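/- Let $\Omega=(a,b)$ be a non-empty bounded open interval in $\mathbb R$ with Lebesgue measure $\lambda$, so $\lambda(\Omega)=b-a$. For $s\ge 0$ and $f\in L^2(\Omega)$ let $$\|f\|_{s,2}^2=\sum_{0\le\alpha\le\lfloor s\rfloor}\int_\Omega |f^{(\alpha)}|^2\,d\lambda+\int_\Omega\int_\Omega\frac{|f^{(\lfloor s\rfloor)}(x)-f^{(\lfloor s\rfloor)}(y)|^2}{|x-y|^{1+2(s-\lfloor s\rfloor)}}\,d\lambda(x)\,d\lambda(y),$$ where derivatives are weak derivatives, the double integral is omitted when $s$ is an integer, and $\|f\|_{s,2}=\infty$ if one of these weak derivatives does not exist. For $s>1/2$ let $\mathsf W_2^s(\Omega)$ be the space of bounded continuous $f:\Omega\to\mathbb R$ with $\|f\|_{s,2}<\infty$. Write $\|f\|_\Omega=\sup_{x\in\Omega}|f(x)|$. Fix $t>1/2$, $\zeta\ge 0$ and $D>0$ with $\zeta<\lambda(\Omega)^{-1}<D^2$, and put $$\mathcal P(t,\zeta,D)=\Big\{p\in\mathsf W_2^t(\Omega):\int_\Omega p\,d\lambda=1,\ \inf_{x\in\Omega}p(x)\ge\zeta,\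 \|p\|_{t,2}\le D\Big\}.$$ For $x_1,\dots,x_n\in\Omega$, an NPML-estimator is an element $p$ of $\mathcal P(t,\zeta,D)$ that maximizes $\frac1n\sum_{i=1}^n\log p(x_i)$ over $\mathcal P(t,\zeta,D)$, with $\log 0=-\infty$. Let $X_1,X_2,\dots$ be i.i.d. random variables with values in $\Omega$ and common law $\mathbb P$. Let $\Theta\subseteq\mathbb R^m$ be non-empty and compact, let $p_\theta$, $\theta\in\Theta$, be probability densities on $\Omega$, let $(V,\mathcal V,\mu)$ be a probability space and let $\rho:V\times\Theta\to\Omega$ be measurable in its first argument and such that, for every $\theta\in\Theta$, the law of $\rho(\cdot,\theta)$ under $\mu$ has density $p_\theta$. Let $V_1,V_2,\dots$ be i.i.d. random variables with values in $V$ and common law $\mu$. Then an NPML-estimator exists for all $n\ge1$ and all $x_1,\dots,x_n\in\Omega$. Let $\hat p_n$ denote an NPML-estimator for $X_1,\dots,X_n$ (a function of these data), and let $\tilde p_k(\theta)$ denote an NPML-estimator for the simulated data $\rho(V_1,\theta),\dots,\rho(V_k,\theta)$ (a function of $\theta$ and $V_1,\dots,V_k$). For every such choice of estimators the following hold. (a)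 If $\mathbb P$ has a density $p_\blacktriangle\in\mathcal P(t,\zeta,D)$, then $\lim_{n\to\infty}\|\hat p_n-p_\blacktriangle\|_{s,2}=0$ almost surely for every $s$ with $0\le s<t$; in particular, $\lim_{n\to\infty}\|\hat p_n-p_\blacktriangle\|_\Omega=0$ almost surely. (b) If $p_\theta\in\mathcal P(t,\zeta,D)$ for a given $\theta\in\Theta$, then, for this $\theta$, $\lim_{k\to\infty}\|\tilde p_k(\theta)-p_\theta\|_{s,2}=0$ almost surely for every $s$ with $0\le s<t$; in particular, $\lim_{k\to\infty}\|\tilde p_k(\theta)-p_\theta\|_\Omega=0$ almost surely. (c) If $p_\theta\in\mathcal P(t,\zeta,D)$ for every $\theta\in\Theta$, $\inf_{x\in\Omega,\theta\in\Theta}p_\theta(x)>0$, and $\theta\mapsto\rho(v,\theta)$ is continuous on $\Theta$ for every $v\in V$, then $\lim_{k\to\infty}\sup_{\theta\in\Theta}\|\tilde p_k(\theta)-p_\theta\|_{s,2}=0$ almost surely for every $s$ with $0\le s<t$; in particular, $\lim_{k\to\infty}\sup_{\theta\in\Theta}\|\tilde p_k(\theta)-p_\theta\|_\Omega=0$ almost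 surely. -/

import Mathlib

open Set MeasureTheory ProbabilityTheory Filter Topology
open scoped ENNReal ContDiff

namespace NPML

/-- The bounded open interval `(a, b)` as a type, with its Borel `σ`-field. -/
abbrev Dom (a b : ℝ) : Type := ↥(Set.Ioo a b)

/-- Lebesgue measure on `(a, b)`. -/
noncomputable def leb (a b : ℝ) : Measure (Dom a b) := Measure.comap Subtype.val volume

variable {a b : ℝ}

/-- `g` is a weak derivative of order `α` of `f` on `(a, b)`: both functions are locally integrable
and `∫ f φ⁽ᵅ⁾ = (-1)ᵅ ∫ g φ` for all smooth `φ` with compact support contained in `(a, b)`. -/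
def IsWeakDeriv (α : ℕ) (f g : Dom a b → ℝ) : Prop :=
  LocallyIntegrable f (leb a b) ∧ LocallyIntegrable g (leb a b) ∧
    ∀ φ : ℝ → ℝ, ContDiff ℝ ∞ φ → HasCompactSupport φ → tsupport φ ⊆ Set.Ioo a b →
      ∫ x, f x * iteratedDeriv α φ x ∂(leb a b) = (-1) ^ α * ∫ x, g x * φ x ∂(leb a b)

open Classical in
/-- The weak derivative of order `α` (unique up to null sets); zero if there is none. -/
noncomputable def weakDeriv (α : ℕ) (f : Dom a b → ℝ) : Dom a b → ℝ :=
  if h : ∃ g, IsWeakDeriv α f g then h.choose else 0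

/-- The double integral of `(g x - g y)² / |x - y|^(1 + 2σ)`. -/
noncomputable def gagliardo (σ : ℝ) (g : Dom a b → ℝ) : ℝ≥0∞ :=
  ∫⁻ y, ∫⁻ x, ENNReal.ofReal ((g x - g y) ^ 2 / |(x : ℝ) - (y : ℝ)| ^ (1 + 2 * σ))
    ∂(leb a b) ∂(leb a b)

open Classical in
/-- The Sobolev norm `‖f‖_{s,2}` of order `s ≥ 0`, with values in `[0, ∞]`. It is infinite if one
of the weak derivatives of order at most `⌊s⌋` does not exist. -/
noncomputable def sobolevNorm (s : ℝ) (f : Dom a b → ℝ) : ℝ≥0∞ :=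
  if ∀ α ≤ ⌊s⌋₊, ∃ g, IsWeakDeriv α f g then
    ((∑ α ∈ Finset.range (⌊s⌋₊ + 1), ∫⁻ x, ‖weakDeriv α f x‖ₑ ^ 2 ∂(leb a b)) +
      (if s = (⌊s⌋₊ : ℝ) then 0 else gagliardo (s - (⌊s⌋₊ : ℝ)) (weakDeriv ⌊s⌋₊ f)))
      ^ (1 / 2 : ℝ)
  else ⊤

/-- The sup-norm on `(a, b)`, with values in `[0, ∞]`. -/
noncomputable def supNorm (f : Dom a b → ℝ) : ℝ≥0∞ := ⨆ x, ‖f x‖ₑ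

/-- The Sobolev space of bounded continuous functions with finite `‖·‖_{s,2}` (for `s > 1/2`). -/
def sobolevSpace (a b s : ℝ) : Set (Dom a b → ℝ) :=
  {f | Continuous f ∧ (∃ C : ℝ, ∀ x, |f x| ≤ C) ∧ sobolevNorm s f < ⊤}

/-- The set `𝒫(t, ζ, D)` of probability densities on `(a, b)`. -/
def densities (a b t ζ D : ℝ) : Set (Dom a b → ℝ) :=
  {p | p ∈ sobolevSpace a b t ∧ ∫ x, p x ∂(leb a b) = 1 ∧ (∀ x, ζ ≤ p x) ∧
    sobolevNorm t p ≤ ENNReal.ofReal D}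

/-- The log-likelihood `n⁻¹ ∑ log p(xᵢ)` in `[-∞, ∞)`, with `log 0 = -∞` (for `p ≥ 0`). -/
noncomputable def logLik {n : ℕ} (x : Fin n → Dom a b) (p : Dom a b → ℝ) : EReal :=
  (((n : ℝ)⁻¹ : ℝ) : EReal) * ∑ i, ENNReal.log (ENNReal.ofReal (p (x i)))

/-- `p` is an NPML-estimator over `𝒫(t, ζ, D)` for the data points `x₁, …, xₙ`. -/
def IsNPML (t ζ D : ℝ) {n : ℕ} (x : Fin n → Dom a b) (p : Dom a b → ℝ) : Prop :=
  p ∈ densities a b t ζ D ∧ logLik x p = ⨆ q ∈ densities a b t ζ D, logLik x q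

/-- The measurable non-negative function `p` is a density of `P` with respect to Lebesgue
measure. -/
def IsDensity (P : Measure (Dom a b)) (p : Dom a b → ℝ) : Prop :=
  Measurable p ∧ (∀ x, 0 ≤ p x) ∧ P = (leb a b).withDensity (fun x => ENNReal.ofReal (p x))

end NPML

namespace NPML

variable {a b : ℝ}

/-! ### Lebesgue measure on the interval. -/

section Lebesgue

/-! Consistency comes from compactness of the model in the sup-norm together with one inequality for
the maximum likelihood.

Compactness: for `t > 1/2` a bound `D` on the Sobolev norm gives a Hölder bound depending only on
the interval, `t` and `D` (`exists_holder_bound`, through a Campanato argument). Extended to `[a,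
b]`, the densities are therefore bounded and equicontinuous. They are closed under uniform limits
(`mem_densities_of_forall_approx`): the parallelogram law turns a near-minimizing sequence of
approximants into a Cauchy sequence in the Sobolev norm. Arzelà–Ascoli gives
`isCompact_extDensities`, and since the likelihood product is continuous, estimators exist.

Likelihood: the model is closed under midpoints. Comparing an estimator `q` with its midpoint to the
true density `p` shows that the average of `2p/(q + p)` over the data is at most `1`
(`IsNPML.sum_div_le`). These ratios lie in `[0, 2]`, so no logarithm has to be integrable, and when
`p` is positive at the data they are continuous in the parameter and in `q`. A one-sided uniform
strong law (`ae_forall_integral_le_one`) carries the inequality to any limit point `q` of the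
estimators: `∫ 2p²/(q + p) ≤ 1`. This forces `q = p` (`eq_of_integral_div_le_one`). By compactness
the sup-norm error tends to zero uniformly in the parameter (`ae_tendsto_supNorm`); fixed densities
are the case of a one-point parameter space. The map from parameters to densities is itself
continuous, by compactness and the continuity of the simulation map
(`exists_continuous_extDensities`).

Lower orders `s < t`: differences of densities are bounded in order `t` and tend to zero uniformly,
so interpolation makes every norm of order `s < t` tend to zero (`tendsto_energy_zero`,
`tendsto_sobolevNorm_sub`). -/

instance instIsFiniteMeasureLeb : IsFiniteMeasure (leb a b) := by
  refine ⟨?_⟩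
  rw [leb, comap_subtype_coe_apply measurableSet_Ioo]
  exact (measure_mono (Subtype.coe_image_subset _ _)).trans_lt measure_Ioo_lt_top

theorem measurableEmbedding_val : MeasurableEmbedding (Subtype.val : Dom a b → ℝ) :=
  MeasurableEmbedding.subtype_coe measurableSet_Ioo

theorem map_val_leb : (leb a b).map Subtype.val = volume.restrict (Ioo a b) := by
  rw [leb, map_comap_subtype_coe measurableSet_Ioo]

theorem leb_preimage (s : Set ℝ) (hs : MeasurableSet s) :
    leb a b (Subtype.val ⁻¹' s) = volume (s ∩ Ioo a b) := by
  rw [← measurableEmbedding_val.map_apply, map_val_leb, Measure.restrict_apply hs]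

theorem leb_univ : leb a b univ = ENNReal.ofReal (b - a) := by
  have := leb_preimage (a := a) (b := b) univ MeasurableSet.univ
  simpa using this

theorem leb_Ioo (x y : ℝ) (hx : a ≤ x) (hy : y ≤ b) :
    leb a b (Subtype.val ⁻¹' (Ioo x y)) = ENNReal.ofReal (y - x) := by
  rw [leb_preimage _ measurableSet_Ioo, inter_eq_left.2 (Ioo_subset_Ioo hx hy), Real.volume_Ioo]

instance instIsOpenPosMeasureLeb : (leb a b).IsOpenPosMeasure := by
  refine ⟨fun U hU hne h0 => ?_⟩
  rw [leb, comap_subtype_coe_apply measurableSet_Ioo] at h0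
  exact ((isOpen_Ioo.isOpenMap_subtype_val U hU).measure_pos volume (hne.image _)).ne' h0

theorem lintegral_leb (f : ℝ → ℝ≥0∞) :
    ∫⁻ x, f x ∂(leb a b) = ∫⁻ x in Ioo a b, f x := by
  rw [← map_val_leb, measurableEmbedding_val.lintegral_map]

theorem integral_leb (f : ℝ → ℝ) :
    ∫ x, f x ∂(leb a b) = ∫ x in Ioo a b, f x := by
  rw [← map_val_leb, measurableEmbedding_val.integral_map]

theorem integrable_of_continuous_bdd {f : Dom a b → ℝ} (hf : Continuous f) {C : ℝ}
    (hC : ∀ x, |f x| ≤ C) : Integrable f (leb a b) :=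
  (integrable_const C).mono' hf.aestronglyMeasurable (ae_of_all _ hC)

end Lebesgue

/-! ### Test functions and the fundamental lemma of the calculus of variations. -/

section TestFunctions

/-- The test functions on the interval `(a, b)`. -/
structure IsTest (a b : ℝ) (φ : ℝ → ℝ) : Prop where
  contDiff : ContDiff ℝ ∞ φ
  hasCompactSupport : HasCompactSupport φ
  tsupport_subset : tsupport φ ⊆ Ioo a b

variable {φ ψ : ℝ → ℝ}

theorem tsupport_iteratedDeriv_subset (φ : ℝ → ℝ) (α : ℕ) :
    tsupport (iteratedDeriv α φ) ⊆ tsupport φ := by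
  induction α with
  | zero => simp
  | succ n ih =>
    rw [iteratedDeriv_succ]
    exact tsupport_deriv_subset.trans ih

protected theorem IsTest.iteratedDeriv (h : IsTest a b φ) (α : ℕ) : IsTest a b (iteratedDeriv α φ) where
  contDiff := by
    rw [iteratedDeriv_eq_iterate]
    exact h.contDiff.iterate_deriv α
  hasCompactSupport := h.hasCompactSupport.of_isClosed_subset (isClosed_tsupport _)
    (tsupport_iteratedDeriv_subset φ α)
  tsupport_subset := (tsupport_iteratedDeriv_subset φ α).trans h.tsupport_subset

protected theorem IsTest.deriv (h : IsTest a b φ) : IsTest a b (deriv φ) := by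
  simpa using h.iteratedDeriv 1

theorem IsTest.continuous (h : IsTest a b φ) : Continuous φ := h.contDiff.continuous

theorem IsTest.eq_zero (h : IsTest a b φ) {x : ℝ} (hx : x ∉ Ioo a b) : φ x = 0 :=
  image_eq_zero_of_notMem_tsupport fun hx' => hx (h.tsupport_subset hx')

theorem IsTest.exists_bound (h : IsTest a b φ) : ∃ C, 0 ≤ C ∧ ∀ x, |φ x| ≤ C := by
  obtain ⟨C, hC⟩ := h.hasCompactSupport.exists_bound_of_continuous h.continuous
  exact ⟨C, (norm_nonneg _).trans (hC 0), hC⟩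

theorem IsTest.hasCompactSupport_val (h : IsTest a b φ) :
    HasCompactSupport (fun x : Dom a b => φ x) := by
  have hK : IsCompact (Subtype.val ⁻¹' tsupport φ : Set (Dom a b)) := by
    rw [Topology.IsEmbedding.subtypeVal.isInducing.isCompact_iff, Subtype.image_preimage_coe,
      inter_eq_right.2 h.tsupport_subset]
    exact h.hasCompactSupport
  refine HasCompactSupport.of_support_subset_isCompact hK fun x hx => ?_
  exact subset_tsupport _ hx

theorem IsTest.integrable_mul (h : IsTest a b φ) {f : Dom a b → ℝ}
    (hf : LocallyIntegrable f (leb a b)) : Integrable (fun x => f x * φ x) (leb a b) := by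
  have := hf.integrable_smul_left_of_hasCompactSupport
    (h.continuous.comp continuous_subtype_val) h.hasCompactSupport_val
  refine this.congr (ae_of_all _ fun x => ?_)
  simp [mul_comm]

theorem IsTest.integral_val (h : IsTest a b φ) : ∫ x, φ x ∂(leb a b) = ∫ x, φ x := by
  rw [integral_leb]
  exact setIntegral_eq_integral_of_forall_compl_eq_zero fun x hx => h.eq_zero hx

theorem IsTest.integrable (h : IsTest a b φ) : Integrable φ :=
  h.continuous.integrable_of_hasCompactSupport h.hasCompactSupport

theorem IsTest.add (h : IsTest a b φ) (h' : IsTest a b ψ) : IsTest a b (fun x => φ x + ψ x) where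
  contDiff := h.contDiff.add h'.contDiff
  hasCompactSupport := h.hasCompactSupport.add h'.hasCompactSupport
  tsupport_subset := (tsupport_add φ ψ).trans (union_subset h.tsupport_subset h'.tsupport_subset)

theorem IsTest.const_mul (h : IsTest a b φ) (c : ℝ) : IsTest a b (fun x => c * φ x) where
  contDiff := contDiff_const.mul h.contDiff
  hasCompactSupport := h.hasCompactSupport.mul_left
  tsupport_subset := (tsupport_mul_subset_right (f := fun _ => c)).trans h.tsupport_subset

/-- The fundamental lemma on open subsets of `ℝ`, transported to the subtype by extending `h` by
zero. Uniqueness of weak derivatives rests on it. -/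
theorem ae_eq_zero_of_forall_isTest {h : Dom a b → ℝ} (hh : LocallyIntegrable h (leb a b))
    (H : ∀ φ, IsTest a b φ → ∫ x, h x * φ x ∂(leb a b) = 0) : h =ᵐ[leb a b] 0 := by
  set h' : ℝ → ℝ := Function.extend Subtype.val h 0 with hh'
  have hval : ∀ x : Dom a b, h' x = h x := fun x => Subtype.val_injective.extend_apply _ _ _
  have hloc : LocallyIntegrableOn h' (Ioo a b) volume := by
    rw [locallyIntegrableOn_iff isOpen_Ioo.isLocallyClosed]
    intro K hKU hK
    have hK' : IsCompact (Subtype.val ⁻¹' K : Set (Dom a b)) := by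
      rw [Topology.IsEmbedding.subtypeVal.isInducing.isCompact_iff, Subtype.image_preimage_coe,
        inter_eq_right.2 hKU]
      exact hK
    have h1 : IntegrableOn h' K (volume.restrict (Ioo a b)) := by
      rw [← map_val_leb, measurableEmbedding_val.integrableOn_map_iff]
      refine (hh.integrableOn_isCompact hK').congr (ae_of_all _ fun x => ?_)
      simp [hval]
    rwa [IntegrableOn, Measure.restrict_restrict hK.measurableSet, inter_eq_left.2 hKU] at h1
  have key := isOpen_Ioo.ae_eq_zero_of_integral_contDiff_smul_eq_zero hloc (fun g g1 g2 g3 => by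
    have hg : IsTest a b g := ⟨g1, g2, g3⟩
    have := H g hg
    rw [← setIntegral_eq_integral_of_forall_compl_eq_zero (s := Ioo a b)
      (fun x hx => by simp [hg.eq_zero hx]), ← integral_leb]
    rw [← this]
    refine integral_congr_ae (ae_of_all _ fun x => ?_)
    simp [hval, mul_comm])
  have h2 : ∀ᵐ x ∂((leb a b).map Subtype.val), h' x = 0 := by
    rw [map_val_leb]
    exact (ae_restrict_iff' measurableSet_Ioo).2 key
  have h3 := measurableEmbedding_val.ae_map_iff.1 h2
  filter_upwards [h3] with x hx
  simpa [hval] using hx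

end TestFunctions

/-! ### Algebra of weak derivatives. -/

section WeakDerivatives

variable {α : ℕ} {f f' g g' : Dom a b → ℝ}

theorem IsWeakDeriv.integral_eq (h : IsWeakDeriv α f g) {φ : ℝ → ℝ} (hφ : IsTest a b φ) :
    ∫ x, f x * iteratedDeriv α φ x ∂(leb a b) = (-1) ^ α * ∫ x, g x * φ x ∂(leb a b) :=
  h.2.2 φ hφ.1 hφ.2 hφ.3

theorem IsWeakDeriv.unique (h : IsWeakDeriv α f g) (h' : IsWeakDeriv α f g') :
    g =ᵐ[leb a b] g' := by
  have := ae_eq_zero_of_forall_isTest (h.2.1.sub h'.2.1) fun φ hφ => by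
    simp only [Pi.sub_apply, sub_mul]
    rw [integral_sub (hφ.integrable_mul h.2.1) (hφ.integrable_mul h'.2.1), sub_eq_zero]
    have := (h.integral_eq hφ).symm.trans (h'.integral_eq hφ)
    exact mul_left_cancel₀ (pow_ne_zero _ (by norm_num)) this
  filter_upwards [this] with x hx
  exact sub_eq_zero.1 hx

theorem IsWeakDeriv.congr (h : IsWeakDeriv α f g) (hf : f =ᵐ[leb a b] f')
    (hg : g =ᵐ[leb a b] g') : IsWeakDeriv α f' g' := by
  refine ⟨h.1.congr hf, h.2.1.congr hg, fun φ h1 h2 h3 => ?_⟩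
  have e1 : ∫ x, f x * iteratedDeriv α φ x ∂(leb a b) = ∫ x, f' x * iteratedDeriv α φ x ∂(leb a b) :=
    integral_congr_ae (hf.mono fun x hx => by simp only [hx])
  have e2 : ∫ x, g x * φ x ∂(leb a b) = ∫ x, g' x * φ x ∂(leb a b) :=
    integral_congr_ae (hg.mono fun x hx => by simp only [hx])
  rw [← e1, ← e2, h.2.2 φ h1 h2 h3]

theorem isWeakDeriv_zero (hf : LocallyIntegrable f (leb a b)) : IsWeakDeriv 0 f f :=
  ⟨hf, hf, fun φ _ _ _ => by simp⟩

theorem IsWeakDeriv.lin (h : IsWeakDeriv α f g) (h' : IsWeakDeriv α f' g') (c d : ℝ) :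
    IsWeakDeriv α (fun x => c * f x + d * f' x) (fun x => c * g x + d * g' x) := by
  refine ⟨(h.1.smul c).add (h'.1.smul d), (h.2.1.smul c).add (h'.2.1.smul d),
    fun φ h1 h2 h3 => ?_⟩
  have hφ : IsTest a b φ := ⟨h1, h2, h3⟩
  have key : ∀ {u v : Dom a b → ℝ} {χ : ℝ → ℝ}, LocallyIntegrable u (leb a b) →
      LocallyIntegrable v (leb a b) → IsTest a b χ →
      ∫ x, (c * u x + d * v x) * χ x ∂(leb a b) =
        c * ∫ x, u x * χ x ∂(leb a b) + d * ∫ x, v x * χ x ∂(leb a b) := by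
    intro u v χ hu hv hχ
    rw [← integral_const_mul, ← integral_const_mul, ← integral_add
      ((hχ.integrable_mul hu).const_mul c) ((hχ.integrable_mul hv).const_mul d)]
    refine integral_congr_ae (ae_of_all _ fun x => ?_)
    simp only
    ring
  rw [key h.1 h'.1 (hφ.iteratedDeriv α), key h.2.1 h'.2.1 hφ, h.integral_eq hφ, h'.integral_eq hφ]
  ring

theorem IsWeakDeriv.succ (h : IsWeakDeriv α f g) (h' : IsWeakDeriv (α + 1) f f') :
    IsWeakDeriv 1 g f' := by
  refine ⟨h.2.1, h'.2.1, fun φ h1 h2 h3 => ?_⟩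
  have hφ : IsTest a b φ := ⟨h1, h2, h3⟩
  have e1 := h.integral_eq hφ.deriv
  have e2 := h'.integral_eq hφ
  rw [iteratedDeriv_succ', e1] at e2
  have e3 : (-1 : ℝ) ^ α ≠ 0 := pow_ne_zero _ (by norm_num)
  rw [iteratedDeriv_one]
  apply mul_left_cancel₀ e3
  rw [e2]
  ring

theorem isWeakDeriv_const (c : ℝ) (α : ℕ) :
    IsWeakDeriv α (fun _ : Dom a b => c) (fun _ => if α = 0 then c else 0) := by
  refine ⟨locallyIntegrable_const c, locallyIntegrable_const _, fun φ h1 h2 h3 => ?_⟩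
  have hφ : IsTest a b φ := ⟨h1, h2, h3⟩
  rcases α with _ | α
  · simp
  · have h4 : ∫ x, iteratedDeriv (α + 1) φ x = 0 := by
      rw [iteratedDeriv_succ]
      have h5 := hφ.iteratedDeriv α
      exact integral_eq_zero_of_hasDerivAt_of_integrable
        (fun x => (h5.contDiff.differentiable (by simp) x).hasDerivAt) h5.deriv.integrable
        h5.integrable
    simp [integral_const_mul, (hφ.iteratedDeriv (α + 1)).integral_val, h4]

end WeakDerivatives

/-! ### The squared Sobolev norm as a single integral over the square. -/

section Energy

/-- The integrand of the Gagliardo double integral. -/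
noncomputable def gagKernel (σ : ℝ) (g : Dom a b → ℝ) (p : Dom a b × Dom a b) : ℝ :=
  (g p.1 - g p.2) ^ 2 / |(p.1 : ℝ) - (p.2 : ℝ)| ^ (1 + 2 * σ)

theorem gagKernel_nonneg (σ : ℝ) (g : Dom a b → ℝ) (p : Dom a b × Dom a b) :
    0 ≤ gagKernel σ g p := by
  unfold gagKernel
  positivity

theorem measurable_gagKernel (σ : ℝ) {g : Dom a b → ℝ} (hg : Measurable g) :
    Measurable (gagKernel σ g) := by
  unfold gagKernel
  fun_prop

theorem gagliardo_eq_prod (σ : ℝ) {g : Dom a b → ℝ} (hg : Measurable g) :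
    gagliardo σ g = ∫⁻ p, ENNReal.ofReal (gagKernel σ g p) ∂((leb a b).prod (leb a b)) := by
  rw [lintegral_prod_symm _ (measurable_gagKernel σ hg).ennreal_ofReal.aemeasurable]
  rfl

theorem gagliardo_congr (σ : ℝ) {g g' : Dom a b → ℝ} (h : g =ᵐ[leb a b] g') :
    gagliardo σ g = gagliardo σ g' := by
  unfold gagliardo
  refine lintegral_congr_ae (h.mono fun y hy => lintegral_congr_ae (h.mono fun x hx => ?_))
  simp only [hx, hy]

/-- The squared Sobolev norm of order `s`, as an integrand on the square of the interval, in terms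
of the weak derivatives. -/
noncomputable def energyDensity (s : ℝ) (G : ℕ → Dom a b → ℝ) (p : Dom a b × Dom a b) : ℝ :=
  (∑ α ∈ Finset.range (⌊s⌋₊ + 1), (G α p.1) ^ 2) / (b - a) +
    if s = (⌊s⌋₊ : ℝ) then 0 else gagKernel (s - (⌊s⌋₊ : ℝ)) (G ⌊s⌋₊) p

/-- The squared Sobolev norm of order `s` in terms of the weak derivatives. -/
noncomputable def energy (s : ℝ) (G : ℕ → Dom a b → ℝ) : ℝ≥0∞ :=
  ∫⁻ p, ENNReal.ofReal (energyDensity s G p) ∂((leb a b).prod (leb a b))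

variable {s : ℝ} {G H : ℕ → Dom a b → ℝ}

theorem energyDensity_nonneg (p : Dom a b × Dom a b) : 0 ≤ energyDensity s G p := by
  have hab : 0 < b - a := sub_pos.2 (p.1.2.1.trans p.1.2.2)
  unfold energyDensity
  split_ifs
  · positivity
  · have := gagKernel_nonneg (s - (⌊s⌋₊ : ℝ)) (G ⌊s⌋₊) p
    positivity

theorem measurable_energyDensity (hG : ∀ α, Measurable (G α)) :
    Measurable (energyDensity s G) := by
  unfold energyDensity
  split_ifs
  · fun_prop
  · have := measurable_gagKernel (s - (⌊s⌋₊ : ℝ)) (hG ⌊s⌋₊)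
    fun_prop

/-- The `L²` terms depend on the first coordinate only; integrating out the second gives a factor `b
- a`, which the division in `energyDensity` cancels. With everything in one integrand, the
parallelogram law and Fatou's lemma apply to all terms at once. -/
theorem energy_eq (hab : a < b) (hG : ∀ α, Measurable (G α)) :
    energy s G = (∑ α ∈ Finset.range (⌊s⌋₊ + 1), ∫⁻ x, ‖G α x‖ₑ ^ 2 ∂(leb a b)) +
      (if s = (⌊s⌋₊ : ℝ) then 0 else gagliardo (s - (⌊s⌋₊ : ℝ)) (G ⌊s⌋₊)) := by
  have hab' : 0 < b - a := sub_pos.2 hab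
  have h1 : ∀ p, ENNReal.ofReal (energyDensity s G p) =
      ENNReal.ofReal ((b - a)⁻¹) * (∑ α ∈ Finset.range (⌊s⌋₊ + 1), ‖G α p.1‖ₑ ^ 2) +
      ENNReal.ofReal (if s = (⌊s⌋₊ : ℝ) then 0 else gagKernel (s - (⌊s⌋₊ : ℝ)) (G ⌊s⌋₊) p) := by
    intro p
    unfold energyDensity
    rw [ENNReal.ofReal_add (by positivity)
      (by split_ifs; exacts [le_rfl, gagKernel_nonneg _ _ _]), div_eq_inv_mul,
      ENNReal.ofReal_mul (by positivity), ENNReal.ofReal_sum_of_nonneg (fun _ _ => sq_nonneg _)]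
    congr 2
    refine Finset.sum_congr rfl fun α _ => ?_
    rw [← sq_abs, ENNReal.ofReal_pow (abs_nonneg _), Real.enorm_eq_ofReal_abs]
  have hm : Measurable fun x => ∑ α ∈ Finset.range (⌊s⌋₊ + 1), ‖G α x‖ₑ ^ 2 := by fun_prop
  unfold energy
  simp_rw [h1]
  rw [lintegral_add_left (by fun_prop)]
  congr 1
  · rw [lintegral_const_mul _ (by fun_prop),
      lintegral_prod _ (by fun_prop)]
    simp only [lintegral_const, leb_univ]
    rw [lintegral_mul_const _ hm, lintegral_finsetSum _ (fun α _ => by fun_prop), mul_comm,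
      mul_assoc, ← ENNReal.ofReal_mul hab'.le, mul_inv_cancel₀ hab'.ne', ENNReal.ofReal_one, mul_one]
  · split_ifs with h
    · simp
    · rw [gagliardo_eq_prod _ (hG _)]

/-- The integrand is a pointwise quadratic form in the derivatives, so the identity holds before
integration, and infinite energies need no separate treatment. Its two summands give convexity of
the model and, for near-minimizers, the Cauchy property. -/
theorem energy_parallelogram (hG : ∀ α, Measurable (G α)) (hH : ∀ α, Measurable (H α)) :
    energy s (fun α x => 2⁻¹ * G α x + 2⁻¹ * H α x) +
      energy s (fun α x => 2⁻¹ * G α x + -2⁻¹ * H α x) = 2⁻¹ * energy s G + 2⁻¹ * energy s H := by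
  have hm : ∀ c : ℝ, Measurable (energyDensity s (fun α x => 2⁻¹ * G α x + c * H α x)) :=
    fun c => measurable_energyDensity fun α => by have := hG α; have := hH α; fun_prop
  unfold energy
  rw [← lintegral_add_left (hm _).ennreal_ofReal,
    ← lintegral_const_mul _ (measurable_energyDensity hG).ennreal_ofReal,
    ← lintegral_const_mul _ (measurable_energyDensity hH).ennreal_ofReal,
    ← lintegral_add_left ((measurable_energyDensity hG).ennreal_ofReal.const_mul _)]
  refine lintegral_congr fun p => ?_
  have e : (2⁻¹ : ℝ≥0∞) = ENNReal.ofReal 2⁻¹ := by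
    rw [ENNReal.ofReal_inv_of_pos (by norm_num)]; simp
  rw [e, ← ENNReal.ofReal_mul (by norm_num), ← ENNReal.ofReal_mul (by norm_num),
    ← ENNReal.ofReal_add (energyDensity_nonneg _) (energyDensity_nonneg _),
    ← ENNReal.ofReal_add (mul_nonneg (by norm_num) (energyDensity_nonneg _))
      (mul_nonneg (by norm_num) (energyDensity_nonneg _))]
  congr 1
  unfold energyDensity
  have e1 : ∑ α ∈ Finset.range (⌊s⌋₊ + 1), (2⁻¹ * G α p.1 + 2⁻¹ * H α p.1) ^ 2 =
      2⁻¹ * ∑ α ∈ Finset.range (⌊s⌋₊ + 1), (G α p.1) ^ 2 +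
      2⁻¹ * ∑ α ∈ Finset.range (⌊s⌋₊ + 1), (H α p.1) ^ 2 -
      ∑ α ∈ Finset.range (⌊s⌋₊ + 1), (2⁻¹ * G α p.1 + -2⁻¹ * H α p.1) ^ 2 := by
    rw [Finset.mul_sum, Finset.mul_sum, ← Finset.sum_add_distrib, ← Finset.sum_sub_distrib]
    exact Finset.sum_congr rfl fun α _ => by ring
  rw [e1]
  split_ifs
  · ring
  · unfold gagKernel
    ring

theorem energy_sub_eq (hG : ∀ α, Measurable (G α)) (hH : ∀ α, Measurable (H α)) :
    energy s (fun α x => 1 * G α x + -1 * H α x) =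
      4 * energy s (fun α x => 2⁻¹ * G α x + -2⁻¹ * H α x) := by
  have hm : Measurable (energyDensity s (fun α x => 2⁻¹ * G α x + -2⁻¹ * H α x)) :=
    measurable_energyDensity fun α => by have := hG α; have := hH α; fun_prop
  unfold energy
  rw [← lintegral_const_mul _ hm.ennreal_ofReal]
  refine lintegral_congr fun p => ?_
  rw [← ENNReal.ofReal_ofNat 4, ← ENNReal.ofReal_mul (by norm_num)]
  congr 1
  unfold energyDensity
  have e1 : ∑ α ∈ Finset.range (⌊s⌋₊ + 1), (1 * G α p.1 + -1 * H α p.1) ^ 2 =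
      4 * ∑ α ∈ Finset.range (⌊s⌋₊ + 1), (2⁻¹ * G α p.1 + -2⁻¹ * H α p.1) ^ 2 := by
    rw [Finset.mul_sum]
    exact Finset.sum_congr rfl fun α _ => by ring
  rw [e1]
  split_ifs
  · ring
  · unfold gagKernel
    ring

theorem energy_half_add_le (hG : ∀ α, Measurable (G α)) (hH : ∀ α, Measurable (H α)) :
    energy s (fun α x => 2⁻¹ * G α x + 2⁻¹ * H α x) ≤ 2⁻¹ * energy s G + 2⁻¹ * energy s H :=
  le_self_add.trans_eq (energy_parallelogram hG hH)

theorem energy_half_sub_le (hG : ∀ α, Measurable (G α)) (hH : ∀ α, Measurable (H α)) :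
    energy s (fun α x => 2⁻¹ * G α x + -2⁻¹ * H α x) ≤ 2⁻¹ * energy s G + 2⁻¹ * energy s H :=
  le_add_self.trans_eq (energy_parallelogram hG hH)

theorem lintegral_sq_le_energy (hab : a < b) (hG : ∀ α, Measurable (G α)) {α : ℕ}
    (hα : α ≤ ⌊s⌋₊) : ∫⁻ x, ‖G α x‖ₑ ^ 2 ∂(leb a b) ≤ energy s G := by
  rw [energy_eq hab hG]
  refine le_trans ?_ le_self_add
  exact Finset.single_le_sum (f := fun α => ∫⁻ x, ‖G α x‖ₑ ^ 2 ∂(leb a b)) (fun _ _ => zero_le)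
    (Finset.mem_range.2 (by omega))

theorem gagliardo_le_energy (hab : a < b) (hG : ∀ α, Measurable (G α)) (hs : s ≠ (⌊s⌋₊ : ℝ)) :
    gagliardo (s - (⌊s⌋₊ : ℝ)) (G ⌊s⌋₊) ≤ energy s G := by
  rw [energy_eq hab hG, if_neg hs]
  exact le_add_self

end Energy

/-! ### Measurable families of weak derivatives. -/

section Jets

/-- `G 0, …, G n` are measurable weak derivatives of `f` of the orders `0, …, n`. -/
structure IsJet (n : ℕ) (f : Dom a b → ℝ) (G : ℕ → Dom a b → ℝ) : Prop where
  measurable : ∀ α, Measurable (G α)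
  isWeakDeriv : ∀ α ≤ n, IsWeakDeriv α f (G α)

variable {s : ℝ} {n : ℕ} {f g : Dom a b → ℝ} {G H : ℕ → Dom a b → ℝ}

theorem IsJet.mono (h : IsJet n f G) {m : ℕ} (hm : m ≤ n) : IsJet m f G :=
  ⟨h.1, fun α hα => h.2 α (hα.trans hm)⟩

theorem IsJet.lin (hG : IsJet n f G) (hH : IsJet n g H) (c d : ℝ) :
    IsJet n (fun x => c * f x + d * g x) (fun α x => c * G α x + d * H α x) :=
  ⟨fun α => ((hG.1 α).const_mul c).add ((hH.1 α).const_mul d),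
    fun α hα => (hG.2 α hα).lin (hH.2 α hα) c d⟩

/-- Weak derivatives are unique up to null sets, so the arbitrary choice in `weakDeriv` may be
replaced by any measurable representatives. -/
theorem IsJet.sobolevNorm_eq (hab : a < b) (h : IsJet ⌊s⌋₊ f G) :
    sobolevNorm s f = energy s G ^ (1 / 2 : ℝ) := by
  have hex : ∀ α ≤ ⌊s⌋₊, ∃ g, IsWeakDeriv α f g := fun α hα => ⟨_, h.2 α hα⟩
  have hw : ∀ α ≤ ⌊s⌋₊, weakDeriv α f =ᵐ[leb a b] G α := fun α hα => by
    rw [weakDeriv, dif_pos (hex α hα)]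
    exact (hex α hα).choose_spec.unique (h.2 α hα)
  rw [sobolevNorm, if_pos hex, energy_eq hab h.1, gagliardo_congr _ (hw _ le_rfl)]
  congr 2
  refine Finset.sum_congr rfl fun α hα => lintegral_congr_ae ?_
  filter_upwards [hw α (Nat.lt_succ_iff.1 (Finset.mem_range.1 hα))] with x hx
  rw [hx]

theorem exists_isJet (hf : sobolevNorm s f < ⊤) : ∃ G, IsJet ⌊s⌋₊ f G := by
  have hex : ∀ α ≤ ⌊s⌋₊, ∃ g, IsWeakDeriv α f g := by
    by_contra hne
    rw [sobolevNorm, if_neg hne] at hf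
    exact lt_irrefl _ hf
  have : ∀ α, ∃ g : Dom a b → ℝ, Measurable g ∧ (α ≤ ⌊s⌋₊ → IsWeakDeriv α f g) := by
    intro α
    by_cases hα : α ≤ ⌊s⌋₊
    · obtain ⟨g, hg⟩ := hex α hα
      have hm := hg.2.1.aestronglyMeasurable
      exact ⟨hm.mk g, hm.stronglyMeasurable_mk.measurable, fun _ => hg.congr ae_eq_rfl hm.ae_eq_mk⟩
    · exact ⟨0, measurable_zero, fun h => absurd h hα⟩
  choose G hG hG' using this
  exact ⟨G, hG, hG'⟩

theorem rpow_half_le_iff {x y : ℝ≥0∞} : x ^ (1 / 2 : ℝ) ≤ y ↔ x ≤ y ^ 2 := by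
  rw [one_div, ENNReal.rpow_inv_le_iff (by norm_num)]
  norm_cast

theorem IsJet.energy_le (hab : a < b) (h : IsJet ⌊s⌋₊ f G) {D : ℝ} (hD : 0 ≤ D)
    (hf : sobolevNorm s f ≤ ENNReal.ofReal D) : energy s G ≤ ENNReal.ofReal (D ^ 2) := by
  rw [h.sobolevNorm_eq hab, rpow_half_le_iff] at hf
  rw [ENNReal.ofReal_pow hD]
  simpa using hf

theorem IsJet.sobolevNorm_le (hab : a < b) (h : IsJet ⌊s⌋₊ f G) {D : ℝ} (hD : 0 ≤ D)
    (hf : energy s G ≤ ENNReal.ofReal (D ^ 2)) : sobolevNorm s f ≤ ENNReal.ofReal D := by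
  rw [h.sobolevNorm_eq hab, rpow_half_le_iff]
  rw [ENNReal.ofReal_pow hD] at hf
  simpa using hf

end Jets

/-! ### Functions with an integrable weak derivative are primitives. -/

section FundamentalTheorem

theorem exists_isTest_integral_eq_one (hab : a < b) : ∃ χ, IsTest a b χ ∧ ∫ x, χ x = 1 := by
  let B : ContDiffBump ((a + b) / 2) := ⟨(b - a) / 8, (b - a) / 4, by linarith, by linarith⟩
  refine ⟨B.normed volume, ⟨B.contDiff_normed, B.hasCompactSupport_normed, ?_⟩, B.integral_normed⟩
  rw [B.tsupport_normed_eq]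
  intro x hx
  rw [Metric.mem_closedBall, Real.dist_eq, abs_le] at hx
  have h1 : B.rOut = (b - a) / 4 := rfl
  constructor <;> linarith [hx.1, hx.2]

/-- The primitive from the left end of the support vanishes to the left of the support, and to its
right because the total integral is zero; so it is again compactly supported. -/
theorem IsTest.exists_primitive {θ : ℝ → ℝ} (h : IsTest a b θ) (h0 : ∫ x, θ x = 0) :
    ∃ ψ, IsTest a b ψ ∧ deriv ψ = θ := by
  rcases (tsupport θ).eq_empty_or_nonempty with he | hne
  · have hz : θ = 0 := tsupport_eq_empty_iff.1 he
    rw [hz] at h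
    exact ⟨0, h, by rw [hz]; exact deriv_zero⟩
  obtain ⟨c, hc⟩ := h.hasCompactSupport.exists_isLeast hne
  obtain ⟨d, hd⟩ := h.hasCompactSupport.exists_isGreatest hne
  have hder : ∀ x, HasDerivAt (fun x => ∫ t in c..x, θ t) (θ x) x := fun x =>
    intervalIntegral.integral_hasDerivAt_right (h.continuous.intervalIntegrable _ _)
      h.continuous.stronglyMeasurable.stronglyMeasurableAtFilter h.continuous.continuousAt
  have hderiv : deriv (fun x => ∫ t in c..x, θ t) = θ := funext fun x => (hder x).deriv
  have hout : ∀ x, x ∉ Icc c d → θ x = 0 := fun x hx =>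
    image_eq_zero_of_notMem_tsupport fun hx' => hx ⟨hc.2 hx', hd.2 hx'⟩
  have hsupp : tsupport (fun x => ∫ t in c..x, θ t) ⊆ Icc c d := by
    refine closure_minimal (fun x hx => ?_) isClosed_Icc
    by_contra hx'
    refine hx ?_
    simp only
    rcases lt_or_ge x c with hlt | hge
    · rw [intervalIntegral.integral_of_ge hlt.le, integral_Ioc_eq_integral_Ioo,
        setIntegral_eq_zero_of_forall_eq_zero fun y hy => hout y fun hy' => by
          linarith [hy.2, hy'.1], neg_zero]
    · have hxd : d < x := by
        by_contra hcon
        exact hx' ⟨hge, not_lt.1 hcon⟩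
      rw [intervalIntegral.integral_of_le hge, ← integral_Icc_eq_integral_Ioc,
        setIntegral_eq_integral_of_forall_compl_eq_zero, h0]
      exact fun y hy => hout y fun hy' => hy ⟨hy'.1, hy'.2.trans hxd.le⟩
  refine ⟨fun x => ∫ t in c..x, θ t, ⟨?_, ?_, ?_⟩, hderiv⟩
  · rw [contDiff_infty_iff_deriv, hderiv]
    exact ⟨fun x => (hder x).differentiableAt, h.contDiff⟩
  · exact HasCompactSupport.of_support_subset_isCompact isCompact_Icc
      ((subset_tsupport _).trans hsupp)
  · exact hsupp.trans fun x hx => show x ∈ Ioo a b from ⟨(h.tsupport_subset hc.1).1.trans_le hx.1,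
      hx.2.trans_lt (h.tsupport_subset hd.1).2⟩

/-- Du Bois-Reymond: with `χ` a test function of integral one, `φ - (∫ φ) χ` has mean zero and is
thus the derivative of a test function. Testing against it shows that `h - ∫ h χ` annihilates every
`φ`. -/
theorem ae_eq_const_of_forall_isTest_deriv (hab : a < b) {h : Dom a b → ℝ}
    (hh : LocallyIntegrable h (leb a b))
    (H : ∀ ψ, IsTest a b ψ → ∫ x, h x * deriv ψ x ∂(leb a b) = 0) :
    ∃ c, h =ᵐ[leb a b] fun _ => c := by
  obtain ⟨χ, hχ, hχ1⟩ := exists_isTest_integral_eq_one hab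
  set c := ∫ x, h x * χ x ∂(leb a b) with hc
  refine ⟨c, ?_⟩
  have := ae_eq_zero_of_forall_isTest (hh.sub (locallyIntegrable_const c)) fun φ hφ => by
    obtain ⟨ψ, hψ, hψ'⟩ := (hφ.add (hχ.const_mul (-∫ x, φ x))).exists_primitive (by
      rw [integral_add hφ.integrable (hχ.integrable.const_mul _), integral_const_mul, hχ1]
      ring)
    have e := H ψ hψ
    rw [hψ'] at e
    have e1 : ∀ x : Dom a b, h x * (φ x + (-∫ x, φ x) * χ x) =
        h x * φ x + (-∫ x, φ x) * (h x * χ x) := fun x => by ring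
    simp_rw [e1] at e
    rw [integral_add (hφ.integrable_mul hh) ((hχ.integrable_mul hh).const_mul _),
      integral_const_mul, ← hc] at e
    simp only [Pi.sub_apply, sub_mul]
    rw [integral_sub (hφ.integrable_mul hh) (hφ.integrable_mul (locallyIntegrable_const c)),
      integral_const_mul, hφ.integral_val]
    linarith
  filter_upwards [this] with x hx
  exact sub_eq_zero.1 hx

theorem integrable_primitive_kernel {u g : Dom a b → ℝ} (hu : Integrable u (leb a b))
    (hg : Integrable g (leb a b)) :
    Integrable (fun p : Dom a b × Dom a b => {p : Dom a b × Dom a b | p.2 < p.1}.indicator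
      (fun p => u p.1 * g p.2) p) ((leb a b).prod (leb a b)) :=
  (hu.mul_prod hg).indicator (measurableSet_lt measurable_snd measurable_fst)

theorem integrable_primitive {g : Dom a b → ℝ} (hg : Integrable g (leb a b)) :
    Integrable (fun x => ∫ z in Iio x, g z ∂(leb a b)) (leb a b) := by
  have := (integrable_primitive_kernel (integrable_const (1 : ℝ)) hg).integral_prod_left
  refine this.congr (ae_of_all _ fun x => ?_)
  simp only
  rw [← integral_indicator measurableSet_Iio]
  refine integral_congr_ae (ae_of_all _ fun z => ?_)
  simp [indicator]

/-- Fubini on the triangle `z < x`, where the inner integral of `φ'` over `(z, ∞)` is `-φ z`. -/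
theorem isWeakDeriv_primitive {g : Dom a b → ℝ} (hg : Integrable g (leb a b)) :
    IsWeakDeriv 1 (fun x => ∫ z in Iio x, g z ∂(leb a b)) g := by
  refine ⟨(integrable_primitive hg).locallyIntegrable, hg.locallyIntegrable, fun φ h1 h2 h3 => ?_⟩
  have hφ : IsTest a b φ := ⟨h1, h2, h3⟩
  have hu : Integrable (fun x : Dom a b => deriv φ x) (leb a b) := by
    obtain ⟨C, -, hC⟩ := hφ.deriv.exists_bound
    exact integrable_of_continuous_bdd (hφ.deriv.continuous.comp continuous_subtype_val)
      fun x => hC x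
  have hsw := integral_integral_swap (f := fun x z : Dom a b =>
    {p : Dom a b × Dom a b | p.2 < p.1}.indicator (fun p => deriv φ p.1 * g p.2) (x, z))
    (integrable_primitive_kernel hu hg)
  have e1 : ∀ x : Dom a b, ∫ z, {p : Dom a b × Dom a b | p.2 < p.1}.indicator
      (fun p => deriv φ p.1 * g p.2) (x, z) ∂(leb a b) =
      (∫ z in Iio x, g z ∂(leb a b)) * iteratedDeriv 1 φ x := by
    intro x
    rw [iteratedDeriv_one, mul_comm, ← integral_const_mul, ← integral_indicator measurableSet_Iio]
    refine integral_congr_ae (ae_of_all _ fun z => ?_)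
    simp [indicator]
  have e2 : ∀ z : Dom a b, ∫ x, {p : Dom a b × Dom a b | p.2 < p.1}.indicator
      (fun p => deriv φ p.1 * g p.2) (x, z) ∂(leb a b) = - (g z * φ z) := by
    intro z
    have h5 : ∀ x : Dom a b, {p : Dom a b × Dom a b | p.2 < p.1}.indicator
      (fun p => deriv φ p.1 * g p.2) (x, z) = (Ioi (z : ℝ)).indicator (deriv φ) x * g z := by
      intro x
      simp [indicator]
    simp_rw [h5]
    rw [integral_mul_const, integral_leb, setIntegral_eq_integral_of_forall_compl_eq_zero
      (fun x hx => by simp [indicator, hφ.deriv.eq_zero hx]), integral_indicator measurableSet_Ioi,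
      h2.integral_Ioi_deriv_eq (h1.of_le (by simp))]
    ring
  simp_rw [e1, e2] at hsw
  rw [hsw, integral_neg]
  ring

/-- A function with an integrable weak derivative is a.e. equal to a primitive of it. -/
theorem IsWeakDeriv.exists_ae_eq_primitive (hab : a < b) {w g : Dom a b → ℝ}
    (h : IsWeakDeriv 1 w g) (hg : Integrable g (leb a b)) :
    ∃ c, ∀ᵐ x ∂(leb a b), w x = c + ∫ z in Iio x, g z ∂(leb a b) := by
  have h0 := h.lin (isWeakDeriv_primitive hg) 1 (-1)
  obtain ⟨c, hc⟩ := ae_eq_const_of_forall_isTest_deriv hab h0.1 fun ψ hψ => by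
    have := h0.integral_eq hψ
    rw [iteratedDeriv_one] at this
    rw [this]
    simp
  refine ⟨c, hc.mono fun x hx => ?_⟩
  simp only at hx
  linarith

theorem sq_lintegral_le {X : Type*} [MeasurableSpace X] (μ : Measure X) {g : X → ℝ≥0∞}
    (hg : AEMeasurable g μ) : (∫⁻ x, g x ∂μ) ^ 2 ≤ μ univ * ∫⁻ x, g x ^ 2 ∂μ := by
  have h := ENNReal.lintegral_mul_le_Lp_mul_Lq μ Real.HolderConjugate.two_two
    (aemeasurable_const (b := (1 : ℝ≥0∞))) hg
  simp only [Pi.mul_apply, one_mul, ENNReal.rpow_ofNat, one_pow, lintegral_one] at h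
  calc (∫⁻ x, g x ∂μ) ^ 2 ≤ (μ univ ^ (1 / 2 : ℝ) * (∫⁻ x, g x ^ 2 ∂μ) ^ (1 / 2 : ℝ)) ^ 2 := by
        gcongr
    _ = _ := by
        rw [← ENNReal.mul_rpow_of_nonneg _ _ (by norm_num), ← ENNReal.rpow_natCast,
          ← ENNReal.rpow_mul]
        norm_num

theorem integrable_of_lintegral_sq_lt_top {g : Dom a b → ℝ} (hm : Measurable g)
    (hg : ∫⁻ x, ‖g x‖ₑ ^ 2 ∂(leb a b) < ⊤) : Integrable g (leb a b) := by
  refine ⟨hm.aestronglyMeasurable, ?_⟩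
  have := (sq_lintegral_le (leb a b) hm.enorm.aemeasurable).trans_lt
    (ENNReal.mul_lt_top (measure_lt_top _ _) hg)
  rw [HasFiniteIntegral]
  by_contra hcon
  rw [not_lt, top_le_iff] at hcon
  rw [hcon] at this
  simp at this

end FundamentalTheorem

/-! ### A square integrable derivative controls the fractional seminorms. -/

section GagliardoOfWeakDeriv

instance instNoAtomsLeb : NullSingletonClass (leb a b) := by
  refine ⟨fun x => ?_⟩
  rw [leb, comap_subtype_coe_apply measurableSet_Ioo, image_singleton]
  exact measure_singleton _

theorem leb_Ioo_dom (x y : Dom a b) : leb a b (Ioo x y) = ENNReal.ofReal ((y : ℝ) - x) :=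
  leb_Ioo (x : ℝ) (y : ℝ) x.2.1.le y.2.2.le

theorem lintegral_abs_rpow_lt_top {σ L : ℝ} (h0 : 0 < σ) (h1 : σ < 1) :
    ∫⁻ r, (Ioo (-L) L).indicator (fun r => ENNReal.ofReal (|r| ^ (-σ))) r < ⊤ := by
  set h : ℝ → ℝ≥0∞ := (Ioc 0 L).indicator (fun r => ENNReal.ofReal (r ^ (-σ))) with hh
  have hm : Measurable h := by
    have : Measurable fun r : ℝ => ENNReal.ofReal (r ^ (-σ)) := by fun_prop
    exact this.indicator measurableSet_Ioc
  have hfin : ∫⁻ r, h r < ⊤ := by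
    rw [hh, lintegral_indicator measurableSet_Ioc]
    have := (intervalIntegral.intervalIntegrable_rpow' (a := 0) (b := L) (r := -σ)
      (by linarith)).1
    exact this.lintegral_lt_top
  calc _ ≤ ∫⁻ r, (h r + h (-r)) := by
        refine lintegral_mono fun r => ?_
        simp only [indicator]
        split_ifs with hr
        · rcases lt_trichotomy r 0 with hlt | heq | hgt
          · have hm' : -r ∈ Ioc 0 L := ⟨by linarith, by linarith [hr.1]⟩
            rw [abs_of_neg hlt]
            refine le_trans (le_of_eq ?_) le_add_self
            simp [hh, hm'.1, hm'.2]
          · subst heq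
            simp [Real.zero_rpow (neg_ne_zero.2 h0.ne')]
          · have hm' : r ∈ Ioc 0 L := ⟨hgt, hr.2.le⟩
            rw [abs_of_pos hgt]
            refine le_trans (le_of_eq ?_) le_self_add
            simp [hh, hm'.1, hm'.2]
        · exact zero_le
    _ < ⊤ := by
        rw [lintegral_add_left hm, lintegral_neg_eq_self]
        exact ENNReal.add_lt_top.2 ⟨hfin, hfin⟩

/-- The singularity is integrable since `σ < 1`, and translation by `z` moves the interval into
`(-(b - a), b - a)`, whence a bound uniform in `z`. -/
theorem exists_lintegral_dist_rpow_le {σ : ℝ} (h0 : 0 < σ) (h1 : σ < 1) :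
    ∃ K : ℝ≥0∞, K < ⊤ ∧ ∀ z : Dom a b,
      ∫⁻ x : Dom a b, ENNReal.ofReal (|(x : ℝ) - z| ^ (-σ)) ∂(leb a b) ≤ K := by
  refine ⟨_, lintegral_abs_rpow_lt_top (L := b - a) h0 h1, fun z => ?_⟩
  rw [lintegral_leb fun x => ENNReal.ofReal (|x - z| ^ (-σ)),
    ← lintegral_indicator measurableSet_Ioo]
  refine le_trans ?_ (lintegral_sub_right_eq_self _ (z : ℝ)).le
  refine lintegral_mono fun x => ?_
  simp only [indicator]
  split_ifs with hx hx'
  · exact le_rfl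
  · exact absurd ⟨by linarith [hx.1, z.2.2], by linarith [hx.2, z.2.1]⟩ hx'
  · exact zero_le
  · exact zero_le

theorem enorm_primitive_sub_le {g : Dom a b → ℝ} (hg : Integrable g (leb a b)) {x y : Dom a b}
    (hxy : x ≤ y) :
    ‖(∫ z in Iio y, g z ∂(leb a b)) - ∫ z in Iio x, g z ∂(leb a b)‖ₑ ≤
      ∫⁻ z in Ioo x y, ‖g z‖ₑ ∂(leb a b) := by
  rw [← Iio_union_Ico_eq_Iio hxy, setIntegral_union _ measurableSet_Ico hg.integrableOn
    hg.integrableOn, add_sub_cancel_left, setLIntegral_congr Ioo_ae_eq_Ico]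
  · exact enorm_integral_le_lintegral_enorm _
  · exact disjoint_left.2 fun z hz hz' => absurd hz (not_lt.2 hz'.1)

/-- Cauchy–Schwarz bounds `c²` by `(y - x) ∫ g²` over `(x, y)`, leaving the weight `(y - x)^(-2σ)`.
For `z` between `x` and `y` this is at most `|y - z|^(-σ) |x - z|^(-σ)`, a product in which `x` and
`y` are separated. -/
theorem ofReal_sq_sub_div_le {g : Dom a b → ℝ} (hm : Measurable g)
    (hg : Integrable g (leb a b)) {σ : ℝ} (h0 : 0 < σ) {x y : Dom a b} (hxy : x < y) {c : ℝ}
    (hc : c = (∫ z in Iio y, g z ∂(leb a b)) - ∫ z in Iio x, g z ∂(leb a b)) :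
    ENNReal.ofReal (c ^ 2 / |(y : ℝ) - x| ^ (1 + 2 * σ)) ≤
      ∫⁻ z, ‖g z‖ₑ ^ 2 * ENNReal.ofReal (|(y : ℝ) - z| ^ (-σ)) *
        ENNReal.ofReal (|(x : ℝ) - z| ^ (-σ)) ∂(leb a b) := by
  have hpos : 0 < (y : ℝ) - x := sub_pos.2 hxy
  have e1 : ENNReal.ofReal (c ^ 2) ≤
      ENNReal.ofReal ((y : ℝ) - x) * ∫⁻ z in Ioo x y, ‖g z‖ₑ ^ 2 ∂(leb a b) := by
    have h2 := sq_lintegral_le ((leb a b).restrict (Ioo x y)) hm.enorm.aemeasurable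
    rw [Measure.restrict_apply_univ, leb_Ioo_dom] at h2
    refine le_trans ?_ h2
    rw [← sq_abs, ENNReal.ofReal_pow (abs_nonneg _), ← Real.enorm_eq_ofReal_abs, hc]
    gcongr
    exact enorm_primitive_sub_le hg hxy.le
  rw [abs_of_pos hpos]
  have e2 : c ^ 2 / ((y : ℝ) - x) ^ (1 + 2 * σ) =
      c ^ 2 * (((y : ℝ) - x)⁻¹ * (((y : ℝ) - x) ^ (-σ) * ((y : ℝ) - x) ^ (-σ))) := by
    rw [← Real.rpow_add hpos, ← Real.rpow_neg_one, ← Real.rpow_add hpos, div_eq_mul_inv,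
      ← Real.rpow_neg hpos.le]
    ring_nf
  rw [e2, ENNReal.ofReal_mul (sq_nonneg _), ENNReal.ofReal_mul (by positivity),
    ENNReal.ofReal_mul (by positivity)]
  calc _ ≤ ENNReal.ofReal ((y : ℝ) - x) * (∫⁻ z in Ioo x y, ‖g z‖ₑ ^ 2 ∂(leb a b)) *
        (ENNReal.ofReal ((y : ℝ) - x)⁻¹ * (ENNReal.ofReal (((y : ℝ) - x) ^ (-σ)) *
          ENNReal.ofReal (((y : ℝ) - x) ^ (-σ)))) := by gcongr
    _ = (ENNReal.ofReal ((y : ℝ) - x) * ENNReal.ofReal ((y : ℝ) - x)⁻¹) *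
        ((∫⁻ z in Ioo x y, ‖g z‖ₑ ^ 2 ∂(leb a b)) *
          (ENNReal.ofReal (((y : ℝ) - x) ^ (-σ)) * ENNReal.ofReal (((y : ℝ) - x) ^ (-σ)))) := by
        ring
    _ = ∫⁻ z in Ioo x y, ‖g z‖ₑ ^ 2 * (ENNReal.ofReal (((y : ℝ) - x) ^ (-σ)) *
          ENNReal.ofReal (((y : ℝ) - x) ^ (-σ))) ∂(leb a b) := by
        rw [← ENNReal.ofReal_mul hpos.le, mul_inv_cancel₀ hpos.ne', ENNReal.ofReal_one, one_mul,
          lintegral_mul_const _ (by fun_prop)]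
    _ ≤ ∫⁻ z in Ioo x y, ‖g z‖ₑ ^ 2 * ENNReal.ofReal (|(y : ℝ) - z| ^ (-σ)) *
        ENNReal.ofReal (|(x : ℝ) - z| ^ (-σ)) ∂(leb a b) := by
        refine setLIntegral_mono' measurableSet_Ioo fun z hz => ?_
        have hz1 : (x : ℝ) < z := hz.1
        have hz2 : (z : ℝ) < y := hz.2
        rw [mul_assoc, abs_of_pos (sub_pos.2 hz2), abs_of_neg (sub_neg.2 hz1), neg_sub]
        gcongr ?_ * (ENNReal.ofReal ?_ * ENNReal.ofReal ?_)
        · exact le_rfl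
        · exact Real.rpow_le_rpow_of_nonpos (by linarith) (by linarith) (by linarith)
        · exact Real.rpow_le_rpow_of_nonpos (by linarith) (by linarith) (by linarith)
    _ ≤ _ := setLIntegral_le_lintegral _ _

/-- A function with a square integrable weak derivative has finite Gagliardo seminorms of all
orders below one. -/
theorem exists_gagliardo_le_of_isWeakDeriv (hab : a < b) {σ : ℝ} (h0 : 0 < σ) (h1 : σ < 1) :
    ∃ K : ℝ≥0∞, K < ⊤ ∧ ∀ w g : Dom a b → ℝ, Measurable g → IsWeakDeriv 1 w g →
      ∫⁻ x, ‖g x‖ₑ ^ 2 ∂(leb a b) < ⊤ →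
      gagliardo σ w ≤ K * ∫⁻ x, ‖g x‖ₑ ^ 2 ∂(leb a b) := by
  obtain ⟨K, hK, hK'⟩ := exists_lintegral_dist_rpow_le (a := a) (b := b) h0 h1
  refine ⟨K * K, ENNReal.mul_lt_top hK hK, fun w g hm hwg hfin => ?_⟩
  have hg := integrable_of_lintegral_sq_lt_top hm hfin
  obtain ⟨c, hc⟩ := hwg.exists_ae_eq_primitive hab hg
  set k : Dom a b → Dom a b → ℝ≥0∞ := fun x z => ENNReal.ofReal (|(x : ℝ) - z| ^ (-σ)) with hk
  have hkm : Measurable (Function.uncurry k) := by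
    simp only [hk, Function.uncurry_def]
    fun_prop
  have hk1 : ∀ z, Measurable fun x => k x z := fun z =>
    hkm.comp (measurable_id.prodMk measurable_const)
  have hk2 : ∀ x, Measurable fun z => k x z := fun x =>
    hkm.comp (measurable_const.prodMk measurable_id)
  have hpt : ∀ᵐ y ∂(leb a b), ∀ᵐ x ∂(leb a b),
      ENNReal.ofReal ((w x - w y) ^ 2 / |(x : ℝ) - y| ^ (1 + 2 * σ)) ≤
        ∫⁻ z, ‖g z‖ₑ ^ 2 * k y z * k x z ∂(leb a b) := by
    filter_upwards [hc] with y hy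
    filter_upwards [hc] with x hx
    rcases lt_trichotomy x y with hlt | heq | hgt
    · refine le_trans (le_of_eq ?_) (ofReal_sq_sub_div_le hm hg h0 hlt (c := w y - w x)
        (by rw [hx, hy]; ring))
      rw [abs_sub_comm, ← neg_sub, neg_sq]
    · subst heq
      simp
    · refine (ofReal_sq_sub_div_le hm hg h0 hgt (c := w x - w y)
        (by rw [hx, hy]; ring)).trans (le_of_eq ?_)
      refine lintegral_congr fun z => ?_
      simp only [hk]
      ring
  -- By Tonelli `x` and then `y` are integrated out at fixed `z`, each contributing one factor `K`.
  calc gagliardo σ w ≤ ∫⁻ y, ∫⁻ x, ∫⁻ z, ‖g z‖ₑ ^ 2 * k y z * k x z ∂(leb a b) ∂(leb a b)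
        ∂(leb a b) := lintegral_mono_ae (hpt.mono fun y hy => lintegral_mono_ae hy)
    _ = ∫⁻ y, ∫⁻ z, ∫⁻ x, ‖g z‖ₑ ^ 2 * k y z * k x z ∂(leb a b) ∂(leb a b) ∂(leb a b) := by
        refine lintegral_congr fun y => lintegral_lintegral_swap ?_
        have := hk2 y
        have h5 : Measurable fun p : Dom a b × Dom a b => k p.1 p.2 := hkm
        simp only [Function.uncurry_def]
        fun_prop
    _ ≤ ∫⁻ y, ∫⁻ z, ‖g z‖ₑ ^ 2 * k y z * K ∂(leb a b) ∂(leb a b) := by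
        refine lintegral_mono fun y => lintegral_mono fun z => ?_
        simp only
        rw [lintegral_const_mul _ (hk1 z)]
        gcongr
        exact hK' z
    _ = ∫⁻ z, ∫⁻ y, ‖g z‖ₑ ^ 2 * k y z * K ∂(leb a b) ∂(leb a b) := by
        refine lintegral_lintegral_swap ?_
        have h5 : Measurable fun p : Dom a b × Dom a b => k p.1 p.2 := hkm
        simp only [Function.uncurry_def]
        fun_prop
    _ ≤ ∫⁻ z, ‖g z‖ₑ ^ 2 * (K * K) ∂(leb a b) := by
        refine lintegral_mono fun z => ?_
        simp only
        rw [lintegral_mul_const _ ((hk1 z).const_mul _), lintegral_const_mul _ (hk1 z), mul_assoc]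
        gcongr
        exact hK' z
    _ = _ := by rw [lintegral_mul_const _ (by fun_prop), mul_comm]

end GagliardoOfWeakDeriv

/-! ### Interpolation inequalities. -/

section Interpolation

/-- Split at distance `δ` from the diagonal: nearby, the surplus `|x - y|^(2(σ - σ'))` is at most
`δ^(2(σ - σ'))`; away from it, the kernel is bounded and the numerator is at most `2 (w x² + w y²)`.
-/
theorem gagliardo_le_add {σ σ' δ : ℝ} (hσ' : 0 ≤ σ') (h : σ' ≤ σ) (hδ : 0 < δ)
    {w : Dom a b → ℝ} (hw : Measurable w) :
    gagliardo σ' w ≤ ENNReal.ofReal (δ ^ (2 * (σ - σ'))) * gagliardo σ w +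
      ENNReal.ofReal (4 * (b - a) / δ ^ (1 + 2 * σ')) * ∫⁻ x, ‖w x‖ₑ ^ 2 ∂(leb a b) := by
  rcases lt_or_ge a b with hab | hab
  swap
  · have : IsEmpty (Dom a b) := ⟨fun x => absurd (x.2.1.trans x.2.2) (not_lt.2 hab)⟩
    simp [gagliardo]
  have hab' : 0 < b - a := sub_pos.2 hab
  have hpt : ∀ p : Dom a b × Dom a b, gagKernel σ' w p ≤
      δ ^ (2 * (σ - σ')) * gagKernel σ w p +
        2 / δ ^ (1 + 2 * σ') * (w p.1 ^ 2 + w p.2 ^ 2) := by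
    intro p
    have hn1 : 0 ≤ δ ^ (2 * (σ - σ')) * gagKernel σ w p :=
      mul_nonneg (by positivity) (gagKernel_nonneg _ _ _)
    rcases lt_or_ge |(p.1 : ℝ) - p.2| δ with hlt | hge
    · refine le_trans ?_ (le_add_of_nonneg_right (by positivity))
      rcases (abs_nonneg ((p.1 : ℝ) - p.2)).eq_or_lt with h0 | hpos
      · have h12 : p.1 = p.2 := Subtype.ext (sub_eq_zero.1 (abs_eq_zero.1 h0.symm))
        rw [gagKernel, gagKernel, h12]
        simp
      · have e : |(p.1 : ℝ) - p.2| ^ (1 + 2 * σ) =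
            |(p.1 : ℝ) - p.2| ^ (1 + 2 * σ') * |(p.1 : ℝ) - p.2| ^ (2 * (σ - σ')) := by
          rw [← Real.rpow_add hpos]
          ring_nf
        have hr : |(p.1 : ℝ) - p.2| ^ (2 * (σ - σ')) ≤ δ ^ (2 * (σ - σ')) :=
          Real.rpow_le_rpow hpos.le hlt.le (by linarith)
        have hp1 : 0 < |(p.1 : ℝ) - p.2| ^ (2 * (σ - σ')) := Real.rpow_pos_of_pos hpos _
        have hp2 : 0 < |(p.1 : ℝ) - p.2| ^ (1 + 2 * σ') := Real.rpow_pos_of_pos hpos _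
        rw [gagKernel, gagKernel, e, div_mul_eq_div_div, ← mul_div_assoc, le_div_iff₀ hp1, mul_comm]
        exact mul_le_mul_of_nonneg_right hr (by positivity)
    · refine le_trans ?_ (le_add_of_nonneg_left hn1)
      have hr : δ ^ (1 + 2 * σ') ≤ |(p.1 : ℝ) - p.2| ^ (1 + 2 * σ') :=
        Real.rpow_le_rpow hδ.le hge (by linarith)
      have hp : 0 < δ ^ (1 + 2 * σ') := Real.rpow_pos_of_pos hδ _
      rw [gagKernel, div_mul_eq_mul_div]
      gcongr
      nlinarith [sq_nonneg (w p.1 + w p.2)]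
  rw [gagliardo_eq_prod _ hw, gagliardo_eq_prod _ hw,
    ← lintegral_const_mul _ (measurable_gagKernel σ hw).ennreal_ofReal]
  have hsq : ∀ x, ENNReal.ofReal (w x ^ 2) = ‖w x‖ₑ ^ 2 := fun x => by
    rw [← sq_abs, ENNReal.ofReal_pow (abs_nonneg _), Real.enorm_eq_ofReal_abs]
  have hi : ∫⁻ p, (‖w p.1‖ₑ ^ 2 + ‖w p.2‖ₑ ^ 2) ∂((leb a b).prod (leb a b)) =
      ENNReal.ofReal (2 * (b - a)) * ∫⁻ x, ‖w x‖ₑ ^ 2 ∂(leb a b) := by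
    rw [lintegral_add_left (by fun_prop), lintegral_prod _ (by fun_prop),
      lintegral_prod _ (by fun_prop)]
    simp only [lintegral_const, leb_univ]
    rw [lintegral_mul_const _ (by fun_prop), mul_comm, ← two_mul, ← mul_assoc,
      ENNReal.ofReal_mul (by norm_num)]
    simp
  calc _ ≤ ∫⁻ p, (ENNReal.ofReal (δ ^ (2 * (σ - σ'))) * ENNReal.ofReal (gagKernel σ w p) +
        ENNReal.ofReal (2 / δ ^ (1 + 2 * σ')) * (‖w p.1‖ₑ ^ 2 + ‖w p.2‖ₑ ^ 2))
        ∂((leb a b).prod (leb a b)) := by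
        refine lintegral_mono fun p => ?_
        simp only
        rw [← hsq, ← hsq, ← ENNReal.ofReal_add (sq_nonneg _) (sq_nonneg _),
          ← ENNReal.ofReal_mul (by positivity), ← ENNReal.ofReal_mul (by positivity),
          ← ENNReal.ofReal_add (mul_nonneg (by positivity) (gagKernel_nonneg _ _ _))
            (by positivity)]
        exact ENNReal.ofReal_le_ofReal (hpt p)
    _ = _ := by
        have := measurable_gagKernel σ hw
        rw [lintegral_add_left (by fun_prop), lintegral_const_mul _ (by fun_prop),
          lintegral_const_mul _ (by fun_prop), hi, ← mul_assoc,
          ← ENNReal.ofReal_mul (by positivity)]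
        congr 3
        ring

/-- To keep the support inside `(a, b)`, the bump is placed on the side of `y` that faces the
midpoint of the interval. Only two profiles are translated, which makes the derivative bound uniform
in `y`. -/
theorem exists_uniform_bump {δ : ℝ} (hδ : 0 < δ) (hδ' : δ < (b - a) / 2) (α : ℕ) :
    ∃ C, 0 ≤ C ∧ ∀ y : Dom a b, ∃ φ, IsTest a b φ ∧ (∀ x, 0 ≤ φ x ∧ φ x ≤ 2 / δ) ∧
      (∀ x, φ x ≠ 0 → |x - y| ≤ δ) ∧ ∫ x, φ x = 1 ∧ ∀ x, |iteratedDeriv α φ x| ≤ C := by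
  let B : (c : ℝ) → ContDiffBump c := fun c => ⟨δ / 4, δ / 2, by linarith, by linarith⟩
  have hB : ∀ c, (B c).rOut = δ / 2 := fun c => rfl
  have hbd : ∀ c, ∃ C, 0 ≤ C ∧ ∀ x, |iteratedDeriv α ((B c).normed volume) x| ≤ C := by
    intro c
    have ht : IsTest (c - δ) (c + δ) ((B c).normed volume) := by
      refine ⟨(B c).contDiff_normed, (B c).hasCompactSupport_normed, fun x hx => ?_⟩
      rw [(B c).tsupport_normed_eq, Metric.mem_closedBall, Real.dist_eq, abs_le, hB] at hx
      constructor <;> linarith [hx.1, hx.2]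
    exact (ht.iteratedDeriv α).exists_bound
  obtain ⟨C₁, h₁, hC₁⟩ := hbd (δ / 2)
  obtain ⟨C₂, h₂, hC₂⟩ := hbd (-(δ / 2))
  have key : ∀ c : ℝ, |c| = δ / 2 → ∀ y : Dom a b, a < y + c - δ / 2 → y + c + δ / 2 < b →
      ∀ C, (∀ x, |iteratedDeriv α ((B c).normed volume) x| ≤ C) →
      ∃ φ, IsTest a b φ ∧ (∀ x, 0 ≤ φ x ∧ φ x ≤ 2 / δ) ∧
      (∀ x, φ x ≠ 0 → |x - y| ≤ δ) ∧ ∫ x, φ x = 1 ∧ ∀ x, |iteratedDeriv α φ x| ≤ C := by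
    intro c hc y h1 h2 C hC
    have hs : ∀ x, (B c).normed volume (x - y) ≠ 0 →
        x ∈ Icc (y + c - δ / 2) (y + c + δ / 2) := by
      intro x hx
      have : x - y ∈ Function.support ((B c).normed volume) := hx
      rw [(B c).support_normed_eq, Metric.mem_ball, Real.dist_eq, abs_lt, hB] at this
      constructor <;> linarith [this.1, this.2]
    refine ⟨fun x => (B c).normed volume (x - y), ⟨?_, ?_, ?_⟩, fun x => ⟨(B c).nonneg_normed _, ?_⟩,
      fun x hx => ?_, ?_, fun x => ?_⟩
    · exact (B c).contDiff_normed.comp (contDiff_id.sub contDiff_const)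
    · exact HasCompactSupport.of_support_subset_isCompact isCompact_Icc fun x hx => hs x hx
    · refine (closure_minimal (fun x hx => hs x hx) isClosed_Icc).trans fun x hx => ?_
      exact show x ∈ Ioo a b from ⟨h1.trans_le hx.1, hx.2.trans_lt h2⟩
    · refine ((B c).normed_le_div_measure_closedBall_rIn volume _).trans (le_of_eq ?_)
      have : (B c).rIn = δ / 4 := rfl
      rw [this, Real.volume_real_closedBall (by positivity)]
      field_simp
      norm_num
    · have := hs x hx
      rw [abs_le] at *
      have h3 := neg_abs_le c
      have h4 := le_abs_self c
      constructor <;> linarith [this.1, this.2]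
    · rw [integral_sub_right_eq_self (fun x => (B c).normed volume x) (y : ℝ), (B c).integral_normed]
    · have := congrFun (iteratedDeriv_comp_sub_const α ((B c).normed volume) (y : ℝ)) x
      rw [this]
      exact hC _
  refine ⟨max C₁ C₂, h₁.trans (le_max_left _ _), fun y => ?_⟩
  rcases le_total (y : ℝ) ((a + b) / 2) with hy | hy
  · exact key (δ / 2) (abs_of_pos (by linarith)) y (by linarith [y.2.1]) (by linarith) _
      fun x => (hC₁ x).trans (le_max_left _ _)
  · exact key (-(δ / 2)) (by rw [abs_neg, abs_of_pos (by linarith)]) y (by linarith)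
      (by linarith [y.2.2]) _ fun x => (hC₂ x).trans (le_max_right _ _)

/-- Interpolation of weak derivatives between a Gagliardo seminorm and the sup-norm. -/
theorem exists_lintegral_sq_le_gagliardo_add (hab : a < b) {σ δ : ℝ} (hσ : 0 ≤ σ) (hδ : 0 < δ)
    (hδ' : δ < (b - a) / 2) (α : ℕ) :
    ∃ C, 0 ≤ C ∧ ∀ (u w : Dom a b → ℝ) (κ : ℝ), Measurable w → IsWeakDeriv α u w → 0 ≤ κ →
      (∀ x, |u x| ≤ κ) → ∫⁻ x, ‖w x‖ₑ ^ 2 ∂(leb a b) ≤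
        ENNReal.ofReal (16 * δ ^ (2 * σ)) * gagliardo σ w + ENNReal.ofReal (C * κ ^ 2) := by
  obtain ⟨C, hC0, hC⟩ := exists_uniform_bump hδ hδ' α
  have hab' : 0 < b - a := sub_pos.2 hab
  refine ⟨2 * (C * (b - a)) ^ 2 * (b - a), by positivity, fun u w κ hwm huw hκ hu => ?_⟩
  have hpt : ∀ y : Dom a b, ‖w y‖ₑ ^ 2 ≤ ENNReal.ofReal (16 * δ ^ (2 * σ)) *
      (∫⁻ x, ENNReal.ofReal ((w x - w y) ^ 2 / |(x : ℝ) - (y : ℝ)| ^ (1 + 2 * σ)) ∂(leb a b)) +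
      ENNReal.ofReal (2 * (κ * C * (b - a)) ^ 2) := by
    intro y
    obtain ⟨φ, hφ, hφb, hφs, hφ1, hφC⟩ := hC y
    -- The local mean `A` of `w` near `y` is, up to sign, `∫ u φ⁽ᵅ⁾` and so is controlled by `κ`;
    -- the deviation `w y - A` is controlled by the Gagliardo integrand.
    set A := ∫ x, w x * φ x ∂(leb a b) with hA
    have hAbd : |A| ≤ κ * C * (b - a) := by
      have e := huw.integral_eq hφ
      have e' : |A| = |∫ x, u x * iteratedDeriv α φ x ∂(leb a b)| := by
        rw [e, abs_mul, abs_pow, abs_neg, abs_one, one_pow, one_mul]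
      rw [e', ← Real.norm_eq_abs]
      refine (norm_integral_le_of_norm_le_const (C := κ * C) (ae_of_all _ fun x => ?_)).trans_eq ?_
      · rw [norm_mul, Real.norm_eq_abs, Real.norm_eq_abs]
        exact mul_le_mul (hu x) (hφC x) (abs_nonneg _) hκ
      · rw [measureReal_def, leb_univ, ENNReal.toReal_ofReal hab'.le]
    set N : Set (Dom a b) := Subtype.val ⁻¹' Icc (y - δ) (y + δ) with hN
    have hNm : MeasurableSet N := measurable_subtype_coe measurableSet_Icc
    have hNle : leb a b N ≤ ENNReal.ofReal (2 * δ) := by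
      rw [hN, leb_preimage _ measurableSet_Icc]
      refine (measure_mono inter_subset_left).trans ?_
      rw [Real.volume_Icc]
      exact ENNReal.ofReal_le_ofReal (by linarith)
    have hdiff : ‖w y - A‖ₑ ≤ ENNReal.ofReal (2 / δ) * ∫⁻ x in N, ‖w x - w y‖ₑ ∂(leb a b) := by
      have e : w y - A = ∫ x, (w y - w x) * φ x ∂(leb a b) := by
        simp_rw [sub_mul]
        rw [integral_sub (hφ.integrable_mul (locallyIntegrable_const _))
          (hφ.integrable_mul huw.2.1), integral_const_mul, hφ.integral_val, hφ1, mul_one]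
      rw [e, ← lintegral_const_mul _ (by fun_prop), ← lintegral_indicator hNm]
      refine (enorm_integral_le_lintegral_enorm _).trans (lintegral_mono fun x => ?_)
      simp only
      by_cases hx : φ x = 0
      · simp [hx]
      · have hxN : x ∈ N := by
          have := hφs x hx
          rw [abs_le] at this
          exact ⟨by linarith [this.1], by linarith [this.2]⟩
        rw [indicator_of_mem hxN, enorm_mul, mul_comm, Real.enorm_of_nonneg (hφb x).1,
          ← enorm_neg (w x - w y), neg_sub]
        gcongr
        exact (hφb x).2
    -- Here `8 δ^(2σ) = (2/δ)² · 2δ · δ^(1+2σ)`: the squared bound on `φ`, the measure bound on `N`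
    -- from Cauchy–Schwarz, and the price of inserting the kernel.
    have hdiff2 : ‖w y - A‖ₑ ^ 2 ≤ ENNReal.ofReal (8 * δ ^ (2 * σ)) *
        (∫⁻ x, ENNReal.ofReal ((w x - w y) ^ 2 / |(x : ℝ) - (y : ℝ)| ^ (1 + 2 * σ)) ∂(leb a b)) := by
      have hker : ∀ x ∈ N, ‖w x - w y‖ₑ ^ 2 ≤ ENNReal.ofReal (δ ^ (1 + 2 * σ)) *
          ENNReal.ofReal ((w x - w y) ^ 2 / |(x : ℝ) - (y : ℝ)| ^ (1 + 2 * σ)) := by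
        intro x hx
        rw [← ENNReal.ofReal_mul (by positivity), Real.enorm_eq_ofReal_abs,
          ← ENNReal.ofReal_pow (abs_nonneg _), sq_abs]
        refine ENNReal.ofReal_le_ofReal ?_
        rcases (abs_nonneg ((x : ℝ) - y)).eq_or_lt with h0 | hpos
        · have h12 : x = y := Subtype.ext (sub_eq_zero.1 (abs_eq_zero.1 h0.symm))
          simp [h12]
        · have hp : 0 < |(x : ℝ) - y| ^ (1 + 2 * σ) := Real.rpow_pos_of_pos hpos _
          rw [← mul_div_assoc, le_div_iff₀ hp, mul_comm]
          refine mul_le_mul_of_nonneg_right (Real.rpow_le_rpow hpos.le ?_ (by linarith))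
            (sq_nonneg _)
          rw [abs_le]
          exact ⟨by linarith [hx.1], by linarith [hx.2]⟩
      have hsq := sq_lintegral_le ((leb a b).restrict N) (g := fun x => ‖w x - w y‖ₑ)
        (by fun_prop)
      rw [Measure.restrict_apply_univ] at hsq
      calc ‖w y - A‖ₑ ^ 2 ≤ (ENNReal.ofReal (2 / δ) * ∫⁻ x in N, ‖w x - w y‖ₑ ∂(leb a b)) ^ 2 := by
            gcongr
        _ ≤ ENNReal.ofReal (2 / δ) ^ 2 * (ENNReal.ofReal (2 * δ) *
            ∫⁻ x in N, ENNReal.ofReal (δ ^ (1 + 2 * σ)) *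
              ENNReal.ofReal ((w x - w y) ^ 2 / |(x : ℝ) - (y : ℝ)| ^ (1 + 2 * σ)) ∂(leb a b)) := by
            rw [mul_pow]
            gcongr
            refine hsq.trans (mul_le_mul' hNle ?_)
            exact setLIntegral_mono' hNm hker
        _ ≤ ENNReal.ofReal (2 / δ) ^ 2 * (ENNReal.ofReal (2 * δ) *
            ∫⁻ x, ENNReal.ofReal (δ ^ (1 + 2 * σ)) *
              ENNReal.ofReal ((w x - w y) ^ 2 / |(x : ℝ) - (y : ℝ)| ^ (1 + 2 * σ)) ∂(leb a b)) := by
            gcongr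
            exact Measure.restrict_le_self
        _ = _ := by
            rw [lintegral_const_mul _ (by fun_prop), ← mul_assoc, ← mul_assoc,
              ← ENNReal.ofReal_pow (by positivity), ← ENNReal.ofReal_mul (by positivity),
              ← ENNReal.ofReal_mul (by positivity), Real.rpow_add hδ, Real.rpow_one]
            congr 2
            field_simp
            norm_num
    have hw2 : ‖w y‖ₑ ^ 2 ≤ 2 * ‖w y - A‖ₑ ^ 2 + 2 * ‖A‖ₑ ^ 2 := by
      simp only [Real.enorm_eq_ofReal_abs, ← ENNReal.ofReal_pow (abs_nonneg _), sq_abs]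
      rw [← ENNReal.ofReal_ofNat 2, ← ENNReal.ofReal_mul (by norm_num),
        ← ENNReal.ofReal_mul (by norm_num), ← ENNReal.ofReal_add (by positivity) (by positivity)]
      refine ENNReal.ofReal_le_ofReal ?_
      nlinarith [sq_nonneg (w y - 2 * A)]
    refine hw2.trans (add_le_add ?_ ?_)
    · refine (mul_le_mul_right hdiff2 2).trans_eq ?_
      rw [← mul_assoc, ← ENNReal.ofReal_ofNat 2, ← ENNReal.ofReal_mul (by norm_num)]
      congr 2
      ring
    · rw [Real.enorm_eq_ofReal_abs, ← ENNReal.ofReal_pow (abs_nonneg _), ← ENNReal.ofReal_ofNat 2,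
        ← ENNReal.ofReal_mul (by norm_num)]
      refine ENNReal.ofReal_le_ofReal ?_
      gcongr
  calc _ ≤ _ := lintegral_mono hpt
    _ = _ := by
      rw [lintegral_add_right _ measurable_const, lintegral_const_mul', lintegral_const, leb_univ,
        ← ENNReal.ofReal_mul (by positivity)]
      · congr 2
        ring
      · exact ENNReal.ofReal_ne_top

end Interpolation

/-! ### Hölder continuity from averages over shrinking intervals. -/

section Campanato

theorem ofReal_sq_eq_enorm_sq (c : ℝ) : ENNReal.ofReal (c ^ 2) = ‖c‖ₑ ^ 2 := by
  rw [← sq_abs, ENNReal.ofReal_pow (abs_nonneg _), Real.enorm_eq_ofReal_abs]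

/-- The difference is the mean of `f y - f x` over `I × J`. Cauchy–Schwarz in each variable makes it
quadratic, and `|x - y| ≤ ℓ` allows the kernel to be inserted at the cost `ℓ^(1 + 2σ)`. -/
theorem abs_setAverage_sub_setAverage_le {σ ℓ M : ℝ} (hσ : 0 ≤ σ) (hM : 0 ≤ M)
    {f : Dom a b → ℝ} (hfm : Measurable f) (hfi : Integrable f (leb a b))
    (hgag : gagliardo σ f ≤ ENNReal.ofReal (M ^ 2)) {I J : Set (Dom a b)} (hI : MeasurableSet I)
    (hJ : MeasurableSet J) (hI0 : 0 < (leb a b).real I) (hJ0 : 0 < (leb a b).real J)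
    (hℓ : ∀ y ∈ I, ∀ x ∈ J, |(x : ℝ) - y| ≤ ℓ) :
    |(⨍ y in I, f y ∂(leb a b)) - ⨍ x in J, f x ∂(leb a b)| ≤
      M * √(ℓ ^ (1 + 2 * σ) / ((leb a b).real I * (leb a b).real J)) := by
  set m := (leb a b).real I with hm
  set m' := (leb a b).real J with hm'
  have hℓ0 : 0 ≤ ℓ := by
    have hIne : I.Nonempty := nonempty_of_measure_ne_zero (μ := leb a b) fun h => by
      rw [hm, measureReal_def, h] at hI0
      simp at hI0
    have hJne : J.Nonempty := nonempty_of_measure_ne_zero (μ := leb a b) fun h => by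
      rw [hm', measureReal_def, h] at hJ0
      simp at hJ0
    obtain ⟨y, hy⟩ := hIne
    obtain ⟨x, hx⟩ := hJne
    exact (abs_nonneg _).trans (hℓ y hy x hx)
  have hmI : leb a b I = ENNReal.ofReal m := by rw [hm, ofReal_measureReal]
  have hmJ : leb a b J = ENNReal.ofReal m' := by rw [hm', ofReal_measureReal]
  set d := (⨍ y in I, f y ∂(leb a b)) - ⨍ x in J, f x ∂(leb a b) with hd
  have e : m * m' * d = ∫ y in I, ∫ x in J, (f y - f x) ∂(leb a b) ∂(leb a b) := by
    have e1 : ∀ y, ∫ x in J, (f y - f x) ∂(leb a b) = m' * f y - ∫ x in J, f x ∂(leb a b) := by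
      intro y
      rw [integral_sub (integrable_const _) hfi.integrableOn, setIntegral_const, smul_eq_mul]
    simp_rw [e1]
    rw [integral_sub (hfi.integrableOn.const_mul _) (integrable_const _), setIntegral_const,
      integral_const_mul, hd, setAverage_eq, setAverage_eq, smul_eq_mul, smul_eq_mul, smul_eq_mul,
      ← hm, ← hm']
    field_simp
  have hin : ∀ y ∈ I, ∫⁻ x in J, ‖f y - f x‖ₑ ^ 2 ∂(leb a b) ≤ ENNReal.ofReal (ℓ ^ (1 + 2 * σ)) *
      ∫⁻ x, ENNReal.ofReal ((f x - f y) ^ 2 / |(x : ℝ) - (y : ℝ)| ^ (1 + 2 * σ)) ∂(leb a b) := by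
    intro y hy
    rw [← lintegral_const_mul _ (by fun_prop)]
    refine le_trans (setLIntegral_mono' hJ fun x hx => ?_) (setLIntegral_le_lintegral J _)
    rw [← ENNReal.ofReal_mul (by positivity), ← ofReal_sq_eq_enorm_sq]
    refine ENNReal.ofReal_le_ofReal ?_
    rcases (abs_nonneg ((x : ℝ) - y)).eq_or_lt with h0 | hpos
    · have h12 : x = y := Subtype.ext (sub_eq_zero.1 (abs_eq_zero.1 h0.symm))
      simp [h12]
    · have hp : 0 < |(x : ℝ) - y| ^ (1 + 2 * σ) := Real.rpow_pos_of_pos hpos _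
      rw [← mul_div_assoc, le_div_iff₀ hp, mul_comm, ← neg_sub (f x), neg_sq]
      exact mul_le_mul_of_nonneg_right
        (Real.rpow_le_rpow hpos.le (hℓ y hy x hx) (by linarith)) (sq_nonneg _)
  have hsq : ‖m * m' * d‖ₑ ^ 2 ≤
      ENNReal.ofReal (m * (m' * (ℓ ^ (1 + 2 * σ) * M ^ 2))) := by
    have hmm : Measurable fun y => ∫⁻ x in J, ‖f y - f x‖ₑ ∂(leb a b) := by
      refine Measurable.lintegral_prod_right' (f := fun p : Dom a b × Dom a b => ‖f p.1 - f p.2‖ₑ) ?_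
      fun_prop
    calc ‖m * m' * d‖ₑ ^ 2 ≤
        (∫⁻ y in I, ∫⁻ x in J, ‖f y - f x‖ₑ ∂(leb a b) ∂(leb a b)) ^ 2 := by
          rw [e]
          gcongr
          refine (enorm_integral_le_lintegral_enorm _).trans (lintegral_mono fun y => ?_)
          exact enorm_integral_le_lintegral_enorm _
      _ ≤ ENNReal.ofReal m * ∫⁻ y in I, (∫⁻ x in J, ‖f y - f x‖ₑ ∂(leb a b)) ^ 2 ∂(leb a b) := by
          have := sq_lintegral_le ((leb a b).restrict I) hmm.aemeasurable
          rwa [Measure.restrict_apply_univ, hmI] at this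
      _ ≤ ENNReal.ofReal m * ∫⁻ y in I, ENNReal.ofReal m' * (ENNReal.ofReal (ℓ ^ (1 + 2 * σ)) *
          ∫⁻ x, ENNReal.ofReal ((f x - f y) ^ 2 / |(x : ℝ) - (y : ℝ)| ^ (1 + 2 * σ)) ∂(leb a b))
          ∂(leb a b) := by
          gcongr 1
          refine setLIntegral_mono' hI fun y hy => ?_
          have := sq_lintegral_le ((leb a b).restrict J) (g := fun x => ‖f y - f x‖ₑ) (by fun_prop)
          rw [Measure.restrict_apply_univ, hmJ] at this
          refine this.trans ?_
          gcongr
          exact hin y hy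
      _ ≤ ENNReal.ofReal m * (ENNReal.ofReal m' * (ENNReal.ofReal (ℓ ^ (1 + 2 * σ)) *
          gagliardo σ f)) := by
          gcongr
          rw [lintegral_const_mul' _ _ ENNReal.ofReal_ne_top,
            lintegral_const_mul' _ _ ENNReal.ofReal_ne_top]
          gcongr
          exact setLIntegral_le_lintegral _ _
      _ ≤ _ := by
          rw [ENNReal.ofReal_mul hI0.le, ENNReal.ofReal_mul hJ0.le,
            ENNReal.ofReal_mul (by positivity)]
          gcongr
  rw [← ofReal_sq_eq_enorm_sq, ENNReal.ofReal_le_ofReal_iff (by positivity)] at hsq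
  refine abs_le_of_sq_le_sq ?_ (by positivity)
  rw [mul_pow, Real.sq_sqrt (by positivity), ← mul_div_assoc, le_div_iff₀ (by positivity)]
  have hpos : 0 < m * m' := by positivity
  refine le_of_mul_le_mul_left ?_ hpos
  linarith

/-- Consecutive averages differ by a constant times `(h 2⁻ⁿ)^(σ - 1/2)`, a convergent geometric
series exactly because `σ > 1/2`; continuity identifies the limit as `f x`. -/
theorem abs_setAverage_sub_le_of_nested {σ M h : ℝ} (hσ : 1 / 2 < σ) (hM : 0 ≤ M) (hh : 0 < h)
    {f : Dom a b → ℝ} (hf : Continuous f) (hfi : Integrable f (leb a b))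
    (hgag : gagliardo σ f ≤ ENNReal.ofReal (M ^ 2)) (x : Dom a b) (I : ℕ → Set (Dom a b))
    (hI : ∀ n, MeasurableSet (I n)) (hIm : ∀ n, (leb a b).real (I n) = h * 2⁻¹ ^ n)
    (hIx : ∀ n, ∀ y ∈ I n, |(y : ℝ) - x| ≤ h * 2⁻¹ ^ n) :
    |(⨍ y in I 0, f y ∂(leb a b)) - f x| ≤
      2 ^ (1 + σ) / (1 - 2⁻¹ ^ (σ - 1 / 2)) * M * h ^ (σ - 1 / 2) := by
  set r : ℝ := 2⁻¹ ^ (σ - 1 / 2) with hr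
  have hr1 : r < 1 := Real.rpow_lt_one (by norm_num) (by norm_num) (by linarith)
  have hlim : Tendsto (fun n => ⨍ y in I n, f y ∂(leb a b)) atTop (𝓝 (f x)) := by
    rw [Metric.tendsto_atTop]
    intro ε hε
    obtain ⟨η, hη, hη'⟩ := Metric.continuousAt_iff.1 (hf.continuousAt (x := x)) (ε / 2) (half_pos hε)
    have ht : Tendsto (fun n : ℕ => h * (2⁻¹ : ℝ) ^ n) atTop (𝓝 0) := by
      simpa using (tendsto_pow_atTop_nhds_zero_of_lt_one (by norm_num : (0 : ℝ) ≤ 2⁻¹)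
        (by norm_num)).const_mul h
    obtain ⟨N, hN⟩ := eventually_atTop.1 (ht.eventually_lt_const hη)
    refine ⟨N, fun n hn => ?_⟩
    have hm : 0 < (leb a b).real (I n) := by rw [hIm]; positivity
    have e : (⨍ y in I n, f y ∂(leb a b)) - f x =
        ((leb a b).real (I n))⁻¹ * ∫ y in I n, (f y - f x) ∂(leb a b) := by
      rw [integral_sub hfi.integrableOn (integrable_const _), setIntegral_const, setAverage_eq,
        smul_eq_mul, smul_eq_mul]
      field_simp
    rw [Real.dist_eq, e, abs_mul, abs_inv, abs_of_pos hm, inv_mul_lt_iff₀ hm, ← Real.norm_eq_abs]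
    refine (norm_setIntegral_le_of_norm_le_const (C := ε / 2) (measure_lt_top _ _)
      fun y hy => ?_).trans_lt ?_
    · refine (hη' ?_).le
      rw [Subtype.dist_eq, Real.dist_eq]
      exact (hIx n y hy).trans_lt (hN n hn)
    · rw [mul_comm]
      exact mul_lt_mul_of_pos_left (half_lt_self hε) hm
  have hstep : ∀ n, dist (⨍ y in I n, f y ∂(leb a b)) (⨍ y in I (n + 1), f y ∂(leb a b)) ≤
      2 ^ (1 + σ) * M * h ^ (σ - 1 / 2) * r ^ n := by
    intro n
    have hp : 0 < h * (2⁻¹ : ℝ) ^ n := by positivity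
    have := abs_setAverage_sub_setAverage_le (ℓ := 2 * (h * 2⁻¹ ^ n)) (by linarith) hM
      hf.measurable hfi hgag (hI n) (hI (n + 1)) (by rw [hIm]; positivity)
      (by rw [hIm]; positivity) fun y hy z hz => by
        have h1 := hIx n y hy
        have h2 := hIx (n + 1) z hz
        rw [pow_succ] at h2
        rw [abs_le] at *
        constructor <;> linarith [h1.1, h1.2, h2.1, h2.2]
    rw [Real.dist_eq]
    refine this.trans_eq ?_
    rw [hIm, hIm, pow_succ]
    have e : (2 * (h * (2⁻¹ : ℝ) ^ n)) ^ (1 + 2 * σ) / (h * 2⁻¹ ^ n * (h * (2⁻¹ ^ n * 2⁻¹))) =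
        (2 ^ (1 + σ) * (h * 2⁻¹ ^ n) ^ (σ - 1 / 2)) ^ 2 := by
      have e2 : h * 2⁻¹ ^ n * (h * (2⁻¹ ^ n * 2⁻¹)) = (h * (2⁻¹ : ℝ) ^ n) ^ (2 : ℝ) * 2⁻¹ := by
        rw [Real.rpow_ofNat]
        ring
      have e3 : (1 + σ) * ((2 : ℕ) : ℝ) = (1 + 2 * σ) + 1 := by push_cast; ring
      have e4 : (σ - 1 / 2) * ((2 : ℕ) : ℝ) = (1 + 2 * σ) - 2 := by push_cast; ring
      rw [e2]
      generalize h * (2⁻¹ : ℝ) ^ n = q at hp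
      rw [mul_pow, ← Real.rpow_natCast, ← Real.rpow_natCast, ← Real.rpow_mul (by norm_num),
        ← Real.rpow_mul hp.le, Real.mul_rpow (by norm_num) hp.le, e3, e4, Real.rpow_add (by norm_num), Real.rpow_sub hp, Real.rpow_one]
      field_simp
      rw [show (1 + 2 * σ + 1 : ℝ) = 2 + 2 * σ by ring, Real.rpow_add (by norm_num),
        Real.rpow_ofNat]
    rw [e, Real.sqrt_sq (by positivity), Real.mul_rpow hh.le (by positivity), hr,
      ← Real.rpow_natCast, ← Real.rpow_natCast, ← Real.rpow_mul (by norm_num),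
      ← Real.rpow_mul (by norm_num), mul_comm (n : ℝ)]
    ring
  have := dist_le_of_le_geometric_of_tendsto₀ r _ hr1 hstep hlim
  rw [Real.dist_eq] at this
  refine this.trans_eq ?_
  ring

/-- Campanato's embedding: a finite Gagliardo seminorm of order `σ > 1/2` implies Hölder
continuity of order `σ - 1/2`. -/
theorem abs_sub_le_of_gagliardo_le {σ M : ℝ} (hσ : 1 / 2 < σ) (hM : 0 ≤ M)
    {f : Dom a b → ℝ} (hf : Continuous f) (hfi : Integrable f (leb a b))
    (hgag : gagliardo σ f ≤ ENNReal.ofReal (M ^ 2)) (x y : Dom a b) :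
    |f x - f y| ≤ 2 * (2 ^ (1 + σ) / (1 - 2⁻¹ ^ (σ - 1 / 2)) * M * |(x : ℝ) - y| ^ (σ - 1 / 2)) := by
  wlog hxy : x < y generalizing x y
  · rcases (not_lt.1 hxy).eq_or_lt with h | h
    · subst h
      rw [sub_self, sub_self, abs_zero, Real.zero_rpow (by linarith)]
      simp
    · rw [abs_sub_comm, abs_sub_comm (x : ℝ)]
      exact this y x h
  have hh : 0 < (y : ℝ) - x := sub_pos.2 hxy
  have hr : ∀ n : ℕ, 0 < ((y : ℝ) - x) * 2⁻¹ ^ n := fun n => by positivity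
  have hr' : ∀ n : ℕ, ((y : ℝ) - x) * 2⁻¹ ^ n ≤ (y : ℝ) - x := fun n =>
    mul_le_of_le_one_right hh.le (pow_le_one₀ (by norm_num) (by norm_num))
  -- Both chains of intervals start from `(x, y)`; one shrinks to its left end and the other to its
  -- right end.
  have h1 := abs_setAverage_sub_le_of_nested hσ hM hh hf hfi hgag x
    (fun n => Subtype.val ⁻¹' Ioo (x : ℝ) (x + ((y : ℝ) - x) * 2⁻¹ ^ n))
    (fun n => measurable_subtype_coe measurableSet_Ioo)
    (fun n => by
      rw [measureReal_def, leb_Ioo _ _ x.2.1.le (by linarith [hr' n, y.2.2]),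
        ENNReal.toReal_ofReal (by linarith [hr n])]
      ring)
    (fun n z hz => by
      rw [abs_le]
      exact ⟨by linarith [hz.1, hr n], by linarith [hz.2]⟩)
  have h2 := abs_setAverage_sub_le_of_nested hσ hM hh hf hfi hgag y
    (fun n => Subtype.val ⁻¹' Ioo (y - ((y : ℝ) - x) * 2⁻¹ ^ n) (y : ℝ))
    (fun n => measurable_subtype_coe measurableSet_Ioo)
    (fun n => by
      rw [measureReal_def, leb_Ioo _ _ (by linarith [hr' n, x.2.1]) y.2.2.le,
        ENNReal.toReal_ofReal (by linarith [hr n])]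
      ring)
    (fun n z hz => by
      rw [abs_le]
      exact ⟨by linarith [hz.1], by linarith [hz.2, hr n]⟩)
  have e1 : (x : ℝ) + ((y : ℝ) - x) * 2⁻¹ ^ 0 = y := by ring
  have e2 : (y : ℝ) - ((y : ℝ) - x) * 2⁻¹ ^ 0 = x := by ring
  simp only [e1, e2] at h1 h2
  rw [abs_sub_comm (x : ℝ), abs_of_pos hh, two_mul]
  rw [abs_sub_comm] at h1
  exact (abs_sub_le _ _ _).trans (add_le_add h1 h2)

end Campanato

/-! ### Embeddings and convergence in lower Sobolev orders. -/

section Embeddings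

variable {t : ℝ}

/-- Below the top order, the next weak derivative is square integrable. At the top order, `σ > 0`
excludes integer `t`, and the energy contains the Gagliardo term of order `t - ⌊t⌋ ≥ σ`. -/
theorem exists_gagliardo_le_energy (hab : a < b) {σ : ℝ} {α : ℕ} (h0 : 0 < σ) (h1 : σ < 1)
    (hσ : α + σ ≤ t) : ∃ K : ℝ≥0∞, K < ⊤ ∧ ∀ (f : Dom a b → ℝ) (G : ℕ → Dom a b → ℝ),
      IsJet ⌊t⌋₊ f G → energy t G < ⊤ → gagliardo σ (G α) ≤ K * energy t G := by
  have hαt : α ≤ ⌊t⌋₊ := Nat.le_floor (by linarith)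
  rcases hαt.lt_or_eq with hlt | heq
  · obtain ⟨K, hK, hK'⟩ := exists_gagliardo_le_of_isWeakDeriv hab h0 h1
    refine ⟨K, hK, fun f G hG hE => ?_⟩
    have hle := lintegral_sq_le_energy (s := t) hab hG.measurable (α := α + 1) hlt
    refine (hK' _ _ (hG.measurable (α + 1)) ((hG.isWeakDeriv α hαt).succ
      (hG.isWeakDeriv (α + 1) hlt)) (hle.trans_lt hE)).trans ?_
    gcongr
  · have hne : t ≠ (⌊t⌋₊ : ℝ) := by
      rw [← heq]
      intro h
      linarith
    refine ⟨ENNReal.ofReal (1 ^ (2 * (t - (⌊t⌋₊ : ℝ) - σ))) +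
      ENNReal.ofReal (4 * (b - a) / 1 ^ (1 + 2 * σ)),
      ENNReal.add_lt_top.2 ⟨ENNReal.ofReal_lt_top, ENNReal.ofReal_lt_top⟩, fun f G hG hE => ?_⟩
    have hle := lintegral_sq_le_energy (s := t) hab hG.measurable (α := α) hαt
    refine (gagliardo_le_add (σ := t - (⌊t⌋₊ : ℝ)) h0.le (by rw [← heq]; linarith) one_pos
      (hG.measurable α)).trans ?_
    rw [add_mul]
    gcongr
    rw [heq]
    exact gagliardo_le_energy hab hG.measurable hne

theorem tendsto_zero_of_le_add {ι : Type*} {l : Filter ι} {f : ι → ℝ≥0∞} {A : ℝ → ℝ≥0∞}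
    (hA : Tendsto A (𝓝[>] 0) (𝓝 0))
    (h : ∀ᶠ δ in 𝓝[>] (0 : ℝ), ∃ B : ι → ℝ≥0∞, Tendsto B l (𝓝 0) ∧ ∀ i, f i ≤ A δ + B i) :
    Tendsto f l (𝓝 0) := by
  rw [ENNReal.tendsto_nhds_zero]
  intro ε hε
  have hε2 : 0 < ε / 2 := ENNReal.half_pos hε.ne'
  obtain ⟨δ, ⟨B, hB, hf⟩, hδ⟩ := (h.and (ENNReal.tendsto_nhds_zero.1 hA _ hε2)).exists
  filter_upwards [ENNReal.tendsto_nhds_zero.1 hB _ hε2] with i hi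
  exact (hf i).trans ((add_le_add hδ hi).trans_eq (ENNReal.add_halves ε))

theorem tendsto_ofReal_mul_rpow_mul {c r : ℝ} (hr : 0 < r) {K : ℝ≥0∞} (hK : K < ⊤) :
    Tendsto (fun δ : ℝ => ENNReal.ofReal (c * δ ^ r) * K) (𝓝[>] 0) (𝓝 0) := by
  have h1 : Tendsto (fun δ : ℝ => c * δ ^ r) (𝓝[>] 0) (𝓝 0) := by
    have := ((Real.continuousAt_rpow_const 0 r (Or.inr hr.le)).tendsto.const_mul c).mono_left
      (nhdsWithin_le_nhds (s := Ioi 0))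
    simpa [Real.zero_rpow hr.ne'] using this
  have := ENNReal.Tendsto.mul_const (ENNReal.tendsto_ofReal h1) (Or.inr hK.ne)
  simpa using this

/-- Sobolev norms of lower order tend to zero along bounded families that tend to zero uniformly. -/
theorem tendsto_energy_zero (hab : a < b) {s : ℝ} (hs : 0 ≤ s) (hst : s < t) {ι : Type*}
    {l : Filter ι} {u : ι → Dom a b → ℝ} {U : ι → ℕ → Dom a b → ℝ}
    (hU : ∀ i, IsJet ⌊t⌋₊ (u i) (U i)) {E : ℝ≥0∞} (hE : E < ⊤) (hUE : ∀ i, energy t (U i) ≤ E)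
    {κ : ι → ℝ} (hκ : Tendsto κ l (𝓝 0)) (hκ0 : ∀ i, 0 ≤ κ i) (huκ : ∀ i x, |u i x| ≤ κ i) :
    Tendsto (fun i => energy s (U i)) l (𝓝 0) := by
  have hM : (⌊s⌋₊ : ℝ) ≤ s := Nat.floor_le hs
  have hMt : ⌊s⌋₊ ≤ ⌊t⌋₊ := Nat.floor_mono hst.le
  have hL2 : ∀ α ≤ ⌊s⌋₊, Tendsto (fun i => ∫⁻ x, ‖U i α x‖ₑ ^ 2 ∂(leb a b)) l (𝓝 0) := by
    intro α hα
    have hαs : (α : ℝ) ≤ s := le_trans (by exact_mod_cast hα) hM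
    -- Since `α ≤ s < t`, a positive fractional order is left above `α`. It pays for a factor
    -- `δ^(2σ)`, made small before the sup-norm bound is sent to zero.
    have hσ0 : 0 < min (t - α) (1 / 2) := lt_min (by linarith) (by norm_num)
    obtain ⟨K, hK, hK'⟩ := exists_gagliardo_le_energy (a := a) (b := b) (t := t) (α := α) hab hσ0
      ((min_le_right _ _).trans_lt (by norm_num)) (by linarith [min_le_left (t - α) (1 / 2)])
    refine tendsto_zero_of_le_add (tendsto_ofReal_mul_rpow_mul (c := 16)
      (mul_pos two_pos hσ0) (ENNReal.mul_lt_top hK hE)) ?_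
    have hmem : Ioo 0 ((b - a) / 2) ∈ 𝓝[>] (0 : ℝ) := Ioo_mem_nhdsGT (by linarith)
    filter_upwards [hmem] with δ hδ
    obtain ⟨C, hC, hC'⟩ := exists_lintegral_sq_le_gagliardo_add hab hσ0.le hδ.1 hδ.2 α
    refine ⟨fun i => ENNReal.ofReal (C * κ i ^ 2), ?_, fun i => ?_⟩
    · have := ENNReal.tendsto_ofReal ((hκ.pow 2).const_mul C)
      simpa using this
    · refine (hC' (u i) (U i α) (κ i) ((hU i).measurable α)
        ((hU i).isWeakDeriv α (hα.trans hMt)) (hκ0 i) (huκ i)).trans ?_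
      gcongr
      refine (hK' _ _ (hU i) ((hUE i).trans_lt hE)).trans ?_
      gcongr
      exact hUE i
  have hsum : Tendsto (fun i => ∑ α ∈ Finset.range (⌊s⌋₊ + 1), ∫⁻ x, ‖U i α x‖ₑ ^ 2 ∂(leb a b))
      l (𝓝 0) := by
    have := tendsto_finsetSum (Finset.range (⌊s⌋₊ + 1)) fun α hα =>
      hL2 α (Nat.lt_succ_iff.1 (Finset.mem_range.1 hα))
    simpa using this
  simp_rw [fun i => energy_eq (s := s) hab (hU i).measurable]
  split_ifs with hint
  · simpa using hsum
  have hs' : 0 ≤ s - (⌊s⌋₊ : ℝ) := by linarith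
  have hs1 : s - (⌊s⌋₊ : ℝ) < 1 := by linarith [Nat.lt_floor_add_one s]
  set σ' := s - (⌊s⌋₊ : ℝ) with hσ'
  -- An order strictly between `σ'` and `1` that the energy of order `t` still controls.
  set σ := min (t - ⌊s⌋₊) ((σ' + 1) / 2) with hσ
  have hσσ' : σ' < σ := lt_min (by linarith) (by linarith)
  have hσ1 : σ < 1 := (min_le_right _ _).trans_lt (by linarith)
  obtain ⟨K, hK, hK'⟩ := exists_gagliardo_le_energy (a := a) (b := b) (t := t) (α := ⌊s⌋₊)
    (σ := σ) hab (by linarith) hσ1 (by linarith [min_le_left (t - ⌊s⌋₊) ((σ' + 1) / 2)])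
  have hgag : Tendsto (fun i => gagliardo σ' (U i ⌊s⌋₊)) l (𝓝 0) := by
    refine tendsto_zero_of_le_add (tendsto_ofReal_mul_rpow_mul (c := 1)
      (r := 2 * (σ - σ')) (by linarith) (ENNReal.mul_lt_top hK hE)) ?_
    filter_upwards [self_mem_nhdsWithin] with δ hδ
    refine ⟨fun i => ENNReal.ofReal (4 * (b - a) / δ ^ (1 + 2 * σ')) *
      ∫⁻ x, ‖U i ⌊s⌋₊ x‖ₑ ^ 2 ∂(leb a b), ?_, fun i => ?_⟩
    · simpa using ENNReal.Tendsto.const_mul (hL2 _ le_rfl) (Or.inr ENNReal.ofReal_ne_top)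
    · refine (gagliardo_le_add hs' hσσ'.le hδ ((hU i).measurable _)).trans ?_
      rw [one_mul]
      gcongr
      refine (hK' _ _ (hU i) ((hUE i).trans_lt hE)).trans ?_
      gcongr
      exact hUE i
  simpa using hsum.add hgag

theorem exists_holder_bound (hab : a < b) (ht : 1 / 2 < t) {D : ℝ} (hD : 0 ≤ D) :
    ∃ C γ : ℝ, 0 ≤ C ∧ 0 < γ ∧ ∀ f ∈ sobolevSpace a b t, sobolevNorm t f ≤ ENNReal.ofReal D →
      ∀ x y, |f x - f y| ≤ C * |(x : ℝ) - y| ^ γ := by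
  set σ := min t (3 / 4) with hσ
  have hσ2 : 1 / 2 < σ := lt_min ht (by norm_num)
  have hσ1 : σ < 1 := (min_le_right _ _).trans_lt (by norm_num)
  obtain ⟨K, hK, hK'⟩ := exists_gagliardo_le_energy (a := a) (b := b) (t := t) (α := 0) (σ := σ)
    hab (by linarith) hσ1 (by simp [hσ])
  set M := √(K.toReal * D ^ 2) with hM
  have hr1 : (2⁻¹ : ℝ) ^ (σ - 1 / 2) < 1 :=
    Real.rpow_lt_one (by norm_num) (by norm_num) (by linarith)
  have h1r : 0 < 1 - (2⁻¹ : ℝ) ^ (σ - 1 / 2) := sub_pos.2 hr1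
  refine ⟨2 * (2 ^ (1 + σ) / (1 - 2⁻¹ ^ (σ - 1 / 2)) * M), σ - 1 / 2, by positivity, by linarith,
    fun f hf hfD x y => ?_⟩
  obtain ⟨hfc, ⟨B, hB⟩, hfin⟩ := hf
  obtain ⟨G, hG⟩ := exists_isJet hfin
  have hE := hG.energy_le hab hD hfD
  have hfi := integrable_of_continuous_bdd hfc hB
  have h0 : G 0 =ᵐ[leb a b] f :=
    (hG.isWeakDeriv 0 (Nat.zero_le _)).unique (isWeakDeriv_zero hfi.locallyIntegrable)
  have hg : gagliardo σ f ≤ ENNReal.ofReal (M ^ 2) := by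
    rw [← gagliardo_congr _ h0, hM, Real.sq_sqrt (by positivity),
      ENNReal.ofReal_mul ENNReal.toReal_nonneg, ENNReal.ofReal_toReal hK.ne]
    refine (hK' _ _ hG (hE.trans_lt ENNReal.ofReal_lt_top)).trans ?_
    gcongr
  refine (abs_sub_le_of_gagliardo_le hσ2 (Real.sqrt_nonneg _) hfc hfi hg x y).trans_eq ?_
  ring

variable {ζ D : ℝ}

theorem integrable_of_mem_densities {p : Dom a b → ℝ} (hp : p ∈ densities a b t ζ D) :
    Integrable p (leb a b) := by
  obtain ⟨⟨hc, ⟨B, hB⟩, -⟩, -⟩ := hp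
  exact integrable_of_continuous_bdd hc hB

/-- A density has mean value `(b - a)⁻¹`, and the Hölder bound limits its oscillation around it. -/
theorem exists_bound_densities (hab : a < b) (ht : 1 / 2 < t) (hζ : 0 ≤ ζ) (hD : 0 ≤ D) :
    ∃ B, 0 < B ∧ ∀ p ∈ densities a b t ζ D, ∀ x, |p x| ≤ B := by
  obtain ⟨C, γ, hC, hγ, h⟩ := exists_holder_bound hab ht hD
  have hab' : 0 < b - a := sub_pos.2 hab
  refine ⟨(b - a)⁻¹ + C * (b - a) ^ γ, by positivity, fun p hp x => ?_⟩
  have hpi := integrable_of_mem_densities hp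
  rw [abs_of_nonneg (hζ.trans (hp.2.2.1 x))]
  have hxy : ∀ y, p x ≤ p y + C * (b - a) ^ γ := by
    intro y
    have h1 := h p hp.1 hp.2.2.2 x y
    have h2 : |(x : ℝ) - y| ^ γ ≤ (b - a) ^ γ := by
      refine Real.rpow_le_rpow (abs_nonneg _) ?_ hγ.le
      rw [abs_le]
      constructor <;> linarith [x.2.1, x.2.2, y.2.1, y.2.2]
    have h3 := mul_le_mul_of_nonneg_left h2 hC
    linarith [le_abs_self (p x - p y)]
  have hint := integral_mono (integrable_const (p x)) (hpi.add (integrable_const (C * (b - a) ^ γ)))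
    hxy
  have hr : (leb a b).real univ = b - a := by
    rw [measureReal_def, leb_univ, ENNReal.toReal_ofReal hab'.le]
  simp only [Pi.add_apply] at hint
  rw [integral_add hpi (integrable_const _), integral_const, integral_const, hp.2.1, hr, smul_eq_mul,
    smul_eq_mul] at hint
  have e : (b - a)⁻¹ + C * (b - a) ^ γ = (1 + (b - a) * (C * (b - a) ^ γ)) / (b - a) := by
    field_simp
  rw [e, le_div_iff₀ hab']
  linarith

/-- The parallelogram law bounds the energy of half the difference by `D²`, so `tendsto_energy_zero`
applies to it; homogeneity then restores the factor `4`. -/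
theorem tendsto_sobolevNorm_sub (hab : a < b) (hD : 0 ≤ D) {s : ℝ} (hs : 0 ≤ s) (hst : s < t)
    {ι : Type*} {l : Filter ι} {f g : ι → Dom a b → ℝ} (hf : ∀ i, f i ∈ densities a b t ζ D)
    (hg : ∀ i, g i ∈ densities a b t ζ D)
    (hfg : Tendsto (fun i => supNorm (f i - g i)) l (𝓝 0)) :
    Tendsto (fun i => sobolevNorm s (f i - g i)) l (𝓝 0) := by
  choose F hF using fun i => exists_isJet (hf i).1.2.2
  choose G hG using fun i => exists_isJet (hg i).1.2.2
  have hFE := fun i => (hF i).energy_le hab hD (hf i).2.2.2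
  have hGE := fun i => (hG i).energy_le hab hD (hg i).2.2.2
  have hfin : ∀ i, supNorm (f i - g i) < ⊤ := by
    intro i
    obtain ⟨⟨-, ⟨B, hB⟩, -⟩, -⟩ := hf i
    obtain ⟨⟨-, ⟨B', hB'⟩, -⟩, -⟩ := hg i
    refine lt_of_le_of_lt (iSup_le fun x => ?_) (ENNReal.ofReal_lt_top (r := B + B'))
    rw [Real.enorm_eq_ofReal_abs]
    exact ENNReal.ofReal_le_ofReal ((abs_sub _ _).trans (add_le_add (hB x) (hB' x)))
  have hκ : Tendsto (fun i => (supNorm (f i - g i)).toReal) l (𝓝 0) := by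
    have := (ENNReal.tendsto_toReal ENNReal.zero_ne_top).comp hfg
    simpa [Function.comp_def] using this
  have hle : ∀ i x, |f i x - g i x| ≤ (supNorm (f i - g i)).toReal := by
    intro i x
    have := ENNReal.toReal_mono (hfin i).ne (le_iSup (fun x => ‖(f i - g i) x‖ₑ) x)
    simpa using this
  have hhalf := tendsto_energy_zero (t := t) hab hs hst (l := l)
    (fun i => (hF i).lin (hG i) 2⁻¹ (-2⁻¹)) (E := ENNReal.ofReal (D ^ 2)) ENNReal.ofReal_lt_top
    (fun i => (energy_half_sub_le (hF i).measurable (hG i).measurable).trans (by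
      refine (add_le_add (mul_le_mul_right (hFE i) _) (mul_le_mul_right (hGE i) _)).trans_eq ?_
      rw [← add_mul, ENNReal.inv_two_add_inv_two, one_mul]))
    hκ (fun i => ENNReal.toReal_nonneg) (fun i x => by
      have := hle i x
      rw [show 2⁻¹ * f i x + -2⁻¹ * g i x = 2⁻¹ * (f i x - g i x) by ring, abs_mul,
        abs_of_pos (by norm_num : (0 : ℝ) < 2⁻¹)]
      linarith [abs_nonneg (f i x - g i x)])
  have hfull : Tendsto (fun i => energy s (fun α x => 1 * F i α x + -1 * G i α x)) l (𝓝 0) := by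
    simp_rw [fun i => energy_sub_eq (s := s) (hF i).measurable (hG i).measurable]
    simpa using ENNReal.Tendsto.const_mul hhalf (Or.inr (by norm_num : (4 : ℝ≥0∞) ≠ ⊤))
  have hnorm : ∀ i, sobolevNorm s (f i - g i) =
      energy s (fun α x => 1 * F i α x + -1 * G i α x) ^ (1 / 2 : ℝ) := by
    intro i
    have := (((hF i).lin (hG i) 1 (-1)).mono (Nat.floor_mono hst.le)).sobolevNorm_eq hab
    rw [← this]
    congr 1
    ext x
    simp [sub_eq_add_neg]
  simp_rw [hnorm]
  have := hfull.ennrpow_const (1 / 2 : ℝ)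
  simpa using this

end Embeddings

/-! ### Midpoints in the model and limits of jets. -/

section Closedness

variable {t ζ D : ℝ}

theorem const_mem_densities (hab : a < b) (hζb : ζ < (b - a)⁻¹) (hD : 0 < D)
    (hDb : (b - a)⁻¹ < D ^ 2) : (fun _ => (b - a)⁻¹) ∈ densities a b t ζ D := by
  have hab' : 0 < b - a := sub_pos.2 hab
  have hjet : IsJet ⌊t⌋₊ (fun _ : Dom a b => (b - a)⁻¹)
      (fun α _ => if α = 0 then (b - a)⁻¹ else 0) :=
    ⟨fun α => measurable_const, fun α _ => isWeakDeriv_const _ _⟩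
  have hE : energy t (fun α (_ : Dom a b) => if α = 0 then (b - a)⁻¹ else 0) ≤
      ENNReal.ofReal (D ^ 2) := by
    rw [energy_eq hab hjet.measurable]
    have h1 : ∀ α : ℕ, ∫⁻ _ : Dom a b, ‖if α = 0 then (b - a)⁻¹ else 0‖ₑ ^ 2 ∂(leb a b) =
        if α = 0 then ENNReal.ofReal (b - a)⁻¹ else 0 := by
      intro α
      rw [lintegral_const, leb_univ]
      split_ifs
      · rw [← ofReal_sq_eq_enorm_sq, ← ENNReal.ofReal_mul (by positivity)]
        congr 1
        field_simp
      · simp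
    have h2 : ∀ (σ c : ℝ), gagliardo σ (fun _ : Dom a b => c) = 0 := by
      intro σ c
      simp [gagliardo]
    simp_rw [h1, h2]
    simpa using ENNReal.ofReal_le_ofReal hDb.le
  have hn := hjet.sobolevNorm_le hab hD.le hE
  refine ⟨⟨continuous_const, ⟨_, fun x => le_rfl⟩, hn.trans_lt ENNReal.ofReal_lt_top⟩, ?_,
    fun x => hζb.le, hn⟩
  rw [integral_const, measureReal_def, leb_univ, ENNReal.toReal_ofReal hab'.le, smul_eq_mul,
    mul_inv_cancel₀ hab'.ne']

theorem midpoint_mem_densities (hab : a < b) (hD : 0 ≤ D) {p q : Dom a b → ℝ}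
    (hp : p ∈ densities a b t ζ D) (hq : q ∈ densities a b t ζ D) :
    (fun x => 2⁻¹ * p x + 2⁻¹ * q x) ∈ densities a b t ζ D := by
  obtain ⟨F, hF⟩ := exists_isJet hp.1.2.2
  obtain ⟨G, hG⟩ := exists_isJet hq.1.2.2
  have hE : energy t (fun α x => 2⁻¹ * F α x + 2⁻¹ * G α x) ≤ ENNReal.ofReal (D ^ 2) := by
    refine (energy_half_add_le hF.measurable hG.measurable).trans ?_
    refine (add_le_add (mul_le_mul_right (hF.energy_le hab hD hp.2.2.2) _)
      (mul_le_mul_right (hG.energy_le hab hD hq.2.2.2) _)).trans_eq ?_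
    rw [← add_mul, ENNReal.inv_two_add_inv_two, one_mul]
  have hn := (hF.lin hG 2⁻¹ 2⁻¹).sobolevNorm_le hab hD hE
  obtain ⟨B, hB⟩ := hp.1.2.1
  obtain ⟨B', hB'⟩ := hq.1.2.1
  refine ⟨⟨(hp.1.1.const_mul _).add (hq.1.1.const_mul _), ⟨2⁻¹ * B + 2⁻¹ * B', fun x => ?_⟩,
    hn.trans_lt ENNReal.ofReal_lt_top⟩, ?_, fun x => ?_, hn⟩
  · have h1 := abs_le.1 (hB x)
    have h2 := abs_le.1 (hB' x)
    rw [abs_le]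
    constructor <;> linarith [h1.1, h1.2, h2.1, h2.2]
  · rw [integral_add ((integrable_of_mem_densities hp).const_mul _)
      ((integrable_of_mem_densities hq).const_mul _), integral_const_mul, integral_const_mul,
      hp.2.1, hq.2.1]
    norm_num
  · linarith [hp.2.2.1 x, hq.2.2.1 x]

theorem tendsto_integral_of_forall_abs_sub_le {f : ℕ → Dom a b → ℝ} {p : Dom a b → ℝ}
    (hf : ∀ n, Integrable (f n) (leb a b)) (hp : Integrable p (leb a b)) {κ : ℕ → ℝ}
    (hκ : Tendsto κ atTop (𝓝 0)) (h : ∀ n x, |f n x - p x| ≤ κ n) :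
    Tendsto (fun n => ∫ x, f n x ∂(leb a b)) atTop (𝓝 (∫ x, p x ∂(leb a b))) := by
  rw [tendsto_iff_norm_sub_tendsto_zero]
  refine squeeze_zero (g := fun n => κ n * (leb a b).real univ) (fun n => norm_nonneg _)
    (fun n => ?_) (by simpa using hκ.mul_const ((leb a b).real univ))
  rw [← integral_sub (hf n) hp]
  exact norm_integral_le_of_norm_le_const (ae_of_all _ (h n))

/-- A sequence of functions with weak derivatives of order `α` that form a fast Cauchy sequence in
`L²` and converge almost everywhere. -/
theorem IsWeakDeriv.of_tendsto {α : ℕ} {f F : ℕ → Dom a b → ℝ} {p g : Dom a b → ℝ}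
    (hfF : ∀ n, IsWeakDeriv α (f n) (F n)) (hf : ∀ n, Integrable (f n) (leb a b))
    (hp : Integrable p (leb a b)) {κ : ℕ → ℝ} (hκ : Tendsto κ atTop (𝓝 0))
    (h : ∀ n x, |f n x - p x| ≤ κ n) (hF : ∀ n, Integrable (F n) (leb a b))
    (hg : Integrable g (leb a b))
    (hFg : Tendsto (fun n => ∫⁻ x, ‖F n x - g x‖ₑ ∂(leb a b)) atTop (𝓝 0)) :
    IsWeakDeriv α p g := by
  refine ⟨hp.locallyIntegrable, hg.locallyIntegrable, fun φ h1 h2 h3 => ?_⟩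
  have hφ : IsTest a b φ := ⟨h1, h2, h3⟩
  obtain ⟨C, hC0, hC⟩ := (hφ.iteratedDeriv α).exists_bound
  obtain ⟨C', hC0', hC'⟩ := hφ.exists_bound
  have hl : Tendsto (fun n => ∫ x, f n x * iteratedDeriv α φ x ∂(leb a b)) atTop
      (𝓝 (∫ x, p x * iteratedDeriv α φ x ∂(leb a b))) := by
    refine tendsto_integral_of_forall_abs_sub_le (κ := fun n => κ n * C)
      (fun n => (hφ.iteratedDeriv α).integrable_mul (hf n).locallyIntegrable)
      ((hφ.iteratedDeriv α).integrable_mul hp.locallyIntegrable) (by simpa using hκ.mul_const C)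
      fun n x => ?_
    rw [← sub_mul, abs_mul]
    exact mul_le_mul (h n x) (hC x) (abs_nonneg _) ((abs_nonneg _).trans (h n x))
  have hr : Tendsto (fun n => ∫ x, F n x * φ x ∂(leb a b)) atTop
      (𝓝 (∫ x, g x * φ x ∂(leb a b))) := by
    refine tendsto_integral_of_L1 _ (hφ.integrable_mul hg.locallyIntegrable).aestronglyMeasurable
      (Eventually.of_forall fun n => hφ.integrable_mul (hF n).locallyIntegrable) ?_
    refine tendsto_of_tendsto_of_tendsto_of_le_of_le tendsto_const_nhds
      (by simpa using ENNReal.Tendsto.mul_const hFg (Or.inr (ENNReal.ofReal_ne_top (r := C'))))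
      (fun n => zero_le) fun n => ?_
    simp only
    rw [← lintegral_mul_const' _ _ ENNReal.ofReal_ne_top]
    refine lintegral_mono fun x => ?_
    rw [← sub_mul, enorm_mul, Real.enorm_eq_ofReal_abs (φ x)]
    gcongr
    exact hC' x
  have hlim := hr.const_mul ((-1 : ℝ) ^ α)
  refine tendsto_nhds_unique hl (hlim.congr fun n => ?_)
  exact ((hfF n).integral_eq hφ).symm

theorem eLpNorm_two_sq (f : Dom a b → ℝ) :
    eLpNorm f 2 (leb a b) ^ 2 = ∫⁻ x, ‖f x‖ₑ ^ 2 ∂(leb a b) := by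
  rw [eLpNorm_eq_lintegral_rpow_enorm_toReal (by norm_num) (by norm_num)]
  simp only [ENNReal.toReal_ofNat, ENNReal.rpow_ofNat]
  rw [← ENNReal.rpow_natCast, ← ENNReal.rpow_mul]
  norm_num

/-- Uniform limits of jets that form a fast Cauchy sequence in the Sobolev norm. -/
theorem exists_isJet_of_cauchy (hab : a < b) {f : ℕ → Dom a b → ℝ} {F : ℕ → ℕ → Dom a b → ℝ}
    {p : Dom a b → ℝ} (hF : ∀ n, IsJet ⌊t⌋₊ (f n) (F n)) (hf : ∀ n, Integrable (f n) (leb a b))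
    (hp : Integrable p (leb a b)) {κ : ℕ → ℝ} (hκ : Tendsto κ atTop (𝓝 0))
    (h : ∀ n x, |f n x - p x| ≤ κ n) {E : ℝ≥0∞} (hE : E < ⊤) (hFE : ∀ n, energy t (F n) ≤ E)
    (hcauchy : ∀ N n m, N ≤ n → N ≤ m →
      energy t (fun α x => 1 * F n α x + -1 * F m α x) < (2⁻¹ ^ N) ^ 2) :
    ∃ G, IsJet ⌊t⌋₊ p G ∧ energy t G ≤ E := by
  have hB : ∑' N : ℕ, (2⁻¹ : ℝ≥0∞) ^ N ≠ ⊤ := by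
    rw [ENNReal.tsum_geometric]
    simp
  have hLp : ∀ α ≤ ⌊t⌋₊, ∀ N n m, N ≤ n → N ≤ m →
      eLpNorm (F n α - F m α) 2 (leb a b) < 2⁻¹ ^ N := by
    intro α hα N n m hn hm
    refine lt_of_pow_lt_pow_left' 2 ?_
    rw [eLpNorm_two_sq]
    refine lt_of_le_of_lt ?_ (hcauchy N n m hn hm)
    have := lintegral_sq_le_energy (s := t) hab (G := fun α x => 1 * F n α x + -1 * F m α x)
      (fun α => (((hF n).measurable α).const_mul 1).add (((hF m).measurable α).const_mul (-1))) hα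
    refine le_trans (le_of_eq ?_) this
    refine lintegral_congr fun x => ?_
    simp [sub_eq_add_neg]
  have hex : ∀ α, ∃ g : Dom a b → ℝ, Measurable g ∧
      (α ≤ ⌊t⌋₊ → ∀ᵐ x ∂(leb a b), Tendsto (fun n => F n α x) atTop (𝓝 (g x))) := by
    intro α
    by_cases hα : α ≤ ⌊t⌋₊
    -- The rates `2⁻ᴺ` are summable, so the whole sequence converges almost everywhere and no
    -- subsequence is needed.
    · have hae := Lp.ae_tendsto_of_cauchy_eLpNorm
        (fun n => ((hF n).measurable α).aestronglyMeasurable) (by norm_num) hB (hLp α hα)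
      obtain ⟨g, hg, hg'⟩ := measurable_limit_of_tendsto_metrizable_ae
        (fun n => ((hF n).measurable α).aemeasurable) hae
      exact ⟨g, hg, fun _ => hg'⟩
    · exact ⟨0, measurable_zero, fun h => absurd h hα⟩
  choose G hGm hG using hex
  -- Fatou on the square: pointwise convergence of the derivatives gives almost everywhere
  -- convergence of the energy densities, including the difference quotients.
  have hGE : energy t G ≤ E := by
    have hd : ∀ᵐ q ∂((leb a b).prod (leb a b)),
        Tendsto (fun n => energyDensity t (F n) q) atTop (𝓝 (energyDensity t G q)) := by
      have h1 : ∀ᵐ q ∂((leb a b).prod (leb a b)), ∀ α ≤ ⌊t⌋₊,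
          Tendsto (fun n => F n α q.1) atTop (𝓝 (G α q.1)) :=
        Measure.quasiMeasurePreserving_fst.ae (p := fun x => ∀ α ≤ ⌊t⌋₊,
          Tendsto (fun n => F n α x) atTop (𝓝 (G α x)))
          (ae_all_iff.2 fun α => by
            by_cases hα : α ≤ ⌊t⌋₊
            · exact (hG α hα).mono fun x hx _ => hx
            · exact ae_of_all _ fun x h => absurd h hα)
      have h2 : ∀ᵐ q ∂((leb a b).prod (leb a b)),
          Tendsto (fun n => F n ⌊t⌋₊ q.2) atTop (𝓝 (G ⌊t⌋₊ q.2)) :=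
        Measure.quasiMeasurePreserving_snd.ae (hG _ le_rfl)
      filter_upwards [h1, h2] with q hq1 hq2
      have hs : Tendsto (fun n => (∑ α ∈ Finset.range (⌊t⌋₊ + 1), (F n α q.1) ^ 2) / (b - a)) atTop
          (𝓝 ((∑ α ∈ Finset.range (⌊t⌋₊ + 1), (G α q.1) ^ 2) / (b - a))) :=
        (tendsto_finsetSum _ fun α hα =>
          (hq1 α (Nat.lt_succ_iff.1 (Finset.mem_range.1 hα))).pow 2).div_const _
      unfold energyDensity
      split_ifs
      · exact hs.add_const 0
      · exact hs.add ((((hq1 _ le_rfl).sub hq2).pow 2).div_const _)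
    have hF' := lintegral_liminf_le (μ := (leb a b).prod (leb a b)) (u := atTop)
      (f := fun n q => ENNReal.ofReal (energyDensity t (F n) q))
      fun n => (measurable_energyDensity (hF n).measurable).ennreal_ofReal
    calc energy t G = ∫⁻ q, liminf (fun n => ENNReal.ofReal (energyDensity t (F n) q)) atTop
          ∂((leb a b).prod (leb a b)) :=
          lintegral_congr_ae (hd.mono fun q hq => (ENNReal.tendsto_ofReal hq).liminf_eq.symm)
      _ ≤ liminf (fun n => energy t (F n)) atTop := hF'
      _ ≤ liminf (fun _ : ℕ => E) atTop := liminf_le_liminf (Eventually.of_forall hFE)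
      _ = E := liminf_const E
  refine ⟨G, ⟨hGm, fun α hα => ?_⟩, hGE⟩
  have hFi : ∀ n, Integrable (F n α) (leb a b) := fun n =>
    integrable_of_lintegral_sq_lt_top ((hF n).measurable α)
      ((lintegral_sq_le_energy hab (hF n).measurable hα).trans_lt ((hFE n).trans_lt hE))
  have hGi : Integrable (G α) (leb a b) :=
    integrable_of_lintegral_sq_lt_top (hGm α)
      ((lintegral_sq_le_energy hab hGm hα).trans_lt (hGE.trans_lt hE))
  refine IsWeakDeriv.of_tendsto (fun n => (hF n).isWeakDeriv α hα) hf hp hκ h hFi hGi ?_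
  have hL2 := Lp.cauchy_tendsto_of_tendsto
    (fun n => ((hF n).measurable α).aestronglyMeasurable) (G α) hB (hLp α hα) (hG α hα)
  have hL2' := ENNReal.Tendsto.const_mul
    (((ENNReal.continuous_pow 2).tendsto _).comp hL2) (Or.inr (measure_ne_top (leb a b) univ))
  have hle : ∀ n, (∫⁻ x, ‖F n α x - G α x‖ₑ ∂(leb a b)) ^ 2 ≤
      leb a b univ * eLpNorm (F n α - G α) 2 (leb a b) ^ 2 := by
    intro n
    rw [eLpNorm_two_sq]
    exact sq_lintegral_le _ (((hF n).measurable α).sub (hGm α)).enorm.aemeasurable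
  have hsq : Tendsto (fun n => (∫⁻ x, ‖F n α x - G α x‖ₑ ∂(leb a b)) ^ 2) atTop (𝓝 0) :=
    tendsto_of_tendsto_of_tendsto_of_le_of_le tendsto_const_nhds (by simpa using hL2')
      (fun n => zero_le) hle
  have := hsq.ennrpow_const (1 / 2 : ℝ)
  refine (by simpa using this : Tendsto _ atTop (𝓝 (0 : ℝ≥0∞))).congr fun n => ?_
  rw [← ENNReal.rpow_natCast, ← ENNReal.rpow_mul]
  norm_num

end Closedness

/-! ### Closedness of the model under uniform limits. -/

section Closedness

variable {t ζ D : ℝ}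

/-- The set of densities is closed under uniform limits. -/
theorem mem_densities_of_forall_approx (hab : a < b) (hD : 0 ≤ D) {p : Dom a b → ℝ}
    (hp : ∀ ε > 0, ∃ q ∈ densities a b t ζ D, ∀ x, |q x - p x| ≤ ε) :
    p ∈ densities a b t ζ D := by
  have hκpos : ∀ k : ℕ, 0 < 1 / ((k : ℝ) + 1) := fun k => by positivity
  -- `S k` collects the energies of model elements within `1/(k + 1)` of `p`. The infima increase
  -- with `k` to a finite `d`, the least energy asymptotically needed to approximate `p`.
  set S : ℕ → Set ℝ≥0∞ := fun k => {e | ∃ q ∈ densities a b t ζ D,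
    (∀ x, |q x - p x| ≤ 1 / ((k : ℝ) + 1)) ∧ ∃ F, IsJet ⌊t⌋₊ q F ∧ energy t F = e} with hS
  have hSanti : ∀ {k l}, k ≤ l → S l ⊆ S k := by
    rintro k l hkl e ⟨q, hq, hqp, F, hF, rfl⟩
    exact ⟨q, hq, fun x => (hqp x).trans (one_div_le_one_div_of_le (by positivity)
      (by exact_mod_cast Nat.succ_le_succ hkl)), F, hF, rfl⟩
  have hSle : ∀ k, ∀ e ∈ S k, e ≤ ENNReal.ofReal (D ^ 2) := by
    rintro k e ⟨q, hq, hqp, F, hF, rfl⟩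
    exact hF.energy_le hab hD hq.2.2.2
  have hSne : ∀ k, (S k).Nonempty := by
    intro k
    obtain ⟨q, hq, hqp⟩ := hp _ (hκpos k)
    obtain ⟨F, hF⟩ := exists_isJet hq.1.2.2
    exact ⟨_, q, hq, hqp, F, hF, rfl⟩
  have hdle : ∀ k, sInf (S k) ≤ ENNReal.ofReal (D ^ 2) := fun k =>
    (sInf_le (hSne k).some_mem).trans (hSle k _ (hSne k).some_mem)
  set d := ⨆ k, sInf (S k) with hd
  have hdtop : d ≠ ⊤ := ((iSup_le hdle).trans_lt ENNReal.ofReal_lt_top).ne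
  -- Chosen so that `4 · 2 η N` is half of the required bound `(2⁻ᴺ)²`.
  set η : ℕ → ℝ≥0∞ := fun N => (2⁻¹ ^ N) ^ 2 / 16 with hη
  have hηtop : ∀ N, η N ≠ ⊤ := fun N =>
    ENNReal.div_ne_top (ENNReal.pow_ne_top (ENNReal.pow_ne_top (by simp))) (by norm_num)
  have hη0 : ∀ N, η N ≠ 0 := fun N =>
    (ENNReal.div_pos (pow_ne_zero _ (pow_ne_zero _ (by simp))) (by norm_num)).ne'
  have hηanti : Antitone η := by
    intro m n hmn
    simp only [hη]
    gcongr ?_ ^ 2 / 16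
    exact pow_le_pow_right_of_le_one' (by simp) hmn
  have hK : ∀ N, ∃ k, d ≤ sInf (S k) + η N := by
    intro N
    by_contra! hcon
    have h1 : d + η N ≤ d := by
      conv_lhs => rw [hd, ENNReal.iSup_add]
      exact iSup_le fun k => (hcon k).le
    have h2 : d + η N ≤ d + 0 := by simpa using h1
    exact hη0 N (nonpos_iff_eq_zero.1 ((ENNReal.add_le_add_iff_left hdtop).1 h2))
  choose K hK using hK
  -- A sum dominates all earlier `K i` and also `N`, so the approximants beyond `N` are close enough
  -- to `p` for level `K N`.
  set k : ℕ → ℕ := fun N => ∑ i ∈ Finset.range (N + 1), (K i + 1) with hk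
  have hKk : ∀ {N n}, N ≤ n → K N ≤ k n := fun {N n} hNn =>
    (Nat.le_succ _).trans (Finset.single_le_sum (f := fun i => K i + 1) (fun _ _ => Nat.zero_le _)
      (Finset.mem_range.2 (Nat.lt_succ_of_le hNn)))
  have hNk : ∀ N, N ≤ k N := by
    intro N
    have : ∑ i ∈ Finset.range (N + 1), 1 ≤ k N := Finset.sum_le_sum fun i _ => by omega
    simp at this
    omega
  have hsel : ∀ N, ∃ e ∈ S (k N), e ≤ d + η N := by
    intro N
    have hlt : sInf (S (k N)) < d + η N :=
      (le_iSup (fun k => sInf (S k)) (k N)).trans_lt (ENNReal.lt_add_right hdtop (hη0 N))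
    obtain ⟨e, he, hlt⟩ := sInf_lt_iff.1 hlt
    exact ⟨e, he, hlt.le⟩
  choose e he hed using hsel
  choose f hf hfp F hF hFe using he
  have hcauchy : ∀ N n m, N ≤ n → N ≤ m →
      energy t (fun α x => 1 * F n α x + -1 * F m α x) < (2⁻¹ ^ N) ^ 2 := by
    intro N n m hn hm
    -- The midpoint also competes at level `K N`, so its energy is at least `d - η N`; as both ends
    -- have energy at most `d + η N`, the parallelogram law leaves at most `2 η N` for the half
    -- difference.
    have hmid : energy t (fun α x => 2⁻¹ * F n α x + 2⁻¹ * F m α x) ∈ S (K N) := by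
      refine ⟨_, midpoint_mem_densities hab hD (hf n) (hf m), fun x => ?_, _,
        (hF n).lin (hF m) 2⁻¹ 2⁻¹, rfl⟩
      have hle : ∀ {j}, N ≤ j → |f j x - p x| ≤ 1 / ((K N : ℝ) + 1) := fun hj =>
        (hfp _ x).trans (one_div_le_one_div_of_le (by positivity)
          (by exact_mod_cast Nat.succ_le_succ (hKk hj)))
      have h1 := abs_le.1 (hle hn)
      have h2 := abs_le.1 (hle hm)
      rw [abs_le]
      constructor <;> linarith [h1.1, h1.2, h2.1, h2.2]
    have hpar := energy_parallelogram (s := t) (hF n).measurable (hF m).measurable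
    set hdiff := energy t (fun α x => 2⁻¹ * F n α x + -2⁻¹ * F m α x) with hhd
    have hup : energy t (fun α x => 2⁻¹ * F n α x + 2⁻¹ * F m α x) + hdiff ≤ d + η N := by
      rw [hpar, hFe, hFe]
      refine (add_le_add (mul_le_mul_right ((hed n).trans (add_le_add_right (hηanti hn) d)) _)
        (mul_le_mul_right ((hed m).trans (add_le_add_right (hηanti hm) d)) _)).trans_eq ?_
      rw [← add_mul, ENNReal.inv_two_add_inv_two, one_mul]
    have hlow : d + hdiff ≤ d + 2 * η N := by
      calc d + hdiff ≤ (sInf (S (K N)) + η N) + hdiff := by gcongr; exact hK N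
        _ ≤ (energy t (fun α x => 2⁻¹ * F n α x + 2⁻¹ * F m α x) + η N) + hdiff := by
            gcongr
            exact sInf_le hmid
        _ = (energy t (fun α x => 2⁻¹ * F n α x + 2⁻¹ * F m α x) + hdiff) + η N := by ring
        _ ≤ (d + η N) + η N := by gcongr
        _ = d + 2 * η N := by ring
    have hsmall : hdiff ≤ 2 * η N := (ENNReal.add_le_add_iff_left hdtop).1 hlow
    rw [energy_sub_eq (hF n).measurable (hF m).measurable, ← hhd]
    have hpos : ((2⁻¹ : ℝ≥0∞) ^ N) ^ 2 ≠ 0 := pow_ne_zero _ (pow_ne_zero _ (by simp))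
    have htop : ((2⁻¹ : ℝ≥0∞) ^ N) ^ 2 ≠ ⊤ := ENNReal.pow_ne_top (ENNReal.pow_ne_top (by simp))
    calc 4 * hdiff ≤ 4 * (2 * η N) := by gcongr
      _ = (2⁻¹ ^ N) ^ 2 / 2 := by
          simp only [hη]
          rw [div_eq_mul_inv, div_eq_mul_inv, show (16 : ℝ≥0∞) = 8 * 2 by norm_num,
            ENNReal.mul_inv (by norm_num) (by norm_num)]
          calc _ = (8 * 8⁻¹ : ℝ≥0∞) * ((2⁻¹ ^ N) ^ 2 * 2⁻¹) := by ring
            _ = _ := by rw [ENNReal.mul_inv_cancel (by norm_num) (by norm_num), one_mul]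
      _ < _ := ENNReal.half_lt_self hpos htop
  have hκ : Tendsto (fun n : ℕ => 1 / ((n : ℝ) + 1)) atTop (𝓝 0) :=
    tendsto_one_div_add_atTop_nhds_zero_nat
  have hfp' : ∀ n x, |f n x - p x| ≤ 1 / ((n : ℝ) + 1) := fun n x =>
    (hfp n x).trans (one_div_le_one_div_of_le (by positivity)
      (by exact_mod_cast Nat.succ_le_succ (hNk n)))
  have hpc : Continuous p := by
    refine TendstoUniformly.continuous (F := f) (p := atTop) ?_
      (Frequently.of_forall fun n => (hf n).1.1)
    rw [Metric.tendstoUniformly_iff]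
    intro ε hε
    filter_upwards [hκ.eventually_lt_const hε] with n hn x
    rw [dist_comm]
    exact (hfp' n x).trans_lt hn
  obtain ⟨B, hB⟩ := (hf 0).1.2.1
  have hpB : ∀ x, |p x| ≤ B + 1 := by
    intro x
    have h1 := abs_le.1 (hB x)
    have h2 := abs_le.1 (hfp' 0 x)
    norm_num at h2
    rw [abs_le]
    constructor <;> linarith [h1.1, h1.2, h2.1, h2.2]
  have hpi := integrable_of_continuous_bdd hpc hpB
  have hfi := fun n => integrable_of_mem_densities (hf n)
  obtain ⟨G, hG, hGE⟩ := exists_isJet_of_cauchy hab hF hfi hpi hκ hfp'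
    (E := ENNReal.ofReal (D ^ 2)) ENNReal.ofReal_lt_top
    (fun n => (hF n).energy_le hab hD (hf n).2.2.2) hcauchy
  have hn := hG.sobolevNorm_le hab hD hGE
  refine ⟨⟨hpc, ⟨_, hpB⟩, hn.trans_lt ENNReal.ofReal_lt_top⟩, ?_, fun x => ?_, hn⟩
  · have := tendsto_integral_of_forall_abs_sub_le hfi hpi hκ hfp'
    simp_rw [fun n => (hf n).2.1] at this
    exact tendsto_nhds_unique this tendsto_const_nhds
  · refine ge_of_tendsto' (x := atTop) (f := fun n => f n x) ?_ fun n => (hf n).2.2.1 x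
    rw [tendsto_iff_norm_sub_tendsto_zero]
    exact squeeze_zero (fun n => norm_nonneg _) (fun n => hfp' n x) hκ

end Closedness

/-! ### Compactness of the model in the sup-norm on the closed interval. -/

section Compactness

variable {t ζ D : ℝ}

open BoundedContinuousFunction

/-- The inclusion of the open interval into the closed interval. -/
def toIcc (x : Dom a b) : Icc a b := ⟨x, Ioo_subset_Icc_self x.2⟩

theorem isometry_toIcc : Isometry (toIcc : Dom a b → Icc a b) := fun _ _ => rfl

theorem denseRange_toIcc (hab : a < b) : DenseRange (toIcc : Dom a b → Icc a b) := by
  intro y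
  have hy : (y : ℝ) ∈ closure (Ioo a b) := by
    rw [closure_Ioo hab.ne]
    exact y.2
  rw [closure_subtype]
  convert hy
  ext z
  constructor
  · rintro ⟨_, ⟨x, rfl⟩, rfl⟩
    exact x.2
  · exact fun hz => ⟨toIcc ⟨z, hz⟩, ⟨_, rfl⟩, rfl⟩

/-- The bounded continuous functions on `[a, b]` whose restrictions to `(a, b)` are the elements
of `𝒫(t, ζ, D)`. -/
def extDensities (a b t ζ D : ℝ) : Set (Icc a b →ᵇ ℝ) :=
  {F | (fun x => F (toIcc x)) ∈ densities a b t ζ D}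

/-- The Hölder bound makes `p` uniformly continuous, hence extendable to the endpoints; on the
compact `[a, b]` Arzelà–Ascoli becomes available. -/
theorem exists_extDensities (hab : a < b) (ht : 1 / 2 < t) (hD : 0 ≤ D) {p : Dom a b → ℝ}
    (hp : p ∈ densities a b t ζ D) :
    ∃ F ∈ extDensities a b t ζ D, ∀ x, F (toIcc x) = p x := by
  obtain ⟨C, γ, hC, hγ, h⟩ := exists_holder_bound hab ht hD
  have hu : UniformContinuous p := by
    rw [Metric.uniformContinuous_iff]
    intro ε hε
    have hlim : Tendsto (fun r : ℝ => C * r ^ γ) (𝓝 0) (𝓝 0) := by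
      have := (Real.continuousAt_rpow_const 0 γ (Or.inr hγ.le)).tendsto.const_mul C
      simpa [Real.zero_rpow hγ.ne'] using this
    obtain ⟨δ, hδ, hδ'⟩ := Metric.eventually_nhds_iff.1 (hlim.eventually_lt_const hε)
    refine ⟨δ, hδ, fun x y hxy => ?_⟩
    rw [Real.dist_eq]
    refine (h p hp.1 hp.2.2.2 x y).trans_lt (hδ' ?_)
    rw [Subtype.dist_eq, Real.dist_eq] at hxy
    rw [Real.dist_eq, sub_zero, abs_abs]
    exact hxy
  have hi := (isometry_toIcc (a := a) (b := b)).isUniformInducing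
  have hd := denseRange_toIcc hab
  let F : Icc a b →ᵇ ℝ := BoundedContinuousFunction.mkOfCompact
    ⟨(hi.isDenseInducing hd).extend p, (uniformContinuous_uniformly_extend hi hd hu).continuous⟩
  have hF : ∀ x, F (toIcc x) = p x := uniformly_extend_of_ind hi hd hu
  refine ⟨F, ?_, hF⟩
  rw [extDensities, mem_ofPred_eq, funext hF]
  exact hp

theorem dist_le_of_forall_toIcc (hab : a < b) {F G : Icc a b →ᵇ ℝ} {ε : ℝ} (hε : 0 ≤ ε)
    (h : ∀ x, |F (toIcc x) - G (toIcc x)| ≤ ε) : dist F G ≤ ε := by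
  rw [BoundedContinuousFunction.dist_le hε]
  intro y
  exact (denseRange_toIcc hab).induction_on (p := fun y => dist (F y) (G y) ≤ ε) y
    (isClosed_le (F.continuous.dist G.continuous) continuous_const) h

theorem isCompact_extDensities (hab : a < b) (ht : 1 / 2 < t) (hζ : 0 ≤ ζ) (hD : 0 ≤ D) :
    IsCompact (extDensities a b t ζ D) := by
  obtain ⟨C, γ, hC, hγ, h⟩ := exists_holder_bound hab ht hD
  obtain ⟨B, hB0, hB⟩ := exists_bound_densities hab ht hζ hD
  have hd := denseRange_toIcc hab
  have hclosed : IsClosed (extDensities a b t ζ D) := by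
    refine isClosed_of_closure_subset fun F hF => ?_
    refine mem_densities_of_forall_approx hab hD fun ε hε => ?_
    obtain ⟨G, hG, hFG⟩ := Metric.mem_closure_iff.1 hF ε hε
    refine ⟨_, hG, fun x => ?_⟩
    rw [← Real.dist_eq, dist_comm]
    exact (BoundedContinuousFunction.dist_coe_le_dist _).trans hFG.le
  rw [← hclosed.closure_eq]
  refine BoundedContinuousFunction.arzela_ascoli (Icc (-B) B) isCompact_Icc _ (fun F y hF => ?_) ?_
  · exact hd.induction_on (p := fun y => F y ∈ Icc (-B) B) y
      (isClosed_Icc.preimage F.continuous) fun x => abs_le.1 (hB _ hF x)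
  · have hlim : Tendsto (fun r : ℝ => C * r ^ γ) (𝓝 0) (𝓝 0) := by
      have := (Real.continuousAt_rpow_const 0 γ (Or.inr hγ.le)).tendsto.const_mul C
      simpa [Real.zero_rpow hγ.ne'] using this
    refine Metric.equicontinuous_of_continuity_modulus _ hlim _ fun x y F => ?_
    refine hd.induction_on₂ (p := fun x y => dist ((F : Icc a b →ᵇ ℝ) x) ((F : Icc a b →ᵇ ℝ) y) ≤
      C * dist x y ^ γ) ?_ (fun x y => ?_) x y
    · refine isClosed_le ?_ ?_
      · exact ((F : Icc a b →ᵇ ℝ).continuous.comp continuous_fst).dist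
          ((F : Icc a b →ᵇ ℝ).continuous.comp continuous_snd)
      · exact continuous_const.mul ((continuous_fst.dist continuous_snd).rpow_const
          fun _ => Or.inr hγ.le)
    · have := h _ F.2.1 F.2.2.2.2 x y
      rw [← Real.dist_eq, ← Real.dist_eq, ← Subtype.dist_eq] at this
      exact this

end Compactness

/-! ### The likelihood and its maximizers. -/

section Likelihood

variable {t ζ D : ℝ} {n : ℕ}

/-- Passing to products avoids arithmetic with `-∞`: maximizing the log-likelihood becomes
maximizing a real product, including where a density vanishes. -/
theorem logLik_eq (x : Fin n → Dom a b) (p : Dom a b → ℝ) :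
    logLik x p = (((n : ℝ)⁻¹ : ℝ) : EReal) * ENNReal.log (∏ i, ENNReal.ofReal (p (x i))) := by
  have : ∀ s : Finset (Fin n), ∑ i ∈ s, ENNReal.log (ENNReal.ofReal (p (x i))) =
      ENNReal.log (∏ i ∈ s, ENNReal.ofReal (p (x i))) := by
    intro s
    induction s using Finset.cons_induction with
    | empty => simp
    | cons i s hi ih => rw [Finset.sum_cons, Finset.prod_cons, ENNReal.log_mul_add, ih]
  rw [logLik, this]

theorem logLik_le_logLik_iff (hn : 0 < n) (x : Fin n → Dom a b) {p q : Dom a b → ℝ}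
    (hp : ∀ i, 0 ≤ p (x i)) (hq : ∀ i, 0 ≤ q (x i)) :
    logLik x p ≤ logLik x q ↔ ∏ i, p (x i) ≤ ∏ i, q (x i) := by
  have hn' : (0 : ℝ) < n := by exact_mod_cast hn
  have hpos : (0 : EReal) ≤ (((n : ℝ)⁻¹ : ℝ) : EReal) := by exact_mod_cast (inv_pos.2 hn').le
  have hpos' : (0 : EReal) ≤ ((n : ℝ) : EReal) := by exact_mod_cast hn'.le
  have hcancel : ∀ z : EReal, ((n : ℝ) : EReal) * ((((n : ℝ)⁻¹ : ℝ) : EReal) * z) = z := by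
    intro z
    rw [← mul_assoc, ← EReal.coe_mul, mul_inv_cancel₀ hn'.ne', EReal.coe_one, one_mul]
  have hiff : ∀ y z : EReal, (((n : ℝ)⁻¹ : ℝ) : EReal) * y ≤ (((n : ℝ)⁻¹ : ℝ) : EReal) * z ↔
      y ≤ z := by
    refine fun y z => ⟨fun h => ?_, fun h => mul_le_mul_of_nonneg_left h hpos⟩
    have := mul_le_mul_of_nonneg_left h hpos'
    rwa [hcancel, hcancel] at this
  rw [logLik_eq, logLik_eq, hiff, ENNReal.log_le_log_iff,
    ← ENNReal.ofReal_prod_of_nonneg fun i _ => hp i, ← ENNReal.ofReal_prod_of_nonneg fun i _ => hq i,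
    ENNReal.ofReal_le_ofReal_iff (Finset.prod_nonneg fun i _ => hq i)]

/-- The product is continuous in the sup-norm on a compact set, which is non-empty because it
contains the uniform density. -/
theorem exists_isNPML (hab : a < b) (ht : 1 / 2 < t) (hζ : 0 ≤ ζ) (hζb : ζ < (b - a)⁻¹)
    (hD : 0 < D) (hDb : (b - a)⁻¹ < D ^ 2) (hn : 0 < n) (x : Fin n → Dom a b) :
    ∃ p, IsNPML t ζ D x p := by
  obtain ⟨F₀, hF₀, -⟩ := exists_extDensities hab ht hD.le
    (const_mem_densities (t := t) hab hζb hD hDb)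
  obtain ⟨F, hF, hmax⟩ := (isCompact_extDensities hab ht hζ hD.le).exists_isMaxOn ⟨F₀, hF₀⟩
    (f := fun F => ∏ i, F (toIcc (x i)))
    (continuous_finsetProd _ fun i _ => continuous_eval_const _).continuousOn
  refine ⟨fun y => F (toIcc y), hF, le_antisymm (le_iSup₂_of_le _ hF le_rfl)
    (iSup₂_le fun q hq => ?_)⟩
  obtain ⟨G, hG, hGq⟩ := exists_extDensities hab ht hD.le hq
  rw [logLik_le_logLik_iff hn x (fun i => hζ.trans (hq.2.2.1 _)) fun i => hζ.trans (hF.2.2.1 _)]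
  simp_rw [← hGq]
  exact hmax hG

theorem IsNPML.prod_le (hζ : 0 ≤ ζ) (hn : 0 < n) {x : Fin n → Dom a b} {p q : Dom a b → ℝ}
    (hp : IsNPML t ζ D x p) (hq : q ∈ densities a b t ζ D) :
    ∏ i, q (x i) ≤ ∏ i, p (x i) := by
  rw [← logLik_le_logLik_iff hn x (fun i => hζ.trans (hq.2.2.1 _))
    fun i => hζ.trans (hp.1.2.2.1 _), hp.2]
  exact le_iSup₂_of_le q hq le_rfl

/-- The likelihood inequality of an estimator over a convex set of densities. -/
theorem IsNPML.sum_div_le (hab : a < b) (hζ : 0 ≤ ζ) (hD : 0 ≤ D) (hn : 0 < n)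
    {x : Fin n → Dom a b} {p q : Dom a b → ℝ} (hp : IsNPML t ζ D x p)
    (hq : q ∈ densities a b t ζ D) (hpos : ∀ i, 0 < q (x i)) :
    ∑ i, 2 * q (x i) / (p (x i) + q (x i)) ≤ n := by
  have hp0 : ∀ i, 0 ≤ p (x i) := fun i => hζ.trans (hp.1.2.2.1 _)
  have hle := hp.prod_le hζ hn (midpoint_mem_densities hab hD hp.1 hq)
  have hmid : ∀ i, 0 < 2⁻¹ * p (x i) + 2⁻¹ * q (x i) := fun i => by
    have := hp0 i
    have := hpos i
    positivity
  -- The maximizer beats the midpoint. Bounding each ratio `r` by `exp (r - 1)` turns the product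
  -- into a sum, and `r - 1 = 1 - 2q/(p + q)`.
  have h1 : 1 ≤ ∏ i, (p (x i) / (2⁻¹ * p (x i) + 2⁻¹ * q (x i))) := by
    rw [Finset.prod_div_distrib, le_div_iff₀ (Finset.prod_pos fun i _ => hmid i), one_mul]
    exact hle
  have h2 : ∏ i, (p (x i) / (2⁻¹ * p (x i) + 2⁻¹ * q (x i))) ≤
      ∏ i, Real.exp (p (x i) / (2⁻¹ * p (x i) + 2⁻¹ * q (x i)) - 1) := by
    refine Finset.prod_le_prod (fun i _ => div_nonneg (hp0 i) (hmid i).le) fun i _ => ?_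
    have := Real.add_one_le_exp (p (x i) / (2⁻¹ * p (x i) + 2⁻¹ * q (x i)) - 1)
    linarith
  have h3 := h1.trans h2
  rw [← Real.exp_sum, Real.one_le_exp_iff] at h3
  have h4 : ∀ i, p (x i) / (2⁻¹ * p (x i) + 2⁻¹ * q (x i)) - 1 =
      1 - 2 * q (x i) / (p (x i) + q (x i)) := by
    intro i
    have h5 := hmid i
    have h6 : p (x i) + q (x i) ≠ 0 := by linarith
    rw [show 2⁻¹ * p (x i) + 2⁻¹ * q (x i) = (p (x i) + q (x i)) / 2 by ring]
    field_simp
    ring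
  simp_rw [h4] at h3
  rw [Finset.sum_sub_distrib] at h3
  simp at h3
  exact h3

end Likelihood

/-! ### A one-sided uniform strong law. -/

section UniformLaw

variable {V S : Type*} [MeasurableSpace V] [MeasurableSpace S] {μ : Measure V} {Pr : Measure S}
  [IsProbabilityMeasure Pr] {W : ℕ → S → V}

theorem ae_tendsto_average (hWm : ∀ i, Measurable (W i)) (hWi : iIndepFun W Pr)
    (hWl : ∀ i, Pr.map (W i) = μ) {g : V → ℝ} (hg : Measurable g) {C : ℝ} (hC : ∀ v, |g v| ≤ C) :
    ∀ᵐ e ∂Pr, Tendsto (fun n : ℕ => (∑ i ∈ Finset.range n, g (W i e)) / n) atTop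
      (𝓝 (∫ v, g v ∂μ)) := by
  have hint : ∫ v, g v ∂μ = ∫ e, g (W 0 e) ∂Pr := by
    rw [← hWl 0, integral_map (hWm 0).aemeasurable hg.aestronglyMeasurable]
  rw [hint]
  refine strong_law_ae_real (fun i e => g (W i e)) ?_ (fun i j hij => ?_) fun i => ?_
  · exact (integrable_const C).mono' (hg.comp (hWm 0)).aestronglyMeasurable
      (ae_of_all _ fun e => hC _)
  · exact (hWi.indepFun hij).comp hg hg
  · exact (IdentDistrib.mk (hWm i).aemeasurable (hWm 0).aemeasurable
      (by rw [hWl, hWl])).comp hg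

/-- A one-sided uniform strong law of large numbers for families that depend continuously on a
parameter. -/
theorem ae_forall_integral_le_one (hWm : ∀ i, Measurable (W i)) (hWi : iIndepFun W Pr)
    (hWl : ∀ i, Pr.map (W i) = μ) [IsProbabilityMeasure μ] {T : Type*} [PseudoMetricSpace T]
    [TopologicalSpace.SeparableSpace T] {F : V → T → ℝ} (hFm : ∀ τ, Measurable fun v => F v τ)
    (hF0 : ∀ v τ, 0 ≤ F v τ) {C : ℝ} (hFC : ∀ v τ, F v τ ≤ C) (hFc : ∀ᵐ v ∂μ, Continuous (F v)) :
    ∀ᵐ e ∂Pr, ∀ (k : ℕ → ℕ) (τ : ℕ → T) (τ₀ : T), Tendsto k atTop atTop →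
      Tendsto τ atTop (𝓝 τ₀) →
      (∀ j, (∑ i ∈ Finset.range (k j), F (W i e) (τ j)) / (k j : ℝ) ≤ 1) →
      ∫ v, F v τ₀ ∂μ ≤ 1 := by
  obtain ⟨D, hDc, hD⟩ := TopologicalSpace.exists_countable_dense T
  have : Countable D := hDc.to_subtype
  -- Infima over balls with centres and points in a countable dense set: measurable, countably many,
  -- hence one null set serves all of them. For continuous `F v` they bound `F v` from below on the
  -- entire ball.
  set G : D → ℕ → V → ℝ := fun d m v =>
    ⨅ τ : {τ : D // (τ : T) ∈ Metric.ball (d : T) (1 / ((m : ℝ) + 1))}, F v τ.1 with hG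
  have hpos : ∀ m : ℕ, 0 < 1 / ((m : ℝ) + 1) := fun m => by positivity
  have hself : ∀ (d : D) (m : ℕ), (d : T) ∈ Metric.ball (d : T) (1 / ((m : ℝ) + 1)) :=
    fun d m => Metric.mem_ball_self (hpos m)
  have hbdd : ∀ (d : D) (m : ℕ) (v : V), BddBelow (range fun τ : {τ : D // (τ : T) ∈
      Metric.ball (d : T) (1 / ((m : ℝ) + 1))} => F v τ.1) := fun d m v =>
    ⟨0, by rintro _ ⟨τ, rfl⟩; exact hF0 _ _⟩
  have hGm : ∀ d m, Measurable (G d m) := fun d m => Measurable.iInf fun τ => hFm _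
  have hG0 : ∀ d m v, 0 ≤ G d m v := fun d m v => Real.iInf_nonneg fun τ => hF0 _ _
  have hGC : ∀ d m v, |G d m v| ≤ C := fun d m v => by
    rw [abs_of_nonneg (hG0 d m v)]
    exact (ciInf_le (hbdd d m v) ⟨d, hself d m⟩).trans (hFC _ _)
  have hGF : ∀ v, Continuous (F v) → ∀ (d : D) (m : ℕ), ∀ τ ∈ Metric.ball (d : T) (1 / ((m : ℝ) + 1)),
      G d m v ≤ F v τ := by
    intro v hv d m τ hτ
    have hcl : IsClosed {τ | G d m v ≤ F v τ} := isClosed_le continuous_const hv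
    have hsub : Metric.ball (d : T) (1 / ((m : ℝ) + 1)) ∩ D ⊆ {τ | G d m v ≤ F v τ} :=
      fun τ' hτ' => ciInf_le (hbdd d m v) ⟨⟨τ', hτ'.2⟩, hτ'.1⟩
    exact closure_minimal hsub hcl (hD.open_subset_closure_inter Metric.isOpen_ball hτ)
  have hall : ∀ᵐ e ∂Pr, ∀ d m, Tendsto (fun n : ℕ => (∑ i ∈ Finset.range n, G d m (W i e)) / n)
      atTop (𝓝 (∫ v, G d m v ∂μ)) :=
    ae_all_iff.2 fun d => ae_all_iff.2 fun m =>
      ae_tendsto_average hWm hWi hWl (hGm d m) (hGC d m)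
  have hcont : ∀ᵐ e ∂Pr, ∀ i, Continuous (F (W i e)) :=
    ae_all_iff.2 fun i => ae_of_ae_map (hWm i).aemeasurable (by rw [hWl i]; exact hFc)
  filter_upwards [hall, hcont] with e he hec k τ τ₀ hk hτ hle
  have hGle : ∀ (d : D) (m : ℕ), τ₀ ∈ Metric.ball (d : T) (1 / ((m : ℝ) + 1)) → ∫ v, G d m v ∂μ ≤ 1 := by
    intro d m hm
    refine le_of_tendsto ((he d m).comp hk) ?_
    filter_upwards [hτ.eventually_mem (Metric.isOpen_ball.mem_nhds hm)] with j hj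
    refine le_trans ?_ (hle j)
    simp only [Function.comp_apply]
    gcongr with i hi
    exact hGF _ (hec i) d m _ hj
  have hd : ∀ m : ℕ, ∃ d : D, τ₀ ∈ Metric.ball (d : T) (1 / ((m : ℝ) + 1)) := by
    intro m
    obtain ⟨d, hd, hd'⟩ := hD.exists_dist_lt τ₀ (hpos m)
    exact ⟨⟨d, hd⟩, hd'⟩
  choose d hd using hd
  -- As the balls containing `τ₀` shrink, their infima converge to `F v τ₀` by continuity, with `C`
  -- as dominating constant.
  have hlim : Tendsto (fun m => ∫ v, G (d m) m v ∂μ) atTop (𝓝 (∫ v, F v τ₀ ∂μ)) := by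
    refine tendsto_integral_of_dominated_convergence (fun _ => C)
      (fun m => (hGm _ _).aestronglyMeasurable) (integrable_const C)
      (fun m => ae_of_all _ fun v => hGC _ _ v) ?_
    filter_upwards [hFc] with v hv
    rw [Metric.tendsto_atTop]
    intro ε hε
    obtain ⟨δ, hδ, hδ'⟩ := Metric.continuousAt_iff.1 (hv.continuousAt (x := τ₀)) (ε / 2)
      (half_pos hε)
    obtain ⟨N, hN⟩ := exists_nat_one_div_lt (half_pos hδ)
    refine ⟨N, fun m hm => ?_⟩
    have hmN : 1 / ((m : ℝ) + 1) < δ / 2 :=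
      (one_div_le_one_div_of_le (by positivity) (by exact_mod_cast Nat.succ_le_succ hm)).trans_lt hN
    have h1 := hGF v hv (d m) m τ₀ (hd m)
    have h2 : F v τ₀ - ε / 2 ≤ G (d m) m v := by
      have : Nonempty {τ : D // (τ : T) ∈ Metric.ball (d m : T) (1 / ((m : ℝ) + 1))} :=
        ⟨⟨d m, hself _ _⟩⟩
      refine le_ciInf fun τ' => ?_
      have h3 : dist (τ'.1 : T) τ₀ < δ := by
        have h4 := dist_triangle_right (τ'.1 : T) τ₀ (d m : T)
        have h5 := Metric.mem_ball.1 τ'.2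
        have h6 := Metric.mem_ball.1 (hd m)
        linarith
      have := (abs_lt.1 (hδ' h3)).1
      linarith
    rw [Real.dist_eq, abs_lt]
    constructor <;> linarith
  exact le_of_tendsto' hlim fun m => hGle _ _ (hd m)

end UniformLaw

/-! ### Identification of limit points and sup-norm consistency. -/

section Consistency

open BoundedContinuousFunction

variable {t ζ D : ℝ}

theorem integral_withDensity_ofReal {p : Dom a b → ℝ} (hpm : Measurable p) (hp0 : ∀ x, 0 ≤ p x)
    (g : Dom a b → ℝ) :
    ∫ x, g x ∂((leb a b).withDensity fun x => ENNReal.ofReal (p x)) =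
      ∫ x, g x * p x ∂(leb a b) := by
  rw [integral_withDensity_eq_integral_toReal_smul hpm.ennreal_ofReal
    (ae_of_all _ fun x => ENNReal.ofReal_lt_top)]
  refine integral_congr_ae (ae_of_all _ fun x => ?_)
  simp only
  rw [ENNReal.toReal_ofReal (hp0 x), smul_eq_mul, mul_comm]

theorem eq_of_integral_sq_le_zero {h : Dom a b → ℝ} {p q : Dom a b → ℝ} (hp : Continuous p)
    (hq : Continuous q) (hh : Integrable h (leb a b)) (h0 : ∀ x, 0 ≤ h x)
    (hpq : ∀ x, h x = 0 → p x = q x) (hle : ∫ x, h x ∂(leb a b) ≤ 0) : p = q := by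
  have hz := (integral_eq_zero_iff_of_nonneg h0 hh).1
    (le_antisymm hle (integral_nonneg h0))
  exact (hp.ae_eq_iff_eq (leb a b) hq).1 (hz.mono fun x hx => hpq x hx)

/-- The information inequality behind the consistency of the estimators. -/
theorem eq_of_integral_div_le_one (hζ : 0 ≤ ζ) {p q : Dom a b → ℝ}
    (hp : p ∈ densities a b t ζ D) (hq : q ∈ densities a b t ζ D)
    (hle : ∫ x, 2 * p x / (q x + p x) * p x ∂(leb a b) ≤ 1) : q = p := by
  have hp0 : ∀ x, 0 ≤ p x := fun x => hζ.trans (hp.2.2.1 x)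
  have hq0 : ∀ x, 0 ≤ q x := fun x => hζ.trans (hq.2.2.1 x)
  have hpi := integrable_of_mem_densities hp
  have hqi := integrable_of_mem_densities hq
  have hpm := hp.1.1.measurable
  have hqm := hq.1.1.measurable
  have hbd : ∀ x, 2 * p x / (q x + p x) ≤ 2 := fun x =>
    div_le_of_le_mul₀ (add_nonneg (hq0 x) (hp0 x)) (by norm_num) (by linarith [hq0 x])
  have hi : Integrable (fun x => 2 * p x / (q x + p x) * p x) (leb a b) := by
    refine (hpi.const_mul 2).mono' (by fun_prop) (ae_of_all _ fun x => ?_)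
    have h1 : 0 ≤ 2 * p x / (q x + p x) :=
      div_nonneg (by linarith [hp0 x]) (add_nonneg (hq0 x) (hp0 x))
    rw [Real.norm_eq_abs, abs_of_nonneg (mul_nonneg h1 (hp0 x))]
    exact mul_le_mul_of_nonneg_right (hbd x) (hp0 x)
  have hi2 : Integrable (fun x => 3 / 2 * p x - 1 / 2 * q x) (leb a b) :=
    (hpi.const_mul _).sub (hqi.const_mul _)
  -- The linear function `3/2 p - 1/2 q` is the tangent of `2p²/(q + p)` along `q = p` and has
  -- integral one; the excess over it is a weighted square, whose integral can only be zero.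
  have hform : ∀ x, 2 * p x / (q x + p x) * p x - (3 / 2 * p x - 1 / 2 * q x) =
      (q x - p x) ^ 2 / (2 * (q x + p x)) := by
    intro x
    rcases (add_nonneg (hq0 x) (hp0 x)).eq_or_lt with h | h
    · have h1 : p x = 0 := by linarith [hq0 x, hp0 x]
      have h2 : q x = 0 := by linarith [hq0 x, hp0 x]
      simp [h1, h2]
    · field_simp
      ring
  refine eq_of_integral_sq_le_zero hq.1.1 hp.1.1 (hi.sub hi2) (fun x => ?_) (fun x hx => ?_) ?_
  · simp only [Pi.sub_apply]
    rw [hform]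
    exact div_nonneg (sq_nonneg _) (mul_nonneg two_pos.le (add_nonneg (hq0 x) (hp0 x)))
  · simp only [Pi.sub_apply] at hx
    rw [hform, div_eq_zero_iff] at hx
    rcases hx with hx | hx
    · exact sub_eq_zero.1 (pow_eq_zero_iff two_ne_zero |>.1 hx)
    · linarith [hq0 x, hp0 x]
  · simp only [Pi.sub_apply]
    rw [integral_sub hi hi2, integral_sub (hpi.const_mul _) (hqi.const_mul _), integral_const_mul,
      integral_const_mul, hp.2.1, hq.2.1]
    linarith

theorem IsDensity.integral_comp {V : Type*} [MeasurableSpace V] {μ : Measure V} {Θ : Type*}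
    {ρ : V → Θ → Dom a b} {pθ : Θ → Dom a b → ℝ} {θ : Θ} (hρm : Measurable fun v => ρ v θ)
    (h : IsDensity (μ.map fun v => ρ v θ) (pθ θ)) {g : Dom a b → ℝ} (hg : Measurable g) :
    ∫ v, g (ρ v θ) ∂μ = ∫ x, g x * pθ θ x ∂(leb a b) := by
  rw [← integral_withDensity_ofReal h.1 h.2.1, ← h.2.2,
    integral_map hρm.aemeasurable hg.aestronglyMeasurable]

variable {V : Type*} [MeasurableSpace V] {μ : Measure V} [IsProbabilityMeasure μ]
  {Θ : Type*} [PseudoMetricSpace Θ] {ρ : V → Θ → Dom a b} {pθ : Θ → Dom a b → ℝ}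

/-- The densities of the simulated data depend continuously on the parameter in the sup-norm. -/
theorem exists_continuous_extDensities (hab : a < b) (ht : 1 / 2 < t) (hζ : 0 ≤ ζ) (hD : 0 ≤ D)
    (hρm : ∀ θ, Measurable fun v => ρ v θ) (hρc : ∀ v, Continuous (ρ v))
    (hdens : ∀ θ, IsDensity (μ.map fun v => ρ v θ) (pθ θ))
    (hp : ∀ θ, pθ θ ∈ densities a b t ζ D) :
    ∃ Q : Θ → extDensities a b t ζ D, Continuous Q ∧
      ∀ θ x, (Q θ : Icc a b →ᵇ ℝ) (toIcc x) = pθ θ x := by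
  choose Q hQ hQp using fun θ => exists_extDensities hab ht hD (hp θ)
  have : CompactSpace (extDensities a b t ζ D) :=
    isCompact_iff_compactSpace.1 (isCompact_extDensities hab ht hζ hD)
  refine ⟨fun θ => ⟨Q θ, hQ θ⟩, ?_, hQp⟩
  refine continuous_iff_seqContinuous.2 fun θ θ₀ hθ => ?_
  refine tendsto_of_subseq_tendsto fun ns hns => ?_
  obtain ⟨R, φ, hφ, hR⟩ := CompactSpace.tendsto_subseq
    (fun n => (⟨Q (θ (ns n)), hQ _⟩ : extDensities a b t ζ D))
  refine ⟨φ, ?_⟩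
  have hθ' : Tendsto (fun n => θ (ns (φ n))) atTop (𝓝 θ₀) :=
    hθ.comp (hns.comp hφ.tendsto_atTop)
  have hR' : Tendsto (fun n => Q (θ (ns (φ n)))) atTop (𝓝 (R : Icc a b →ᵇ ℝ)) :=
    (continuous_subtype_val.tendsto _).comp hR
  have hRd : (fun x => (R : Icc a b →ᵇ ℝ) (toIcc x)) ∈ densities a b t ζ D := R.2
  set r : Dom a b → ℝ := fun x => (R : Icc a b →ᵇ ℝ) (toIcc x) with hr
  -- The limit is identified by testing with `g = r - pθ θ₀` itself: `∫ g pθ` converges to `∫ g pθ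
  -- θ₀` because the simulated points converge, and to `∫ g r` by uniform convergence, so `∫ g² =
  -- 0`.
  have key : r = pθ θ₀ := by
    set g : Dom a b → ℝ := fun x => r x - pθ θ₀ x with hg
    have hgc : Continuous g := hRd.1.1.sub (hp θ₀).1.1
    obtain ⟨B, hB⟩ := hRd.1.2.1
    obtain ⟨B', hB'⟩ := (hp θ₀).1.2.1
    have hgb : ∀ x, |g x| ≤ B + B' := fun x => (abs_sub _ _).trans (add_le_add (hB x) (hB' x))
    have hpi : ∀ θ, Integrable (fun x => g x * pθ θ x) (leb a b) := fun θ =>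
      (integrable_of_mem_densities (hp θ)).bdd_mul hgc.aestronglyMeasurable (ae_of_all _ hgb)
    have hri : Integrable (fun x => g x * r x) (leb a b) :=
      (integrable_of_mem_densities hRd).bdd_mul hgc.aestronglyMeasurable (ae_of_all _ hgb)
    have l1 : Tendsto (fun n => ∫ x, g x * pθ (θ (ns (φ n))) x ∂(leb a b)) atTop
        (𝓝 (∫ x, g x * pθ θ₀ x ∂(leb a b))) := by
      simp_rw [← fun θ => (hdens θ).integral_comp (hρm θ) hgc.measurable]
      refine tendsto_integral_of_dominated_convergence (fun _ => B + B')
        (fun n => (hgc.measurable.comp (hρm _)).aestronglyMeasurable) (integrable_const _)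
        (fun n => ae_of_all _ fun v => hgb _) (ae_of_all _ fun v => ?_)
      exact ((hgc.comp (hρc v)).tendsto θ₀).comp hθ'
    have l2 : Tendsto (fun n => ∫ x, g x * pθ (θ (ns (φ n))) x ∂(leb a b)) atTop
        (𝓝 (∫ x, g x * r x ∂(leb a b))) := by
      refine tendsto_integral_of_forall_abs_sub_le (fun n => hpi _) hri
        (κ := fun n => (B + B') * dist (Q (θ (ns (φ n)))) R)
        (by simpa using (tendsto_iff_dist_tendsto_zero.1 hR').const_mul (B + B')) fun n x => ?_
      rw [← mul_sub, abs_mul]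
      refine mul_le_mul (hgb x) ?_ (abs_nonneg _) ((abs_nonneg _).trans (hgb x))
      rw [← hQp, ← Real.dist_eq]
      exact dist_coe_le_dist _
    have e := tendsto_nhds_unique l1 l2
    have hsq : ∫ x, g x * g x ∂(leb a b) = 0 := by
      have e1 : ∀ x, g x * g x = g x * r x - g x * pθ θ₀ x := fun x => by
        simp only [hg]
        ring
      simp_rw [e1]
      rw [integral_sub hri (hpi _), e, sub_self]
    refine eq_of_integral_sq_le_zero hRd.1.1 (hp θ₀).1.1 (h := fun x => g x * g x) ?_
      (fun x => mul_self_nonneg _) (fun x hx => sub_eq_zero.1 (mul_self_eq_zero.1 hx)) hsq.le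
    exact (integrable_of_continuous_bdd hgc hgb).bdd_mul hgc.aestronglyMeasurable (ae_of_all _ hgb)
  have hfin : (R : Icc a b →ᵇ ℝ) = Q θ₀ := by
    refine dist_le_zero.1 (dist_le_of_forall_toIcc hab le_rfl fun x => ?_)
    rw [hQp, ← key, hr]
    simp
  have : R = ⟨Q θ₀, hQ θ₀⟩ := Subtype.ext hfin
  rw [this] at hR
  exact hR

variable {S : Type*} [MeasurableSpace S] {Pr : Measure S} [IsProbabilityMeasure Pr] {W : ℕ → S → V}

/-- Uniform consistency of the estimators in the sup-norm over a compact set of parameters. -/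
theorem ae_tendsto_supNorm [CompactSpace Θ] (hab : a < b) (ht : 1 / 2 < t) (hζ : 0 ≤ ζ)
    (hD : 0 ≤ D) (hρm : ∀ θ, Measurable fun v => ρ v θ) (hρc : ∀ v, Continuous (ρ v))
    (hdens : ∀ θ, IsDensity (μ.map fun v => ρ v θ) (pθ θ))
    (hp : ∀ θ, pθ θ ∈ densities a b t ζ D) (hpos : ∀ᵐ v ∂μ, ∀ θ, 0 < pθ θ (ρ v θ))
    (hWm : ∀ i, Measurable (W i)) (hWi : iIndepFun W Pr) (hWl : ∀ i, Pr.map (W i) = μ) :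
    ∀ᵐ e ∂Pr, ∀ q : ℕ → Θ → Dom a b → ℝ,
      (∀ k, 0 < k → ∀ θ, IsNPML t ζ D (fun i : Fin k => ρ (W i e) θ) (q k θ)) →
      Tendsto (fun z : ℕ × Θ => supNorm (q z.1 z.2 - pθ z.2)) (atTop ×ˢ ⊤) (𝓝 0) := by
  obtain ⟨Q, hQc, hQ⟩ := exists_continuous_extDensities hab ht hζ hD hρm hρc hdens hp
  have : CompactSpace (extDensities a b t ζ D) :=
    isCompact_iff_compactSpace.1 (isCompact_extDensities hab ht hζ hD)
  -- The candidate density is part of the parameter, so the exceptional null set does not depend on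
  -- the choice of estimators and these need not be measurable.
  set F : V → Θ × extDensities a b t ζ D → ℝ := fun v τ =>
    2 * (Q τ.1 : Icc a b →ᵇ ℝ) (toIcc (ρ v τ.1)) / ((τ.2 : Icc a b →ᵇ ℝ) (toIcc (ρ v τ.1)) +
      (Q τ.1 : Icc a b →ᵇ ℝ) (toIcc (ρ v τ.1))) with hF
  have hnn : ∀ (R : extDensities a b t ζ D) x, 0 ≤ (R : Icc a b →ᵇ ℝ) (toIcc x) :=
    fun R x => hζ.trans (R.2.2.2.1 x)
  have hti : Continuous (toIcc : Dom a b → Icc a b) := isometry_toIcc.continuous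
  have hFm : ∀ τ, Measurable fun v => F v τ := by
    intro τ
    have h1 : Measurable fun v => (Q τ.1 : Icc a b →ᵇ ℝ) (toIcc (ρ v τ.1)) :=
      ((map_continuous _).comp hti).measurable.comp (hρm _)
    have h2 : Measurable fun v => (τ.2 : Icc a b →ᵇ ℝ) (toIcc (ρ v τ.1)) :=
      ((map_continuous _).comp hti).measurable.comp (hρm _)
    exact (h1.const_mul 2).div (h2.add h1)
  have hFc : ∀ᵐ v ∂μ, Continuous (F v) := by
    filter_upwards [hpos] with v hv
    have hx : Continuous fun τ : Θ × extDensities a b t ζ D => toIcc (ρ v τ.1) :=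
      hti.comp ((hρc v).comp continuous_fst)
    have h1 : Continuous fun τ : Θ × extDensities a b t ζ D =>
        (Q τ.1 : Icc a b →ᵇ ℝ) (toIcc (ρ v τ.1)) :=
      continuous_eval.comp ((continuous_subtype_val.comp (hQc.comp continuous_fst)).prodMk hx)
    have h2 : Continuous fun τ : Θ × extDensities a b t ζ D =>
        (τ.2 : Icc a b →ᵇ ℝ) (toIcc (ρ v τ.1)) :=
      continuous_eval.comp ((continuous_subtype_val.comp continuous_snd).prodMk hx)
    refine (continuous_const.mul h1).div (h2.add h1) fun τ => ?_
    have h3 := hnn τ.2 (ρ v τ.1)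
    have h4 := hv τ.1
    rw [← hQ] at h4
    linarith
  have hF0 : ∀ v τ, 0 ≤ F v τ := fun v τ =>
    div_nonneg (mul_nonneg two_pos.le (hnn _ _)) (add_nonneg (hnn _ _) (hnn _ _))
  have hF2 : ∀ v τ, F v τ ≤ 2 := fun v τ =>
    div_le_of_le_mul₀ (add_nonneg (hnn _ _) (hnn _ _)) (by norm_num)
      (by linarith [hnn τ.2 (ρ v τ.1)])
  have hgood : ∀ᵐ e ∂Pr, ∀ i, ∀ θ, 0 < pθ θ (ρ (W i e) θ) :=
    ae_all_iff.2 fun i => ae_of_ae_map (hWm i).aemeasurable (by rw [hWl i]; exact hpos)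
  filter_upwards [ae_forall_integral_le_one hWm hWi hWl hFm hF0 hF2 hFc, hgood] with e he hge q hq
  by_contra hcon
  rw [ENNReal.tendsto_nhds_zero] at hcon
  push Not at hcon
  obtain ⟨ε, hε, hfreq⟩ := hcon
  have hex : ∀ j : ℕ, ∃ k : ℕ, ∃ θ : Θ, j < k ∧ ε < supNorm (q k θ - pθ θ) := by
    intro j
    have hev : ∀ᶠ z : ℕ × Θ in atTop ×ˢ ⊤, j < z.1 := (eventually_gt_atTop j).prod_inl _
    obtain ⟨z, hz, hz'⟩ := (hfreq.and_eventually hev).exists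
    exact ⟨z.1, z.2, hz', hz⟩
  choose k θ hk hkε using hex
  choose R hR hRq using fun j =>
    exists_extDensities hab ht hD (hq (k j) ((Nat.zero_le j).trans_lt (hk j)) (θ j)).1
  -- Parameters and estimators violating uniform convergence accumulate at some `(θ₀, R₀)`. The
  -- likelihood inequality survives in the limit and gives `R₀ = Q θ₀`, against the error bound `ε`.
  obtain ⟨⟨θ₀, R₀⟩, φ, hφ, hlim⟩ := CompactSpace.tendsto_subseq
    (fun j => ((θ j, ⟨R j, hR j⟩) : Θ × extDensities a b t ζ D))
  have hkt : Tendsto (fun j => k (φ j)) atTop atTop :=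
    (tendsto_atTop_mono (fun j => (hk j).le) tendsto_id).comp hφ.tendsto_atTop
  have hle := he (fun j => k (φ j)) _ _ hkt hlim fun j => by
    have hk0 : 0 < k (φ j) := (Nat.zero_le _).trans_lt (hk (φ j))
    have := (hq (k (φ j)) hk0 (θ (φ j))).sum_div_le hab hζ hD hk0 (hp (θ (φ j)))
      fun i => hge i (θ (φ j))
    rw [div_le_one (by exact_mod_cast hk0), Finset.sum_range]
    refine le_trans (le_of_eq ?_) this
    refine Finset.sum_congr rfl fun i _ => ?_
    simp only [hF, Function.comp_apply, hQ, hRq]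
  have heq : (fun x => (R₀ : Icc a b →ᵇ ℝ) (toIcc x)) = pθ θ₀ := by
    refine eq_of_integral_div_le_one hζ (hp θ₀) R₀.2 ?_
    refine le_trans (le_of_eq ?_) hle
    have hg : Measurable fun x => 2 * pθ θ₀ x / ((R₀ : Icc a b →ᵇ ℝ) (toIcc x) + pθ θ₀ x) := by
      have h1 := (hp θ₀).1.1.measurable
      have h2 : Measurable fun x : Dom a b => (R₀ : Icc a b →ᵇ ℝ) (toIcc x) := R₀.2.1.1.measurable
      fun_prop
    rw [← (hdens θ₀).integral_comp (hρm θ₀) hg]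
    simp only [hF, hQ]
  have hR₀ : (R₀ : Icc a b →ᵇ ℝ) = Q θ₀ := by
    refine dist_le_zero.1 (dist_le_of_forall_toIcc hab le_rfl fun x => ?_)
    rw [hQ, ← heq]
    simp
  have hd : Tendsto (fun j => dist (R (φ j)) (Q (θ (φ j)) : Icc a b →ᵇ ℝ)) atTop (𝓝 0) := by
    have h1 : Tendsto (fun j => R (φ j)) atTop (𝓝 (R₀ : Icc a b →ᵇ ℝ)) :=
      (continuous_subtype_val.tendsto _).comp ((continuous_snd.tendsto _).comp hlim)
    have h2 : Tendsto (fun j => (Q (θ (φ j)) : Icc a b →ᵇ ℝ)) atTop (𝓝 (Q θ₀ : Icc a b →ᵇ ℝ)) :=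
      ((continuous_subtype_val.comp hQc).tendsto _).comp ((continuous_fst.tendsto _).comp hlim)
    have := h1.dist h2
    rwa [hR₀, dist_self] at this
  have hsup : ∀ j, supNorm (q (k j) (θ j) - pθ (θ j)) ≤
      ENNReal.ofReal (dist (R j) (Q (θ j) : Icc a b →ᵇ ℝ)) := by
    intro j
    refine iSup_le fun x => ?_
    rw [Pi.sub_apply, ← hRq, ← hQ, Real.enorm_eq_ofReal_abs, ← Real.dist_eq]
    exact ENNReal.ofReal_le_ofReal (dist_coe_le_dist _)
  have hd' := ENNReal.tendsto_ofReal hd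
  rw [ENNReal.ofReal_zero] at hd'
  obtain ⟨j, hj⟩ := (hd'.eventually_lt_const hε).exists
  exact absurd ((hkε (φ j)).trans_le (hsup (φ j))) (not_lt.2 hj.le)

end Consistency

/-! ### From the sup-norm to Sobolev norms, and the assembled theorems. -/

section Main

variable {t ζ D : ℝ} {V : Type*} [MeasurableSpace V] {μ : Measure V} [IsProbabilityMeasure μ]
  {S : Type*} [MeasurableSpace S] {Pr : Measure S} [IsProbabilityMeasure Pr] {W : ℕ → S → V}

theorem tendsto_iSup_of_prod_top {Θ : Type*} {f : ℕ × Θ → ℝ≥0∞}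
    (h : Tendsto f (atTop ×ˢ ⊤) (𝓝 0)) : Tendsto (fun k => ⨆ θ, f (k, θ)) atTop (𝓝 0) := by
  rw [ENNReal.tendsto_nhds_zero] at h ⊢
  intro ε hε
  have := h ε hε
  rw [← principal_univ, eventually_prod_principal_iff] at this
  filter_upwards [this] with k hk
  exact iSup_le fun θ => hk θ (mem_univ _)

theorem tendsto_sobolevNorm_sub_prod {Θ : Type*} (hab : a < b) (hD : 0 ≤ D) {s : ℝ} (hs : 0 ≤ s)
    (hst : s < t) {q : ℕ × Θ → Dom a b → ℝ} {p : Θ → Dom a b → ℝ}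
    (hq : ∀ z : ℕ × Θ, 0 < z.1 → q z ∈ densities a b t ζ D) (hp : ∀ θ, p θ ∈ densities a b t ζ D)
    (h : Tendsto (fun z : ℕ × Θ => supNorm (q z - p z.2)) (atTop ×ˢ ⊤) (𝓝 0)) :
    Tendsto (fun z : ℕ × Θ => sobolevNorm s (q z - p z.2)) (atTop ×ˢ ⊤) (𝓝 0) := by
  -- Nothing is assumed about `q` for an empty sample; the true density is substituted there, which
  -- does not affect the limit.
  set q' : ℕ × Θ → Dom a b → ℝ := fun z => if 0 < z.1 then q z else p z.2 with hq'
  have hev : ∀ᶠ z : ℕ × Θ in atTop ×ˢ ⊤, q z = q' z := by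
    filter_upwards [(eventually_gt_atTop 0).prod_inl (⊤ : Filter Θ)] with z hz
    rw [hq']
    exact (if_pos hz).symm
  have hmem : ∀ z, q' z ∈ densities a b t ζ D := by
    intro z
    by_cases hz : 0 < z.1
    · rw [hq']
      simp only [hz, if_true]
      exact hq z hz
    · rw [hq']
      simp only [hz, if_false]
      exact hp z.2
  have h' : Tendsto (fun z : ℕ × Θ => supNorm (q' z - p z.2)) (atTop ×ˢ ⊤) (𝓝 0) :=
    h.congr' (hev.mono fun z hz => by rw [hz])
  exact (tendsto_sobolevNorm_sub hab hD hs hst hmem (fun z => hp z.2) h').congr'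
    (hev.mono fun z hz => by simp only [hz])

theorem consistency_uniform {Θ : Type*} [PseudoMetricSpace Θ] [CompactSpace Θ]
    {ρ : V → Θ → Dom a b} {pθ : Θ → Dom a b → ℝ} (hab : a < b) (ht : 1 / 2 < t) (hζ : 0 ≤ ζ)
    (hD : 0 ≤ D) (hρm : ∀ θ, Measurable fun v => ρ v θ) (hρc : ∀ v, Continuous (ρ v))
    (hdens : ∀ θ, IsDensity (μ.map fun v => ρ v θ) (pθ θ))
    (hp : ∀ θ, pθ θ ∈ densities a b t ζ D) (hpos : ∀ᵐ v ∂μ, ∀ θ, 0 < pθ θ (ρ v θ))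
    (hWm : ∀ i, Measurable (W i)) (hWi : iIndepFun W Pr) (hWl : ∀ i, Pr.map (W i) = μ)
    (ptilde : (k : ℕ) → Θ → (Fin k → V) → Dom a b → ℝ)
    (hpt : ∀ k, 0 < k → ∀ θ v, IsNPML t ζ D (fun i => ρ (v i) θ) (ptilde k θ v)) :
    (∀ s, 0 ≤ s → s < t → ∀ᵐ e ∂Pr,
      Tendsto (fun k => ⨆ θ, sobolevNorm s (ptilde k θ (fun i => W i e) - pθ θ)) atTop (𝓝 0)) ∧
    (∀ᵐ e ∂Pr,
      Tendsto (fun k => ⨆ θ, supNorm (ptilde k θ (fun i => W i e) - pθ θ)) atTop (𝓝 0)) := by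
  have key := ae_tendsto_supNorm hab ht hζ hD hρm hρc hdens hp hpos hWm hWi hWl
  refine ⟨fun s hs hst => ?_, ?_⟩
  · filter_upwards [key] with e he
    have h1 := he (fun k θ => ptilde k θ fun i => W i e) fun k hk θ => hpt k hk θ fun i => W i e
    have h2 : ∀ z : ℕ × Θ, 0 < z.1 → ptilde z.1 z.2 (fun i => W i e) ∈ densities a b t ζ D :=
      fun z hz => (hpt z.1 hz z.2 fun i => W i e).1
    have h3 := tendsto_sobolevNorm_sub_prod (q := fun z : ℕ × Θ => ptilde z.1 z.2 fun i => W i e)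
      hab hD hs hst h2 hp h1
    have h4 := tendsto_iSup_of_prod_top h3
    exact h4
  · filter_upwards [key] with e he
    have h1 := tendsto_iSup_of_prod_top
      (he (fun k θ => ptilde k θ fun i => W i e) fun k hk θ => hpt k hk θ fun i => W i e)
    exact h1

/-- With a one-point parameter space continuity is trivial, and no lower bound on `p` is needed:
under its own law, a density is almost surely positive at the data. -/
theorem consistency_single {ρ : V → Dom a b} {p : Dom a b → ℝ} (hab : a < b) (ht : 1 / 2 < t)
    (hζ : 0 ≤ ζ) (hD : 0 ≤ D) (hρm : Measurable ρ) (hdens : IsDensity (μ.map ρ) p)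
    (hp : p ∈ densities a b t ζ D) (hWm : ∀ i, Measurable (W i)) (hWi : iIndepFun W Pr)
    (hWl : ∀ i, Pr.map (W i) = μ) (ptilde : (k : ℕ) → (Fin k → V) → Dom a b → ℝ)
    (hpt : ∀ k, 0 < k → ∀ v, IsNPML t ζ D (fun i => ρ (v i)) (ptilde k v)) :
    (∀ s, 0 ≤ s → s < t → ∀ᵐ e ∂Pr,
      Tendsto (fun k => sobolevNorm s (ptilde k (fun i => W i e) - p)) atTop (𝓝 0)) ∧
    (∀ᵐ e ∂Pr, Tendsto (fun k => supNorm (ptilde k (fun i => W i e) - p)) atTop (𝓝 0)) := by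
  have hpos : ∀ᵐ x ∂(μ.map ρ), 0 < p x := by
    rw [hdens.2.2, ae_withDensity_iff hdens.1.ennreal_ofReal]
    refine ae_of_all _ fun x hx => ?_
    simpa using hx
  have hpos' : ∀ᵐ v ∂μ, ∀ _ : Unit, 0 < p (ρ v) :=
    (ae_of_ae_map hρm.aemeasurable hpos).mono fun v hv _ => hv
  simpa using consistency_uniform (Θ := Unit) (ρ := fun v _ => ρ v) (pθ := fun _ => p) hab ht hζ hD
    (fun _ => hρm) (fun _ => continuous_const) (fun _ => hdens) (fun _ => hp) hpos' hWm hWi hWl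
    (fun k _ v => ptilde k v) fun k hk _ v => hpt k hk v

end Main

end NPML

theorem mainTheorem6
    -- the interval and the constants of the non-parametric model
    (a b t ζ D : ℝ) (hab : a < b) (ht : 1 / 2 < t) (hζ : 0 ≤ ζ) (hζb : ζ < (b - a)⁻¹)
    (hD : 0 < D) (hDb : (b - a)⁻¹ < D ^ 2)
    -- the underlying probability space and the i.i.d. data with common law `P`
    {S : Type*} [MeasurableSpace S] (Pr : Measure S) [IsProbabilityMeasure Pr]
    (P : Measure (NPML.Dom a b)) [IsProbabilityMeasure P]
    (X : ℕ → S → NPML.Dom a b) (hXm : ∀ i, Measurable (X i)) (hXi : iIndepFun X Pr)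
    (hXl : ∀ i, Pr.map (X i) = P)
    -- the parametric model
    (m : ℕ) (Θ : Set (EuclideanSpace ℝ (Fin m))) (hΘ : IsCompact Θ) (hΘne : Θ.Nonempty)
    (pθ : Θ → NPML.Dom a b → ℝ)
    -- the simulation mechanism and the i.i.d. simulated variables with common law `μ`
    {V : Type*} [MeasurableSpace V] (μ : Measure V) [IsProbabilityMeasure μ]
    (ρ : V → Θ → NPML.Dom a b) (hρm : ∀ θ, Measurable (fun v => ρ v θ))
    (hρl : ∀ θ, NPML.IsDensity (μ.map (fun v => ρ v θ)) (pθ θ))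
    (W : ℕ → S → V) (hWm : ∀ i, Measurable (W i)) (hWi : iIndepFun W Pr)
    (hWl : ∀ i, Pr.map (W i) = μ) :
    -- NPML-estimators exist
    (∀ n : ℕ, 0 < n → ∀ x : Fin n → NPML.Dom a b, ∃ p, NPML.IsNPML t ζ D x p) ∧
    -- (a)
    (∀ p₀ : NPML.Dom a b → ℝ, NPML.IsDensity P p₀ → p₀ ∈ NPML.densities a b t ζ D →
      ∀ phat : (n : ℕ) → (Fin n → NPML.Dom a b) → NPML.Dom a b → ℝ,
        (∀ n, 0 < n → ∀ x, NPML.IsNPML t ζ D x (phat n x)) →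
        (∀ s, 0 ≤ s → s < t → ∀ᵐ e ∂Pr,
          Tendsto (fun n => NPML.sobolevNorm s (phat n (fun i => X i e) - p₀)) atTop (𝓝 0)) ∧
        (∀ᵐ e ∂Pr,
          Tendsto (fun n => NPML.supNorm (phat n (fun i => X i e) - p₀)) atTop (𝓝 0))) ∧
    -- (b)
    (∀ θ : Θ, pθ θ ∈ NPML.densities a b t ζ D →
      ∀ ptilde : (k : ℕ) → (Fin k → V) → NPML.Dom a b → ℝ,
        (∀ k, 0 < k → ∀ v, NPML.IsNPML t ζ D (fun i => ρ (v i) θ) (ptilde k v)) →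
        (∀ s, 0 ≤ s → s < t → ∀ᵐ e ∂Pr,
          Tendsto (fun k => NPML.sobolevNorm s (ptilde k (fun i => W i e) - pθ θ))
            atTop (𝓝 0)) ∧
        (∀ᵐ e ∂Pr,
          Tendsto (fun k => NPML.supNorm (ptilde k (fun i => W i e) - pθ θ)) atTop (𝓝 0))) ∧
    -- (c)
    ((∀ θ, pθ θ ∈ NPML.densities a b t ζ D) → (∃ c > 0, ∀ θ x, c ≤ pθ θ x) →
      (∀ v, Continuous (fun θ => ρ v θ)) →
      ∀ ptilde : (k : ℕ) → Θ → (Fin k → V) → NPML.Dom a b → ℝ,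
        (∀ k, 0 < k → ∀ θ v, NPML.IsNPML t ζ D (fun i => ρ (v i) θ) (ptilde k θ v)) →
        (∀ s, 0 ≤ s → s < t → ∀ᵐ e ∂Pr,
          Tendsto (fun k => ⨆ θ, NPML.sobolevNorm s (ptilde k θ (fun i => W i e) - pθ θ))
            atTop (𝓝 0)) ∧
        (∀ᵐ e ∂Pr,
          Tendsto (fun k => ⨆ θ, NPML.supNorm (ptilde k θ (fun i => W i e) - pθ θ))
            atTop (𝓝 0))) := by
  refine ⟨fun n hn x => NPML.exists_isNPML hab ht hζ hζb hD hDb hn x, fun p₀ hp₀ hp₀d phat hphat => ?_, fun θ hθ ptilde hpt => ?_,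
    fun hdens hc hρc ptilde hpt => ?_⟩
  -- Observed data are simulated data whose simulation map is the identity.
  · exact NPML.consistency_single hab ht hζ hD.le measurable_id (by simpa using hp₀) hp₀d hXm hXi hXl phat hphat
  · exact NPML.consistency_single hab ht hζ hD.le (hρm θ) (hρl θ) hθ hWm hWi hWl ptilde hpt
  · have : CompactSpace Θ := isCompact_iff_compactSpace.1 hΘ
    obtain ⟨c, hc0, hc⟩ := hc
    exact NPML.consistency_uniform hab ht hζ hD.le hρm hρc hρl hdens
      (ae_of_all _ fun v θ => hc0.trans_le (hc θ _)) hWm hWi hWl ptilde hpt
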